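/- **Multi-Hamiltonian structure of the vector Kaup–Newell hierarchy.** Let $N\ge 0$ be an integer, $\alpha\in\mathbb C$, and let $\omega=(\mathbf q,\mathbf r)$ be a pair of Schwartz functions $\mathbb R\to\mathbb C^N$. Put $$U(\lambda)=i\lambda^{-2}\sigma_3+\lambda^{-1}Q,\quad \sigma_3=\mathrm{diag}(1,-I_N),\quad Q=\begin{pmatrix}0&\mathbf r^T\\ \mathbf q&0\end{pmatrix},\quad W=\begin{pmatrix}a&\mathbf c^T\\ \mathbf b&\mathbf d\end{pmatrix},\quad S=\begin{pmatrix}0&I_N\\I_N&0\end{pmatrix},\quad J=\begin{pmatrix}0&\partial\\ \partial&0\end{pmatrix}.$$ Here $\partial^{-1}f(x)=\frac12\big(\int_{-\infty}^x f-\int_x^\infty f\big)$, and for a rapidly decreasing matrix function $X$, $(\partial-s\,\mathrm{ad}_X)^{-1}F$ is the mean of the two solutions $D$ of $D_x-s[X,D]=F$ that vanish at $-\infty$ and at $+\infty$ respectively. Operators act on pairs of functions $\mathbb R\to\mathbb C^N$, the pairing is $\langle g,f\rangle=\int (g_1^Tf_1+g_2^Tf_2)\,dx$, and $T$ is skew-symmetric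 on $f,g$ if $\langle g,Tf\rangle=-\langle f,Tg\rangle$, both integrals converging. $\delta H/\delta\omega=G$ at $\omega$ on a set $P$ of pairs $\omega$ means: for each curve $\gamma$ in $P$ with $\gamma(0)=\omega$ that is differentiable at $0$ in the Schwartz topology with derivative $\varphi$, $\frac{d}{d\varepsilon}H(\gamma(\varepsilon))|_{\varepsilon=0}=\langle G,\varphi\rangle$. *Positive hierarchy.* Let $a_0=i\alpha$, $\mathbf d_0=-i\alpha I_N$, $\mathbf b_0=\alpha\mathbf q$, $\mathbf c_0=\alpha\mathbf r$ and, for $i\ge0$, $$a_{i+1}=\tfrac i2\partial^{-1}(\mathbf r^T\mathbf b_{i,x}+\mathbf c_{i,x}^T\mathbf q),\quad \mathbf d_{i+1}=-\tfrac i2\big(\partial-\tfrac i2\mathrm{ad}_{\mathbf q\mathbf r^T}\big)^{-1}(\mathbf b_{i,x}\mathbf r^T+\mathbf q\mathbf c_{i,x}^T),$$ $$i\,\mathbf b_{i+1}=-\tfrac12\mathbf b_{i,x}+\tfrac12(a_{i+1}\mathbf q-\mathbf d_{i+1}\mathbf q),\quad i\,\mathbf c_{i+1}=\tfrac12\mathbf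 c_{i,x}-\tfrac12(\mathbf d_{i+1}^T\mathbf r-a_{i+1}\mathbf r)$$ (a factor $i$ is the imaginary unit, an index $i$ an integer). Let $$L=SL_1S\partial,\qquad L_1=\frac i2\begin{pmatrix}I_N&0\\0&-I_N\end{pmatrix}+\frac14\begin{pmatrix}\mathbf q\partial^{-1}\mathbf r^T+A&\mathbf q\partial^{-1}\mathbf q^T+C\\ \mathbf r\partial^{-1}\mathbf r^T+D&\mathbf r\partial^{-1}\mathbf q^T+B\end{pmatrix},$$ $A=[(\partial-\frac i2\mathrm{ad}_{\mathbf q\mathbf r^T})^{-1}((\cdot)\mathbf r^T)]\mathbf q$, $B=[(\partial+\frac i2\mathrm{ad}_{\mathbf r\mathbf q^T})^{-1}((\cdot)\mathbf q^T)]\mathbf r$, $C=[(\partial-\frac i2\mathrm{ad}_{\mathbf q\mathbf r^T})^{-1}(\mathbf q(\cdot)^T)]\mathbf q$, $D=[(\partial+\frac i2\mathrm{ad}_{\mathbf r\mathbf q^T})^{-1}(\mathbf r(\cdot)^T)]\mathbf r$. Then: 1. $W=\sum_i\begin{pmatrix}a_i\lambda^{2i}&\mathbf c_i^T\lambda^{2i+1}\\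 \mathbf b_i\lambda^{2i+1}&\mathbf d_i\lambda^{2i}\end{pmatrix}$ satisfies $W_x=[U,W]$ as a formal series. 2. $L$ maps pairs of Schwartz functions to pairs of Schwartz functions, and $JL^k$ ($k\ge0$; in particular $J$) is skew-symmetric on them. 3. With $H_0^+=\alpha\int\mathbf q^T\mathbf r\,dx$ and $H_n^+=-\frac1{2n}\int\big[2i(a_{n+1}-\mathrm{tr}\,\mathbf d_{n+1})+\mathbf c_n^T\mathbf q+\mathbf r^T\mathbf b_n\big]dx$ for $n\ge1$ (convergent integrals), one has, on the set of all pairs of Schwartz functions, $\frac{\delta H_n^+}{\delta\omega}=\binom{\mathbf c_n}{\mathbf b_n}=L^k\frac{\delta H_{n-k}^+}{\delta\omega}$ for $0\le k\le n$. 4. With $V=(\lambda^{-2n-2}W)_-$ (the negative powers of $\lambda$), a time-dependent $\omega$ satisfies $U_t-V_x+[U,V]=0$ for all $\lambda\ne0$ if and only if $\omega_t=J\frac{\delta H_n^+}{\delta\omega}$ $\big(=JL^n\frac{\delta H_0^+}{\delta\omega}\big)$. *Negative hierarchy.* Let now $a_0=\frac\alpha2$, $\mathbf d_0=-\frac\alpha2I_N$,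 $\mathbf b_0=\alpha\partial^{-1}\mathbf q$, $\mathbf c_0=-\alpha\partial^{-1}\mathbf r$ and, for $i\ge1$, $a_i=\partial^{-1}(\mathbf r^T\mathbf b_{i-1}-\mathbf c_{i-1}^T\mathbf q)$, $\mathbf d_i=\partial^{-1}(\mathbf q\mathbf c_{i-1}^T-\mathbf b_{i-1}\mathbf r^T)$, $\mathbf b_i=\partial^{-1}(-2i\mathbf b_{i-1}+a_i\mathbf q-\mathbf d_i\mathbf q)$, $\mathbf c_i=\partial^{-1}(2i\mathbf c_{i-1}+\mathbf d_i^T\mathbf r-a_i\mathbf r)$. Let $$K=\partial^{-1}SL_2S,\qquad L_2=-2i\begin{pmatrix}I_N&0\\0&-I_N\end{pmatrix}+\begin{pmatrix}\mathbf q\partial^{-1}\mathbf r^T+(\sum_kq_k\partial^{-1}r_k)I_N&-\mathbf q\partial^{-1}\mathbf q^T-(\mathbf q\partial^{-1}\mathbf q^T)^T\\-\mathbf r\partial^{-1}\mathbf r^T-(\mathbf r\partial^{-1}\mathbf r^T)^T&\mathbf r\partial^{-1}\mathbf q^T+(\sum_kr_k\partial^{-1}q_k)I_N\end{pmatrix}.$$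 Let $P_n$ be the set of $\omega$ such that $\mathbf b_j,\mathbf c_j$ are Schwartz functions for all $j<n$ (so that the integrals defining the coefficients up to $\mathbf b_n,\mathbf c_n$ converge). Then: 5. For every $\omega$, $JK^k$ is skew-symmetric on all pairs of Schwartz functions $f,g$ for which $K^jf,K^jg$ ($j<k$) are Schwartz. 6. If $\omega\in P_n$, then $W=\sum_i\begin{pmatrix}a_i\lambda^{-2i}&\mathbf c_i^T\lambda^{-2i-1}\\ \mathbf b_i\lambda^{-2i-1}&\mathbf d_i\lambda^{-2i}\end{pmatrix}$ satisfies $W_x=[U,W]$ in all powers $\lambda^k$ with $k\ge-2n-2$. 7. With $H_n^-=\frac1{2(n+1)}\int\big[2i(a_n-\mathrm{tr}\,\mathbf d_n)+\mathbf c_n^T\mathbf q+\mathbf r^T\mathbf b_n\big]dx$ (for $n=0$ without the constant term $2i(a_0-\mathrm{tr}\,\mathbf d_0)$), the integral converges on $P_n$, and for $\omega\in P_n$ one has, on $P_n$, $\frac{\delta H_n^-}{\delta\omega}=\binom{\mathbf c_n}{\mathbf b_n}$, and $\binom{\mathbf c_n}{\mathbf b_n}=K^k\binom{\mathbf c_{n-k}}{\mathbf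 b_{n-k}}$ for $0\le k\le n$. 8. With $V=(\lambda^{2n}W)_+$ (the nonnegative powers), a time-dependent $\omega$ with values in $P_n$ satisfies $U_t-V_x+[U,V]=0$ for all $\lambda\ne0$ if and only if $\omega_t=-J\binom{\mathbf c_n}{\mathbf b_n}$, that is, $\omega_t=-J\frac{\delta H_n^-}{\delta\omega}=-JK^n\frac{\delta H_0^-}{\delta\omega}$. *First negative flow.* Let $N=2$, $\alpha=\frac i2$, $\sigma=\pm1$, let $u_1(t,\cdot),u_2(t,\cdot)$ be Schwartz functions, and $\mathbf q=(u_{1,x},u_{2,x})^T$, $\mathbf r=(u_{1,x}^*,\sigma u_{2,x}^*)^T$. Then $\omega\in P_1$ for all $t$, and the flow $\omega_t=-J\frac{\delta H_1^-}{\delta\omega}$ is equivalent to the coupled Fokas–Lenells equation $$u_{1,xt}+u_1+i(|u_1|^2+\tfrac12\sigma|u_2|^2)u_{1,x}+\tfrac i2\sigma u_1u_2^*u_{2,x}=0,$$ $$u_{2,xt}+u_2+i(\sigma|u_2|^2+\tfrac12|u_1|^2)u_{2,x}+\tfrac i2u_2u_1^*u_{1,x}=0.$$ -/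

import Mathlib

open MeasureTheory Filter Topology Complex Matrix
open scoped SchwartzMap

noncomputable section

namespace KaupNewell

/-- Column vectors with `N` complex components. -/
abbrev Vec (N : ℕ) := Fin N → ℂ

/-- The phase space: pairs `ω = (q, r)` of rapidly decreasing smooth `ℂ^N`-valued functions on
the line. -/
abbrev Phase (N : ℕ) := 𝓢(ℝ, Vec N × Vec N)

/-- Two-component fields `x ↦ (f₁ x, f₂ x)` without decay, on which the operators act. -/
abbrev VField (N : ℕ) := ℝ → Vec N × Vec N

/-- `(1 + N) × (1 + N)` matrices in block form. -/
abbrev BMat (N : ℕ) := Matrix (Unit ⊕ Fin N) (Unit ⊕ Fin N) ℂ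

variable {N : ℕ}

/-- The component `q` of `ω = (q, r)`. -/
def qOf (ω : Phase N) (x : ℝ) : Vec N := (ω x).1

/-- The component `r` of `ω = (q, r)`. -/
def rOf (ω : Phase N) (x : ℝ) : Vec N := (ω x).2

/-- A field is rapidly decreasing if it is (the function underlying) an element of `Phase N`. -/
def IsSchwartz (f : VField N) : Prop := ∃ g : Phase N, ⇑g = f

/-- The bilinear (not sesquilinear) dot product on `ℂ^N × ℂ^N`. -/
def pair (f g : Vec N × Vec N) : ℂ := f.1 ⬝ᵥ g.1 + f.2 ⬝ᵥ g.2

/-! ### The inverses of `∂ₓ` and of `∂ₓ - s ad_X` -/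

/-- The inverse `∂ₓ⁻¹ f (x) = (∫_{-∞}^x f - ∫_x^∞ f) / 2`: the mean of the primitive that vanishes
at `-∞` and the one that vanishes at `+∞`. -/
def invD (f : ℝ → ℂ) (x : ℝ) : ℂ :=
  (1 / 2) * ((∫ y in Set.Iic x, f y) - ∫ y in Set.Ioi x, f y)

/-- `D` solves `D_x - s [X, D] = F` on the line. -/
def SolvesTransport (s : ℂ) (X F D : ℝ → Matrix (Fin N) (Fin N) ℂ) : Prop :=
  ∀ x i j, HasDerivAt (fun y => D y i j) ((F x + s • (X x * D x - D x * X x)) i j) x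

open Classical in
/-- The solution of `D_x - s [X, D] = F` that vanishes along `l` (`l` is `atBot` or `atTop`; for
rapidly decreasing `X` and `F` it exists and is unique). -/
def vanishingSol (l : Filter ℝ) (s : ℂ) (X F : ℝ → Matrix (Fin N) (Fin N) ℂ) :
    ℝ → Matrix (Fin N) (Fin N) ℂ :=
  if h : ∃ D, SolvesTransport s X F D ∧ Tendsto D l (𝓝 0) then h.choose else 0

/-- The inverse `(∂ₓ - s ad_X)⁻¹ F`: the mean of the solution of `D_x - s [X, D] = F` that vanishes
at `-∞` and the one that vanishes at `+∞`. -/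
def invTransport (s : ℂ) (X F : ℝ → Matrix (Fin N) (Fin N) ℂ) (x : ℝ) :
    Matrix (Fin N) (Fin N) ℂ :=
  (1 / 2 : ℂ) • (vanishingSol atBot s X F x + vanishingSol atTop s X F x)

/-- The rank-one matrix function `q rᵀ`. -/
def qrT (ω : Phase N) (x : ℝ) : Matrix (Fin N) (Fin N) ℂ := vecMulVec (qOf ω x) (rOf ω x)

/-- The rank-one matrix function `r qᵀ`. -/
def rqT (ω : Phase N) (x : ℝ) : Matrix (Fin N) (Fin N) ℂ := vecMulVec (rOf ω x) (qOf ω x)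

/-! ### The operators `J`, `L`, `K` -/

/-- The operator exchanging the two components. -/
def swapF (f : VField N) : VField N := fun x => (f x).swap

/-- `J = [[0, ∂], [∂, 0]]`. -/
def opJ (f : VField N) : VField N := fun x => ((deriv f x).2, (deriv f x).1)

/-- `A f = [(∂ - (i/2) ad_{q rᵀ})⁻¹ (f rᵀ)] q`. -/
def opA (ω : Phase N) (f : ℝ → Vec N) (x : ℝ) : Vec N :=
  invTransport (I / 2) (qrT ω) (fun y => vecMulVec (f y) (rOf ω y)) x *ᵥ qOf ω x

/-- `B f = [(∂ + (i/2) ad_{r qᵀ})⁻¹ (f qᵀ)] r`. -/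
def opB (ω : Phase N) (f : ℝ → Vec N) (x : ℝ) : Vec N :=
  invTransport (-(I / 2)) (rqT ω) (fun y => vecMulVec (f y) (qOf ω y)) x *ᵥ rOf ω x

/-- `C f = [(∂ - (i/2) ad_{q rᵀ})⁻¹ (q fᵀ)] q`. -/
def opC (ω : Phase N) (f : ℝ → Vec N) (x : ℝ) : Vec N :=
  invTransport (I / 2) (qrT ω) (fun y => vecMulVec (qOf ω y) (f y)) x *ᵥ qOf ω x

/-- `D f = [(∂ + (i/2) ad_{r qᵀ})⁻¹ (r fᵀ)] r`. -/
def opD (ω : Phase N) (f : ℝ → Vec N) (x : ℝ) : Vec N :=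
  invTransport (-(I / 2)) (rqT ω) (fun y => vecMulVec (rOf ω y) (f y)) x *ᵥ rOf ω x

/-- `L₁ = (i/2) diag(I, -I) + (1/4) [[q ∂⁻¹ rᵀ + A, q ∂⁻¹ qᵀ + C], [r ∂⁻¹ rᵀ + D, r ∂⁻¹ qᵀ + B]]`,
acting on `(b, c)`. -/
def opL1 (ω : Phase N) (f : VField N) : VField N := fun x =>
  let b : ℝ → Vec N := fun y => (f y).1
  let c : ℝ → Vec N := fun y => (f y).2
  ((I / 2) • b x + (1 / 4 : ℂ) •
      (invD (fun y => rOf ω y ⬝ᵥ b y) x • qOf ω x + opA ω b x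
        + (invD (fun y => qOf ω y ⬝ᵥ c y) x • qOf ω x + opC ω c x)),
   -((I / 2) • c x) + (1 / 4 : ℂ) •
      (invD (fun y => rOf ω y ⬝ᵥ b y) x • rOf ω x + opD ω b x
        + (invD (fun y => qOf ω y ⬝ᵥ c y) x • rOf ω x + opB ω c x)))

/-- `L = S L₁ S ∂`, with `S` the exchange of the two components. -/
def opL (ω : Phase N) (f : VField N) : VField N := swapF (opL1 ω (swapF (deriv f)))

/-- `L₂ = -2i diag(I, -I) + [[q ∂⁻¹ rᵀ + (∑ₖ qₖ ∂⁻¹ rₖ) I, -q ∂⁻¹ qᵀ - (q ∂⁻¹ qᵀ)ᵀ],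
[-r ∂⁻¹ rᵀ - (r ∂⁻¹ rᵀ)ᵀ, r ∂⁻¹ qᵀ + (∑ₖ rₖ ∂⁻¹ qₖ) I]]`, acting on `(b, c)`. -/
def opL2 (ω : Phase N) (f : VField N) : VField N := fun x =>
  let b : ℝ → Vec N := fun y => (f y).1
  let c : ℝ → Vec N := fun y => (f y).2
  let q := qOf ω
  let r := rOf ω
  (fun j => -2 * I * b x j
      + (q x j * invD (fun y => r y ⬝ᵥ b y) x + ∑ k, q x k * invD (fun y => r y k * b y j) x)
      - q x j * invD (fun y => q y ⬝ᵥ c y) x - ∑ k, q x k * invD (fun y => q y j * c y k) x,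
   fun j => 2 * I * c x j
      - r x j * invD (fun y => r y ⬝ᵥ b y) x - ∑ k, r x k * invD (fun y => r y j * b y k) x
      + (r x j * invD (fun y => q y ⬝ᵥ c y) x + ∑ k, r x k * invD (fun y => q y k * c y j) x))

/-- `∂ₓ⁻¹` applied to every component of a field. -/
def invDField (f : VField N) : VField N := fun x =>
  (fun j => invD (fun y => (f y).1 j) x, fun j => invD (fun y => (f y).2 j) x)

/-- `K = ∂⁻¹ S L₂ S`. -/
def opK (ω : Phase N) (f : VField N) : VField N := invDField (swapF (opL2 ω (swapF f)))

/-- The operator `T` is skew-symmetric on the pair `f`, `g`: `∫ gᵀ T f = -∫ fᵀ T g`, both integrals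
being convergent. -/
def SkewOn (T : VField N → VField N) (f g : Phase N) : Prop :=
  Integrable (fun x => pair (g x) (T f x)) ∧ Integrable (fun x => pair (f x) (T g x)) ∧
    ∫ x, pair (g x) (T f x) = -∫ x, pair (f x) (T g x)

/-! ### The spectral problem and the stationary zero-curvature equation -/

/-- `σ₃ = diag(1, -I_N)`. -/
def sigma3 : BMat N := fromBlocks 1 0 0 (-1)

/-- `Q = [[0, rᵀ], [q, 0]]`. -/
def matQ (ω : Phase N) (x : ℝ) : BMat N :=
  fromBlocks 0 (of fun _ k => rOf ω x k) (of fun k _ => qOf ω x k) 0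

/-- `U(z) = i z⁻² σ₃ + z⁻¹ Q`, with spectral parameter `z`. -/
def matU (ω : Phase N) (z : ℂ) (x : ℝ) : BMat N :=
  (I * (z ^ 2)⁻¹) • sigma3 + z⁻¹ • matQ ω x

/-- The commutator of two matrices. -/
def comm (A B : BMat N) : BMat N := A * B - B * A

/-- The coefficients `a_i`, `d_i`, `b_i`, `c_i` of the blocks of `W = [[a, cᵀ], [b, d]]`. -/
structure Coeffs (N : ℕ) where
  a : ℝ → ℂ
  d : ℝ → Matrix (Fin N) (Fin N) ℂ
  b : ℝ → Vec N
  c : ℝ → Vec N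

/-- The `m`-th coefficient matrix of `W`: block diagonal with `a_i`, `d_i` for `m = 2 i`, block
off-diagonal with `b_i`, `c_i` for `m = 2 i + 1`. -/
def coeffMat (w : ℕ → Coeffs N) (m : ℕ) (x : ℝ) : BMat N :=
  if m % 2 = 0 then fromBlocks (of fun _ _ => (w (m / 2)).a x) 0 0 ((w (m / 2)).d x)
  else fromBlocks 0 (of fun _ k => (w (m / 2)).c x k) (of fun k _ => (w (m / 2)).b x k) 0

/-- A formal series `W = ∑ₖ z^k W_k`, given by its coefficients, satisfies `W_x = [U, W]` in
the coefficient of `z^k`. -/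
def StationaryAt (ω : Phase N) (W : ℤ → ℝ → BMat N) (k : ℤ) : Prop :=
  ∀ x i j, HasDerivAt (fun y => W k y i j)
    ((comm (I • sigma3) (W (k + 2) x) + comm (matQ ω x) (W (k + 1) x)) i j) x

/-- The zero-curvature equation `U_t - V_x + [U, V] = 0` for all `z ≠ 0`, along a
time-dependent `ω`; the derivatives are required to exist. -/
def ZeroCurvature (ω : ℝ → Phase N) (V : Phase N → ℂ → ℝ → BMat N) : Prop :=
  ∀ z : ℂ, z ≠ 0 → ∀ t x : ℝ, ∃ Ut Vx : BMat N,
    (∀ i j, HasDerivAt (fun s => matU (ω s) z x i j) (Ut i j) t) ∧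
    (∀ i j, HasDerivAt (fun y => V (ω t) z y i j) (Vx i j) x) ∧
    Ut - Vx + comm (matU (ω t) z x) (V (ω t) z x) = 0

/-- `ω` solves the evolution equation `ω_t = F(ω)`. -/
def IsFlow (ω : ℝ → Phase N) (F : Phase N → VField N) : Prop :=
  ∀ t x, HasDerivAt (fun s => ω s x) (F (ω t) x) t

/-- `δH/δω = G` at `ω` on the phase space `P`: along every curve `γ` in `P` through `ω`, with
velocity `φ` at `ω` (in the topology of rapidly decreasing functions), the derivative of `H` is
`∫ Gᵀ φ dx`. For `P = univ` the velocities are all of `Phase N`. -/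
def HasVarDeriv (P : Set (Phase N)) (H : Phase N → ℂ) (ω : Phase N) (G : VField N) : Prop :=
  ∀ (γ : ℝ → Phase N) (φ : Phase N), (∀ ε, γ ε ∈ P) → γ 0 = ω →
    Tendsto (fun ε : ℝ => ε⁻¹ • (γ ε - γ 0)) (𝓝[≠] 0) (𝓝 φ) →
    Integrable (fun x => pair (G x) (φ x)) ∧
      HasDerivAt (fun ε => H (γ ε)) (∫ x, pair (G x) (φ x)) 0

/-! ### The positive hierarchy -/

/-- One step of the recursion for the positive hierarchy:
`a' = (i/2) ∂⁻¹ (rᵀ b_x + c_xᵀ q)`, `d' = -(i/2) (∂ - (i/2) ad_{q rᵀ})⁻¹ (b_x rᵀ + q c_xᵀ)`,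
`i b' = -b_x / 2 + (a' q - d' q) / 2`, `i c' = c_x / 2 - (d'ᵀ r - a' r) / 2`. -/
def posStep (ω : Phase N) (w : Coeffs N) : Coeffs N :=
  let a' : ℝ → ℂ := fun x =>
    (I / 2) * invD (fun y => rOf ω y ⬝ᵥ deriv w.b y + deriv w.c y ⬝ᵥ qOf ω y) x
  let d' : ℝ → Matrix (Fin N) (Fin N) ℂ := fun x =>
    (-(I / 2)) • invTransport (I / 2) (qrT ω)
      (fun y => vecMulVec (deriv w.b y) (rOf ω y) + vecMulVec (qOf ω y) (deriv w.c y)) x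
  { a := a'
    d := d'
    b := fun x => I⁻¹ • (-((1 / 2 : ℂ) • deriv w.b x)
      + (1 / 2 : ℂ) • (a' x • qOf ω x - d' x *ᵥ qOf ω x))
    c := fun x => I⁻¹ • ((1 / 2 : ℂ) • deriv w.c x
      - (1 / 2 : ℂ) • ((d' x)ᵀ *ᵥ rOf ω x - a' x • rOf ω x)) }

/-- The coefficients of the positive hierarchy, starting from `a₀ = i α`, `d₀ = -i α I_N`,
`b₀ = α q`, `c₀ = α r`. -/
def posCoeffs (α : ℂ) (ω : Phase N) : ℕ → Coeffs N
  | 0 => { a := fun _ => I * α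
           d := fun _ => -((I * α) • (1 : Matrix (Fin N) (Fin N) ℂ))
           b := fun x => α • qOf ω x
           c := fun x => α • rOf ω x }
  | n + 1 => posStep ω (posCoeffs α ω n)

/-- `W = ∑_{m ≥ 0} z^m W_m`: the coefficient of `z^k`. -/
def posSeries (α : ℂ) (ω : Phase N) (k : ℤ) : ℝ → BMat N :=
  if 0 ≤ k then coeffMat (posCoeffs α ω) k.toNat else 0

/-- `V = (z^{-2n-2} W)₋`, the part with negative powers of `z`. -/
def posV (α : ℂ) (n : ℕ) (ω : Phase N) (z : ℂ) (x : ℝ) : BMat N :=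
  ∑ k ∈ Finset.Icc (-(2 * (n : ℤ) + 2)) (-1), z ^ k • posSeries α ω (k + (2 * (n : ℤ) + 2)) x

/-- The field `(c_n, b_n)` of the positive hierarchy. -/
def posGrad (α : ℂ) (n : ℕ) (ω : Phase N) : VField N := fun x =>
  ((posCoeffs α ω n).c x, (posCoeffs α ω n).b x)

/-- The density of `H_n⁺`. -/
def posDensity (α : ℂ) (n : ℕ) (ω : Phase N) (x : ℝ) : ℂ :=
  if n = 0 then α * (qOf ω x ⬝ᵥ rOf ω x)
  else -(1 / (2 * (n : ℂ))) *
    (2 * I * ((posCoeffs α ω (n + 1)).a x - ((posCoeffs α ω (n + 1)).d x).trace)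
      + ((posCoeffs α ω n).c x ⬝ᵥ qOf ω x + rOf ω x ⬝ᵥ (posCoeffs α ω n).b x))

/-- The Hamiltonian `H_n⁺`. -/
def posH (α : ℂ) (n : ℕ) (ω : Phase N) : ℂ := ∫ x, posDensity α n ω x

/-! ### The negative hierarchy -/

/-- One step of the recursion for the negative hierarchy:
`a' = ∂⁻¹ (rᵀ b - cᵀ q)`, `d' = ∂⁻¹ (q cᵀ - b rᵀ)`, `b'_x = -2 i b + a' q - d' q`,
`c'_x = 2 i c + d'ᵀ r - a' r`. -/
def negStep (ω : Phase N) (w : Coeffs N) : Coeffs N :=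
  let a' : ℝ → ℂ := invD fun y => rOf ω y ⬝ᵥ w.b y - w.c y ⬝ᵥ qOf ω y
  let d' : ℝ → Matrix (Fin N) (Fin N) ℂ := fun x => of fun j k =>
    invD (fun y => qOf ω y j * w.c y k - w.b y j * rOf ω y k) x
  { a := a'
    d := d'
    b := fun x j => invD
      (fun y => (-(2 * I) • w.b y + (a' y • qOf ω y - d' y *ᵥ qOf ω y)) j) x
    c := fun x j => invD
      (fun y => ((2 * I) • w.c y + ((d' y)ᵀ *ᵥ rOf ω y - a' y • rOf ω y)) j) x }

/-- The coefficients of the negative hierarchy, starting from `a₀ = α / 2`, `d₀ = -(α / 2) I_N`,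
`b₀ = α ∂⁻¹ q`, `c₀ = -α ∂⁻¹ r`. -/
def negCoeffs (α : ℂ) (ω : Phase N) : ℕ → Coeffs N
  | 0 => { a := fun _ => α / 2
           d := fun _ => -((α / 2) • (1 : Matrix (Fin N) (Fin N) ℂ))
           b := fun x j => α * invD (fun y => qOf ω y j) x
           c := fun x j => -(α * invD (fun y => rOf ω y j) x) }
  | n + 1 => negStep ω (negCoeffs α ω n)

/-- `W = ∑_{m ≥ 0} z^{-m} W_m`: the coefficient of `z^k`. -/
def negSeries (α : ℂ) (ω : Phase N) (k : ℤ) : ℝ → BMat N :=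
  if k ≤ 0 then coeffMat (negCoeffs α ω) (-k).toNat else 0

/-- `V = (z^{2n} W)₊`, the part with nonnegative powers of `z`. -/
def negV (α : ℂ) (n : ℕ) (ω : Phase N) (z : ℂ) (x : ℝ) : BMat N :=
  ∑ k ∈ Finset.Icc (0 : ℤ) (2 * (n : ℤ)), z ^ k • negSeries α ω (k - 2 * (n : ℤ)) x

/-- The field `(c_n, b_n)` of the negative hierarchy. -/
def negGrad (α : ℂ) (n : ℕ) (ω : Phase N) : VField N := fun x =>
  ((negCoeffs α ω n).c x, (negCoeffs α ω n).b x)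

/-- The phase space of the `n`-th negative flow: the `ω` for which the `n` nonlocal fields
`(c_j, b_j)`, `j < n`, that have to be integrated to reach `(c_n, b_n)`, are rapidly decreasing.
For `n = 0` this is no condition; for `n = 1` and `α ≠ 0` it says that `q = u_x`, `r = v_x` with
rapidly decreasing `u`, `v`. -/
def negDomain (α : ℂ) (n : ℕ) : Set (Phase N) :=
  {ω | ∀ j < n, IsSchwartz (negGrad α j ω)}

/-- The density of `H_n⁻`; for `n = 0` the constant contribution of `a₀ - tr d₀` is dropped. -/
def negDensity (α : ℂ) (n : ℕ) (ω : Phase N) (x : ℝ) : ℂ :=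
  (1 / (2 * ((n : ℂ) + 1))) *
    ((if n = 0 then 0
      else 2 * I * ((negCoeffs α ω n).a x - ((negCoeffs α ω n).d x).trace))
      + ((negCoeffs α ω n).c x ⬝ᵥ qOf ω x + rOf ω x ⬝ᵥ (negCoeffs α ω n).b x))

/-- The Hamiltonian `H_n⁻`. -/
def negH (α : ℂ) (n : ℕ) (ω : Phase N) : ℂ := ∫ x, negDensity α n ω x

/-! ### The coupled Fokas–Lenells equation -/

/-- The coupled Fokas–Lenells equation for `u = (u₁, u₂)`:
`u_{1,xt} + u₁ + i (|u₁|² + σ |u₂|² / 2) u_{1,x} + (i/2) σ u₁ u₂* u_{2,x} = 0`,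
`u_{2,xt} + u₂ + i (σ |u₂|² + |u₁|² / 2) u_{2,x} + (i/2) u₂ u₁* u_{1,x} = 0`. -/
def CoupledFL (σ : ℝ) (u : ℝ → 𝓢(ℝ, Vec 2)) : Prop :=
  ∀ t x : ℝ, ∃ u1xt u2xt : ℂ,
    HasDerivAt (fun s => deriv (u s) x 0) u1xt t ∧
    HasDerivAt (fun s => deriv (u s) x 1) u2xt t ∧
    u1xt + u t x 0
      + I * ((‖u t x 0‖ : ℂ) ^ 2 + 1 / 2 * σ * (‖u t x 1‖ : ℂ) ^ 2) * deriv (u t) x 0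
      + I / 2 * σ * u t x 0 * (starRingEnd ℂ) (u t x 1) * deriv (u t) x 1 = 0 ∧
    u2xt + u t x 1
      + I * (σ * (‖u t x 1‖ : ℂ) ^ 2 + 1 / 2 * (‖u t x 0‖ : ℂ) ^ 2) * deriv (u t) x 1
      + I / 2 * u t x 1 * (starRingEnd ℂ) (u t x 0) * deriv (u t) x 0 = 0

/-- The reduction `q = u_x`, `r = v_x` with `v = (u₁*, σ u₂*)`. -/
def IsFLReduction (σ : ℝ) (u : ℝ → 𝓢(ℝ, Vec 2)) (ω : ℝ → Phase 2) : Prop :=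
  ∀ t x, qOf (ω t) x = deriv (u t) x ∧
    rOf (ω t) x = ![(starRingEnd ℂ) (deriv (u t) x 0), σ * (starRingEnd ℂ) (deriv (u t) x 1)]

end KaupNewell

end

open KaupNewell

/-!
The four ingredients of the proof are the stationary equation, the skew-symmetry of the operators,
the constancy of `W²`, and a trace identity.

*Stationary equation and zero curvature.* The recursions are the coefficients of `W_x = [U, W]`,
split into block diagonal and off-diagonal parts. The off-diagonal part of the positive hierarchy is
the definition of `b`, `c`; the diagonal part follows because substituting `b`, `c` into it turns it
into the transport equation which `a`, `d` solve (`posW_mDeriv`). In the negative hierarchy each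
coefficient is by definition the mean primitive of its row (`negW_mDeriv`). Truncating `W` leaves
in `V_x - [U, V]` only the term of order `-1` in the spectral parameter, whose off-diagonal
entries are `± ∂` of `(c_n, b_n)`; hence zero curvature is the flow (`zeroCurvature_iff`).

*The operators.* `L` and `K` are the recursion maps on `(c, b)` (`opL_mk_eq_posStep`,
`opK_mk_eq_negStep`). The means in `∂⁻¹` and `(∂ - s ad_X)⁻¹` make both skew-symmetric
(`integral_mul_invD`, `IsMeanSol.integral_trace_mul`): for solutions `D₁`, `D₂` vanishing at `-∞`
and `+∞` the boundary terms of an integration by parts are a quarter of `tr ((D₁ - D₂)(D₁' - D₂'))`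
at either end, and this is a constant, since `D₁ - D₂` and `D₁' - D₂'` solve the homogeneous
equation. So `L₁ S` and `J K = L₂ S` are skew-symmetric, and the powers follow by moving one factor
at a time. The inverse `(∂ - s ad_X)⁻¹` itself exists by a contraction argument in a weighted norm
(`exists_bounded_solution_atBot`), the solutions being unique by a Gronwall estimate
(`transport_unique`).

*Locality.* Let `α ≠ 0`. Along with `W`, its square solves the stationary equation, and its constant
coefficient is a scalar. Therefore an even coefficient `e` of `W²` solves the homogeneous transport
equation once the lower ones vanish; on the other hand it is `2 κ σ₃` times a coefficient of `W`,
plus products of coefficients that decay. That coefficient of `W` is a mean solution, so its limits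
at the two ends are opposite after transport, while those of `e` are equal after transport;
hence `e = 0` (`IsMeanSol.eq_zero`). So `W²` is constant (`posW_square`, `negW_square`), and the
diagonal coefficients are polynomials in lower ones: they are rapidly decreasing, and for the
positive hierarchy all coefficients are differential polynomials in `q` and `r`. This gives the
convergence of the Hamiltonians and the differentiability of the coefficients along curves. In the
negative hierarchy the coefficients are primitives, and differentiability in the Schwartz topology
passes to a primitive that decays at both ends (`VarDer.invD_sch`).

*Gradients.* Let `Ẇ` be the derivative of `W` in the spectral parameter and `δW` its variation.
Both anticommute with `W`, as `W²` is a constant scalar, and with this `∂ tr (W Ẇ δW)` becomes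
`2 W² tr (Ẇ δU - U̇ δW)` (`trace_identity`). Comparing coefficients, the variation of the density of
`H_n` is `(c_n, b_n)` paired with the variation of `(q, r)`, up to the derivative of a rapidly
decreasing function. For `α = 0` all coefficients vanish.

*The first negative flow.* If `q = u_x` and `r = v_x`, the integrands of `a₁` and `d₁` are the
derivatives of `α vᵀ u` and `-α u vᵀ`, so the flow is explicit (`opJ_negGrad_one`); for
`v = (u₁*, σ u₂*)` its second row is the complex conjugate of the first one.
-/

noncomputable section

namespace KaupNewell

/-! ### Classes of smooth functions and of families of smooth functions -/

section Tower

variable {ι : Type*} {l : Filter ι} {K : Set ℕ}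

/-- The family `f` and all its derivatives of order at most `n` in the space variable satisfy `p`. -/
def Tower (p : (ι → ℝ → ℂ) → Prop) : ℕ → (ι → ℝ → ℂ) → Prop
  | 0, f => p f
  | n + 1, f => p f ∧ (∀ i, Differentiable ℝ (f i)) ∧ Tower p n fun i => deriv (f i)

/-- Along `l`, the family is bounded by a multiple of `|x| ^ (-k)`, uniformly in the index, for
every `k ∈ K`. The sets of weights in use are `{0}` (boundedness) and `univ` (rapid decrease). -/
def BigO (K : Set ℕ) (l : Filter ι) (f : ι → ℝ → ℂ) : Prop :=
  ∀ k ∈ K, ∃ C : ℝ, ∀ᶠ i in l, ∀ x, |x| ^ k * ‖f i x‖ ≤ C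

/-- Along `l`, the family tends to zero uniformly with every weight `|x| ^ k`, `k ∈ K`. -/
def LittleO (K : Set ℕ) (l : Filter ι) (f : ι → ℝ → ℂ) : Prop :=
  ∀ k ∈ K, ∀ δ > 0, ∀ᶠ i in l, ∀ x, |x| ^ k * ‖f i x‖ ≤ δ

namespace Tower

variable {p p' p'' : (ι → ℝ → ℂ) → Prop} {f g : ι → ℝ → ℂ} {n : ℕ}

theorem pred : ∀ {n} {f : ι → ℝ → ℂ}, Tower p (n + 1) f → Tower p n f
  | 0, _, h => h.1
  | _ + 1, _, h => ⟨h.1, h.2.1, h.2.2.pred⟩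

theorem map (hp : ∀ f, p f → p' f) : ∀ {n} {f : ι → ℝ → ℂ}, Tower p n f → Tower p' n f
  | 0, _, h => hp _ h
  | _ + 1, _, h => ⟨hp _ h.1, h.2.1, h.2.2.map hp⟩

theorem add (hp : ∀ f g, p f → p g → p fun i x => f i x + g i x) :
    ∀ {n} {f g : ι → ℝ → ℂ}, Tower p n f → Tower p n g → Tower p n fun i x => f i x + g i x
  | 0, _, _, hf, hg => hp _ _ hf hg
  | n + 1, f, g, hf, hg => by
    refine ⟨hp _ _ hf.1 hg.1, fun i => (hf.2.1 i).add (hg.2.1 i), ?_⟩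
    have : (fun i => deriv fun x => f i x + g i x) =
        fun i x => deriv (f i) x + deriv (g i) x := by
      funext i x; exact deriv_fun_add (hf.2.1 i x) (hg.2.1 i x)
    rw [this]
    exact add hp hf.2.2 hg.2.2

theorem mul (hadd : ∀ f g, p'' f → p'' g → p'' fun i x => f i x + g i x)
    (hp : ∀ f g, p f → p' g → p'' fun i x => f i x * g i x) :
    ∀ {n} {f g : ι → ℝ → ℂ}, Tower p n f → Tower p' n g → Tower p'' n fun i x => f i x * g i x
  | 0, _, _, hf, hg => hp _ _ hf hg
  | n + 1, f, g, hf, hg => by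
    refine ⟨hp _ _ hf.1 hg.1, fun i => (hf.2.1 i).mul (hg.2.1 i), ?_⟩
    have : (fun i => deriv fun x => f i x * g i x) =
        fun i x => deriv (f i) x * g i x + f i x * deriv (g i) x := by
      funext i x; exact deriv_fun_mul (hf.2.1 i x) (hg.2.1 i x)
    rw [this]
    exact add hadd (mul hadd hp hf.2.2 hg.pred) (mul hadd hp hf.pred hg.2.2)

/-- Multiplying each member of a family by a constant. -/
theorem smul (c : ι → ℂ) (hp : ∀ f, p f → p' fun i x => c i * f i x) :
    ∀ {n} {f : ι → ℝ → ℂ}, Tower p n f → Tower p' n fun i x => c i * f i x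
  | 0, _, hf => hp _ hf
  | n + 1, f, hf => by
    refine ⟨hp _ hf.1, fun i => (hf.2.1 i).const_mul _, ?_⟩
    have : (fun i => deriv fun x => c i * f i x) = fun i x => c i * deriv (f i) x := by
      funext i x; exact deriv_const_mul _ (hf.2.1 i x)
    rw [this]
    exact smul c hp hf.2.2

/-- Passing to another index set, and in particular from a function to the constant family. -/
theorem reindex {κ : Type*} {q : (κ → ℝ → ℂ) → Prop} (φ : κ → ι)
    (hp : ∀ f, p f → q fun j => f (φ j)) :
    ∀ {n} {f : ι → ℝ → ℂ}, Tower p n f → Tower q n fun j => f (φ j)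
  | 0, _, h => hp _ h
  | _ + 1, _, h => ⟨hp _ h.1, fun j => h.2.1 (φ j), reindex φ hp h.2.2⟩

end Tower

theorem BigO.add {f g : ι → ℝ → ℂ} (hf : BigO K l f) (hg : BigO K l g) :
    BigO K l fun i x => f i x + g i x := by
  intro k hk
  obtain ⟨C, hC⟩ := hf k hk
  obtain ⟨C', hC'⟩ := hg k hk
  refine ⟨C + C', ?_⟩
  filter_upwards [hC, hC'] with i h h' x
  calc |x| ^ k * ‖f i x + g i x‖ ≤ |x| ^ k * (‖f i x‖ + ‖g i x‖) := by
        gcongr; exact norm_add_le _ _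
    _ ≤ C + C' := by rw [mul_add]; exact add_le_add (h x) (h' x)

theorem LittleO.add {f g : ι → ℝ → ℂ} (hf : LittleO K l f) (hg : LittleO K l g) :
    LittleO K l fun i x => f i x + g i x := by
  intro k hk δ hδ
  filter_upwards [hf k hk (δ / 2) (half_pos hδ), hg k hk (δ / 2) (half_pos hδ)] with i h h' x
  calc |x| ^ k * ‖f i x + g i x‖ ≤ |x| ^ k * (‖f i x‖ + ‖g i x‖) := by
        gcongr; exact norm_add_le _ _
    _ ≤ δ / 2 + δ / 2 := by rw [mul_add]; exact add_le_add (h x) (h' x)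
    _ = δ := add_halves δ

theorem LittleO.bigO {f : ι → ℝ → ℂ} (hf : LittleO K l f) : BigO K l f :=
  fun k hk => ⟨1, hf k hk 1 one_pos⟩

theorem BigO.mul {f g : ι → ℝ → ℂ} (hf : BigO K l f) (hg : BigO {0} l g) :
    BigO K l fun i x => f i x * g i x := by
  intro k hk
  obtain ⟨C, hC⟩ := hf k hk
  obtain ⟨C', hC'⟩ := hg 0 rfl
  refine ⟨C * C', ?_⟩
  filter_upwards [hC, hC'] with i h h' x
  have h1 := h x
  have h2 := h' x
  rw [pow_zero, one_mul] at h2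
  rw [norm_mul, ← mul_assoc]
  exact mul_le_mul h1 h2 (norm_nonneg _) ((by positivity : 0 ≤ |x| ^ k * ‖f i x‖).trans h1)

theorem LittleO.mul_bigO {f g : ι → ℝ → ℂ} (hf : LittleO K l f) (hg : BigO {0} l g) :
    LittleO K l fun i x => f i x * g i x := by
  intro k hk δ hδ
  obtain ⟨C', hC'⟩ := hg 0 rfl
  have hpos : 0 < |C'| + 1 := by positivity
  filter_upwards [hf k hk (δ / (|C'| + 1)) (by positivity), hC'] with i h h' x
  have h1 := h x
  have h2 := h' x
  rw [pow_zero, one_mul] at h2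
  rw [norm_mul, ← mul_assoc]
  calc |x| ^ k * ‖f i x‖ * ‖g i x‖ ≤ δ / (|C'| + 1) * (|C'| + 1) := by
        gcongr
        exact h2.trans ((le_abs_self _).trans (by linarith))
    _ = δ := by field_simp

theorem BigO.mul_littleO {f g : ι → ℝ → ℂ} (hf : BigO K l f) (hg : LittleO {0} l g) :
    LittleO K l fun i x => f i x * g i x := by
  intro k hk δ hδ
  obtain ⟨C, hC⟩ := hf k hk
  have hpos : 0 < |C| + 1 := by positivity
  filter_upwards [hg 0 rfl (δ / (|C| + 1)) (by positivity), hC] with i h h' x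
  have h1 := h x
  have h2 := h' x
  rw [pow_zero, one_mul] at h1
  rw [norm_mul, ← mul_assoc]
  calc |x| ^ k * ‖f i x‖ * ‖g i x‖ ≤ (|C| + 1) * (δ / (|C| + 1)) := by
        gcongr
        exact h2.trans ((le_abs_self _).trans (by linarith))
    _ = δ := by field_simp

theorem BigO.const_mul {f : ι → ℝ → ℂ} (hf : BigO K l f) (c : ℂ) :
    BigO K l fun i x => c * f i x := by
  intro k hk
  obtain ⟨C, hC⟩ := hf k hk
  refine ⟨‖c‖ * C, ?_⟩
  filter_upwards [hC] with i h x
  rw [norm_mul, mul_left_comm]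
  exact mul_le_mul_of_nonneg_left (h x) (norm_nonneg _)

theorem LittleO.const_mul {f : ι → ℝ → ℂ} (hf : LittleO K l f) (c : ℂ) :
    LittleO K l fun i x => c * f i x := by
  intro k hk δ hδ
  filter_upwards [hf k hk (δ / (‖c‖ + 1)) (by positivity)] with i h x
  rw [norm_mul, mul_left_comm]
  calc ‖c‖ * (|x| ^ k * ‖f i x‖) ≤ (‖c‖ + 1) * (δ / (‖c‖ + 1)) := by
        gcongr
        · linarith
        · exact h x
    _ = δ := by field_simp

theorem BigO.small_mul {f : ι → ℝ → ℂ} (hf : BigO K l f) {c : ι → ℂ} (hc : Tendsto c l (𝓝 0)) :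
    LittleO K l fun i x => c i * f i x := by
  intro k hk δ hδ
  obtain ⟨C, hC⟩ := hf k hk
  have hpos : 0 < |C| + 1 := by positivity
  have hc' : ∀ᶠ i in l, ‖c i‖ < δ / (|C| + 1) := by
    have := (tendsto_zero_iff_norm_tendsto_zero.1 hc).eventually
      (gt_mem_nhds (show 0 < δ / (|C| + 1) by positivity))
    exact this
  filter_upwards [hC, hc'] with i h h' x
  rw [norm_mul, mul_left_comm]
  calc ‖c i‖ * (|x| ^ k * ‖f i x‖) ≤ δ / (|C| + 1) * (|C| + 1) := by
        gcongr
        exact (h x).trans ((le_abs_self _).trans (by linarith))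
    _ = δ := by field_simp

theorem BigO.mono {K' : Set ℕ} (hK : K' ⊆ K) {f : ι → ℝ → ℂ} (hf : BigO K l f) : BigO K' l f :=
  fun k hk => hf k (hK hk)

theorem LittleO.mono {K' : Set ℕ} (hK : K' ⊆ K) {f : ι → ℝ → ℂ} (hf : LittleO K l f) :
    LittleO K' l f :=
  fun k hk => hf k (hK hk)

end Tower

/-- `f` is smooth, and `f` and all its derivatives are `O(|x| ^ (-k))` for every `k ∈ K`. -/
def Cls (K : Set ℕ) (f : ℝ → ℂ) : Prop :=
  ∀ n, Tower (BigO K (pure ())) n fun _ : Unit => f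

/-- Rapidly decreasing smooth functions. -/
abbrev Sch (f : ℝ → ℂ) : Prop := Cls Set.univ f

/-- Smooth functions all of whose derivatives are bounded. -/
abbrev Smb (f : ℝ → ℂ) : Prop := Cls {0} f

namespace Cls

variable {K : Set ℕ} {f g : ℝ → ℂ}

theorem mono {K' : Set ℕ} (hK : K' ⊆ K) (hf : Cls K f) : Cls K' f :=
  fun n => (hf n).map fun _ => BigO.mono hK

theorem smb (hf : Sch f) : Smb f := hf.mono (Set.subset_univ _)

theorem add (hf : Cls K f) (hg : Cls K g) : Cls K fun x => f x + g x :=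
  fun n => Tower.add (fun _ _ => BigO.add) (hf n) (hg n)

theorem mul (hf : Cls K f) (hg : Smb g) : Cls K fun x => f x * g x :=
  fun n => Tower.mul (fun _ _ => BigO.add) (fun _ _ => BigO.mul) (hf n) (hg n)

theorem mul' (hf : Smb f) (hg : Cls K g) : Cls K fun x => f x * g x := by
  simpa only [mul_comm] using hg.mul hf

theorem const_mul (hf : Cls K f) (c : ℂ) : Cls K fun x => c * f x :=
  fun n => Tower.smul (fun _ => c) (fun _ h => h.const_mul c) (hf n)

theorem neg (hf : Cls K f) : Cls K fun x => -f x := by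
  simpa only [neg_one_mul] using hf.const_mul (-1)

theorem sub (hf : Cls K f) (hg : Cls K g) : Cls K fun x => f x - g x := by
  simpa only [sub_eq_add_neg] using hf.add hg.neg

theorem differentiable (hf : Cls K f) : Differentiable ℝ f := (hf 1).2.1 ()

theorem hasDerivAt (hf : Cls K f) (x : ℝ) : HasDerivAt f (deriv f x) x :=
  (hf.differentiable x).hasDerivAt

theorem continuous (hf : Cls K f) : Continuous f := hf.differentiable.continuous

theorem deriv (hf : Cls K f) : Cls K (deriv f) := fun n => (hf (n + 1)).2.2

theorem zero : Cls K fun _ => 0 := by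
  intro n
  induction n with
  | zero => exact fun k _ => ⟨0, by simp⟩
  | succ n ih =>
    exact ⟨fun k _ => ⟨0, by simp⟩, fun _ => differentiable_const _, by simpa using ih⟩

theorem const (c : ℂ) : Smb fun _ => c := by
  have h0 : BigO {0} (pure ()) fun _ : Unit => fun _ : ℝ => c := by
    intro k hk
    rw [Set.mem_singleton_iff] at hk
    exact ⟨‖c‖, by simp [hk]⟩
  intro n
  cases n with
  | zero => exact h0
  | succ n =>
    refine ⟨h0, fun _ => differentiable_const _, ?_⟩
    have := (zero (K := {0})) n
    simpa using this

theorem sum {κ : Type*} (s : Finset κ) {f : κ → ℝ → ℂ} (h : ∀ k ∈ s, Cls K (f k)) :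
    Cls K fun x => ∑ k ∈ s, f k x := by
  classical
  induction s using Finset.induction_on with
  | empty => simpa using zero
  | insert a s ha ih =>
    simp only [Finset.sum_insert ha]
    exact (h a (Finset.mem_insert_self _ _)).add
      (ih fun k hk => h k (Finset.mem_insert_of_mem hk))

theorem bound (hf : Cls K f) {k : ℕ} (hk : k ∈ K) : ∃ C, ∀ x, |x| ^ k * ‖f x‖ ≤ C := by
  obtain ⟨C, hC⟩ := (hf 0) k hk
  exact ⟨C, by simpa using hC⟩

theorem bounded (hf : Smb f) : ∃ C, ∀ x, ‖f x‖ ≤ C := by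
  simpa using hf.bound (k := 0) rfl

theorem of_hasDerivAt {f' : ℝ → ℂ} (h : ∀ x, HasDerivAt f (f' x) x)
    (hb : ∀ k ∈ K, ∃ C, ∀ x, |x| ^ k * ‖f x‖ ≤ C) (hf' : Cls K f') : Cls K f := by
  have h0 : BigO K (pure ()) fun _ : Unit => f := by
    intro k hk
    obtain ⟨C, hC⟩ := hb k hk
    exact ⟨C, by simpa using hC⟩
  have hd : _root_.deriv f = f' := funext fun x => (h x).deriv
  intro n
  cases n with
  | zero => exact h0
  | succ n => exact ⟨h0, fun _ x => (h x).differentiableAt, by simpa [hd] using hf' n⟩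

end Cls

/-! ### Comparison with Mathlib's space of rapidly decreasing functions -/

section Schwartz

theorem Cls.iteratedDeriv {K : Set ℕ} {f : ℝ → ℂ} (hf : Cls K f) (n : ℕ) :
    Cls K (iteratedDeriv n f) := by
  induction n with
  | zero => simpa using hf
  | succ n ih => rw [iteratedDeriv_succ]; exact ih.deriv

theorem Cls.contDiff {K : Set ℕ} {f : ℝ → ℂ} (hf : Cls K f) : ContDiff ℝ (⊤ : ℕ∞) f :=
  contDiff_of_differentiable_iteratedDeriv fun n _ => (hf.iteratedDeriv n).differentiable

theorem Cls.exists_schwartzMap {f : ℝ → ℂ} (hf : Sch f) : ∃ g : 𝓢(ℝ, ℂ), ⇑g = f := by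
  refine ⟨⟨f, hf.contDiff, fun k n => ?_⟩, rfl⟩
  obtain ⟨C, hC⟩ := (hf.iteratedDeriv n).bound (Set.mem_univ k)
  exact ⟨C, fun x => by
    rw [norm_iteratedFDeriv_eq_norm_iteratedDeriv, Real.norm_eq_abs]; exact hC x⟩

theorem sch_schwartzMap (g : 𝓢(ℝ, ℂ)) : Sch g := by
  intro n
  have h0 : ∀ g : 𝓢(ℝ, ℂ), BigO Set.univ (pure ()) fun _ : Unit => ⇑g := fun g k _ => by
    refine ⟨SchwartzMap.seminorm ℝ k 0 g, ?_⟩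
    simpa using SchwartzMap.norm_pow_mul_le_seminorm ℝ g k
  induction n generalizing g with
  | zero => exact h0 g
  | succ n ih =>
    refine ⟨h0 g, fun _ => g.differentiable, ?_⟩
    exact ih (SchwartzMap.derivCLM ℝ ℂ g)

/-- Convergence in the Schwartz space, expressed by uniform weighted bounds. -/
theorem tower_of_tendsto_schwartzMap {ι : Type*} {l : Filter ι} (g : ι → 𝓢(ℝ, ℂ))
    (hg : Tendsto g l (𝓝 0)) (n : ℕ) : Tower (LittleO Set.univ l) n fun i => ⇑(g i) := by
  have h0 : ∀ g : ι → 𝓢(ℝ, ℂ), Tendsto g l (𝓝 0) →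
      LittleO Set.univ l fun i => ⇑(g i) := fun g hg k _ δ hδ => by
    have hc := ((schwartz_withSeminorms ℝ ℝ ℂ).continuous_seminorm (k, 0)).tendsto 0
    have h1 := (hc.comp hg).eventually (gt_mem_nhds (by simpa using hδ))
    filter_upwards [h1] with i hi x
    exact (SchwartzMap.norm_pow_mul_le_seminorm ℝ (g i) k x).trans hi.le
  induction n generalizing g with
  | zero => exact h0 g hg
  | succ n ih =>
    refine ⟨h0 g hg, fun i => (g i).differentiable, ?_⟩
    have := ih (fun i => SchwartzMap.derivCLM ℝ ℂ (g i))
      (by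
      have := ((SchwartzMap.derivCLM ℝ ℂ).continuous.tendsto 0).comp hg
      rwa [map_zero] at this)
    exact this

end Schwartz

/-! ### The inverse of the derivative -/

section InvD

variable {f g : ℝ → ℂ}

theorem le_inv_one_add_sq {a δ x : ℝ} (h0 : a ≤ δ) (h2 : |x| ^ 2 * a ≤ δ) :
    a ≤ 2 * δ * (1 + x ^ 2)⁻¹ := by
  have hx : 0 < 1 + x ^ 2 := by positivity
  rw [← div_eq_mul_inv, le_div_iff₀ hx]
  rw [sq_abs] at h2
  nlinarith

theorem Cls.integrable (hf : Sch f) : Integrable f := by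
  obtain ⟨C, hC⟩ := hf.bound (Set.mem_univ 0)
  obtain ⟨C', hC'⟩ := hf.bound (Set.mem_univ 2)
  refine (integrable_inv_one_add_sq.const_mul (2 * max C C')).mono'
    hf.continuous.aestronglyMeasurable (Eventually.of_forall fun x => ?_)
  refine le_inv_one_add_sq ((le_of_eq (by simp)).trans ((hC x).trans (le_max_left _ _)))
    ((hC' x).trans (le_max_right _ _))

theorem Cls.tendsto_zero (hf : Sch f) {l : Filter ℝ} (hl : l ≤ cocompact ℝ) :
    Tendsto f l (𝓝 0) := by
  obtain ⟨g, rfl⟩ := hf.exists_schwartzMap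
  exact g.tendsto_cocompact.mono_left hl

theorem Cls.tendsto_atTop (hf : Sch f) : Tendsto f atTop (𝓝 0) :=
  hf.tendsto_zero atTop_le_cocompact

theorem Cls.tendsto_atBot (hf : Sch f) : Tendsto f atBot (𝓝 0) :=
  hf.tendsto_zero atBot_le_cocompact

theorem invD_eq (hf : Integrable f) (x : ℝ) :
    invD f x = (∫ y in Set.Iic x, f y) - (1 / 2) * ∫ y, f y := by
  have h := intervalIntegral.integral_Iic_add_Ioi (b := x) hf.integrableOn hf.integrableOn
  rw [invD, ← h]
  ring

theorem invD_eq' (hf : Integrable f) (x : ℝ) :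
    invD f x = (1 / 2) * (∫ y, f y) - ∫ y in Set.Ioi x, f y := by
  have h := intervalIntegral.integral_Iic_add_Ioi (b := x) hf.integrableOn hf.integrableOn
  rw [invD, ← h]
  ring

theorem invD_tendsto_atBot (hf : Integrable f) :
    Tendsto (invD f) atBot (𝓝 (-((1 / 2) * ∫ y, f y))) := by
  have := (tendsto_integral_Iic_zero (μ := volume) (f := f) (a := fun x : ℝ => x)
    tendsto_id).sub_const ((1 / 2) * ∫ y, f y)
  rw [zero_sub] at this
  exact this.congr fun x => (invD_eq hf x).symm

theorem invD_tendsto_atTop (hf : Integrable f) :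
    Tendsto (invD f) atTop (𝓝 ((1 / 2) * ∫ y, f y)) := by
  have := (tendsto_integral_Ioi_zero (μ := volume) (f := f) (b := fun x : ℝ => x)
    tendsto_id).const_sub ((1 / 2) * ∫ y, f y)
  rw [sub_zero] at this
  exact this.congr fun x => (invD_eq' hf x).symm

theorem invD_hasDerivAt (hf : Integrable f) (hc : Continuous f) (x : ℝ) :
    HasDerivAt (invD f) (f x) x := by
  have h : ∀ y, invD f y = invD f 0 + ∫ t in (0 : ℝ)..y, f t := fun y => by
    rw [invD_eq hf, invD_eq hf,
      ← intervalIntegral.integral_Iic_sub_Iic hf.integrableOn hf.integrableOn]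
    ring
  rw [funext h]
  exact (intervalIntegral.integral_hasDerivAt_right (hf.intervalIntegrable)
    (hc.stronglyMeasurableAtFilter _ _) hc.continuousAt).const_add _

theorem norm_invD_le (hf : Integrable f) (x : ℝ) : ‖invD f x‖ ≤ ∫ y, ‖f y‖ := by
  have h1 : ‖∫ y in Set.Iic x, f y‖ ≤ ∫ y, ‖f y‖ := (norm_integral_le_integral_norm _).trans
    (setIntegral_le_integral hf.norm (Eventually.of_forall fun _ => norm_nonneg _))
  have h2 : ‖∫ y in Set.Ioi x, f y‖ ≤ ∫ y, ‖f y‖ := (norm_integral_le_integral_norm _).trans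
    (setIntegral_le_integral hf.norm (Eventually.of_forall fun _ => norm_nonneg _))
  rw [invD, norm_mul]
  have : ‖(1 / 2 : ℂ)‖ = 1 / 2 := by norm_num
  rw [this]
  linarith [norm_sub_le (∫ y in Set.Iic x, f y) (∫ y in Set.Ioi x, f y)]

theorem invD_add (hf : Integrable f) (hg : Integrable g) (x : ℝ) :
    invD (fun y => f y + g y) x = invD f x + invD g x := by
  rw [invD, invD, invD, integral_add hf.integrableOn hg.integrableOn,
    integral_add hf.integrableOn hg.integrableOn]
  ring

theorem invD_const_mul (c : ℂ) (f : ℝ → ℂ) (x : ℝ) :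
    invD (fun y => c * f y) x = c * invD f x := by
  rw [invD, invD, integral_const_mul, integral_const_mul]
  ring

theorem invD_sub (hf : Integrable f) (hg : Integrable g) (x : ℝ) :
    invD (fun y => f y - g y) x = invD f x - invD g x := by
  rw [invD, invD, invD, integral_sub hf.integrableOn hg.integrableOn,
    integral_sub hf.integrableOn hg.integrableOn]
  ring

theorem invD_zero (x : ℝ) : invD (fun _ => 0) x = 0 := by simp [invD]

/-- A mean primitive need not decay, but it is bounded with all its derivatives. -/
theorem Cls.invD (hf : Sch f) : Smb (invD f) := by
  refine Cls.of_hasDerivAt (invD_hasDerivAt hf.integrable hf.continuous) (fun k hk => ?_) hf.smb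
  rw [Set.mem_singleton_iff] at hk
  subst hk
  exact ⟨_, fun x => by rw [pow_zero, one_mul]; exact norm_invD_le hf.integrable x⟩

/-- If `f` has integral zero, its mean primitive is the one vanishing at both ends, and inherits
the decay of `f`. -/
theorem pow_mul_norm_invD_le (hf : Integrable f) (h0 : ∫ y, f y = 0) {k : ℕ} {δ : ℝ}
    (h1 : ∀ x, |x| ^ k * ‖f x‖ ≤ δ) (h2 : ∀ x, |x| ^ (k + 2) * ‖f x‖ ≤ δ) (x : ℝ) :
    |x| ^ k * ‖KaupNewell.invD f x‖ ≤ 2 * δ * Real.pi := by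
  have hb : ∀ y, |y| ^ k * ‖f y‖ ≤ 2 * δ * (1 + y ^ 2)⁻¹ := fun y => by
    refine le_inv_one_add_sq (h1 y) ?_
    rw [← mul_assoc, ← pow_add, add_comm]
    exact h2 y
  have hδ : 0 ≤ δ := (by positivity : 0 ≤ |x| ^ k * ‖f x‖).trans (h1 x)
  have hi : Integrable fun y : ℝ => 2 * δ * (1 + y ^ 2)⁻¹ :=
    integrable_inv_one_add_sq.const_mul _
  -- both half-line integrals are controlled by the tail on the side of `x` away from the origin
  have key : ∀ s : Set ℝ, MeasurableSet s → (∀ y ∈ s, |x| ≤ |y|) →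
      |x| ^ k * ‖∫ y in s, f y‖ ≤ 2 * δ * Real.pi := fun s hs hsx => by
    calc |x| ^ k * ‖∫ y in s, f y‖ ≤ |x| ^ k * ∫ y in s, ‖f y‖ := by
          gcongr; exact norm_integral_le_integral_norm _
      _ = ∫ y in s, |x| ^ k * ‖f y‖ := (integral_const_mul _ _).symm
      _ ≤ ∫ y in s, 2 * δ * (1 + y ^ 2)⁻¹ := by
          refine setIntegral_mono_on (hf.norm.const_mul _).integrableOn hi.integrableOn hs
            fun y hy => le_trans ?_ (hb y)
          exact mul_le_mul_of_nonneg_right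
            (pow_le_pow_left₀ (abs_nonneg x) (hsx y hy) k) (norm_nonneg _)
      _ ≤ ∫ y, 2 * δ * (1 + y ^ 2)⁻¹ :=
          setIntegral_le_integral hi (Eventually.of_forall fun y => by positivity)
      _ = 2 * δ * Real.pi := by rw [integral_const_mul, integral_univ_inv_one_add_sq]
  rcases le_total 0 x with hx | hx
  · rw [invD_eq' hf, h0, mul_zero, zero_sub, norm_neg]
    refine key _ measurableSet_Ioi fun y hy => ?_
    rw [abs_of_nonneg hx]
    exact (le_of_lt hy).trans (le_abs_self y)
  · rw [invD_eq hf, h0, mul_zero, sub_zero]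
    refine key _ measurableSet_Iic fun y hy => ?_
    rw [abs_of_nonpos hx]
    exact (neg_le_neg hy).trans (neg_le_abs y)

theorem Cls.invD_of_integral_eq_zero (hf : Sch f) (h0 : ∫ y, f y = 0) :
    Sch (KaupNewell.invD f) := by
  refine Cls.of_hasDerivAt (invD_hasDerivAt hf.integrable hf.continuous) (fun k _ => ?_) hf
  obtain ⟨C, hC⟩ := hf.bound (Set.mem_univ k)
  obtain ⟨C', hC'⟩ := hf.bound (Set.mem_univ (k + 2))
  exact ⟨_, pow_mul_norm_invD_le hf.integrable h0 (δ := max C C')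
    (fun x => (hC x).trans (le_max_left _ _)) fun x => (hC' x).trans (le_max_right _ _)⟩

/-- The limits of the mean primitive at the two ends are `∓ (∫ f) / 2`. -/
theorem Cls.integral_eq_zero_of_invD (hf : Sch f) (h : Sch (KaupNewell.invD f)) :
    ∫ y, f y = 0 := by
  have := tendsto_nhds_unique (invD_tendsto_atTop hf.integrable) h.tendsto_atTop
  simpa using this

theorem Cls.integral_deriv_eq_zero (hf : Sch f) : ∫ y, _root_.deriv f y = 0 :=
  integral_eq_zero_of_hasDerivAt_of_integrable hf.hasDerivAt hf.deriv.integrable hf.integrable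

theorem Cls.invD_deriv (hf : Sch f) : KaupNewell.invD (_root_.deriv f) = f := by
  funext x
  rw [invD_eq hf.deriv.integrable, hf.integral_deriv_eq_zero, mul_zero, sub_zero,
    integral_Iic_of_hasDerivAt_of_tendsto' (fun y _ => hf.hasDerivAt y)
      hf.deriv.integrable.integrableOn hf.tendsto_atBot, sub_zero]

/-- `∂⁻¹` is skew-symmetric: the boundary terms at `±∞` cancel by the choice of the mean
primitive. -/
theorem integral_mul_invD (hf : Sch f) (hg : Sch g) :
    ∫ x, f x * invD g x = -∫ x, g x * invD f x := by
  have h := integral_of_hasDerivAt_of_tendsto (f := fun x => invD f x * invD g x)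
    (f' := fun x => f x * invD g x + invD f x * g x)
    (fun x => (invD_hasDerivAt hf.integrable hf.continuous x).mul
      (invD_hasDerivAt hg.integrable hg.continuous x))
    ((hf.mul hg.invD).add (hf.invD.mul' hg)).integrable
    ((invD_tendsto_atBot hf.integrable).mul (invD_tendsto_atBot hg.integrable))
    ((invD_tendsto_atTop hf.integrable).mul (invD_tendsto_atTop hg.integrable))
  rw [integral_add (hf.mul hg.invD).integrable (hf.invD.mul' hg).integrable, neg_mul_neg,
    sub_self] at h
  rw [eq_neg_of_add_eq_zero_left h]
  simp only [mul_comm]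

end InvD

/-! ### Differentiable curves of functions -/

/-- The curve `ε ↦ f ε` of bounded smooth functions is differentiable at `0` with derivative `φ`,
in the topology of smooth functions all of whose derivatives are `O(|x| ^ (-k))`, `k ∈ K`. The
functions `f ε` themselves need not decay. -/
def VarDer (K : Set ℕ) (f : ℝ → ℝ → ℂ) (φ : ℝ → ℂ) : Prop :=
  (∀ ε, Smb (f ε)) ∧ Cls K φ ∧
    ∀ n, Tower (LittleO K (𝓝[≠] (0 : ℝ))) n fun ε x => (ε : ℂ)⁻¹ * (f ε x - f 0 x) - φ x

theorem Cls.tower {ι : Type*} {l : Filter ι} {K : Set ℕ} {f : ℝ → ℂ} (hf : Cls K f) (n : ℕ) :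
    Tower (BigO K l) n fun _ => f := by
  refine (hf n).reindex (fun _ => ()) fun f h k hk => ?_
  obtain ⟨C, hC⟩ := h k hk
  exact ⟨C, Eventually.of_forall fun _ => by simpa using hC⟩

namespace VarDer

variable {K : Set ℕ} {f g : ℝ → ℝ → ℂ} {φ ψ : ℝ → ℂ}

theorem smb (hf : VarDer K f φ) (ε : ℝ) : Smb (f ε) := hf.1 ε

theorem cls (hf : VarDer K f φ) : Cls K φ := hf.2.1

theorem mono {K' : Set ℕ} (hK : K' ⊆ K) (hf : VarDer K f φ) : VarDer K' f φ :=
  ⟨hf.1, hf.2.1.mono hK, fun n => (hf.2.2 n).map fun _ => LittleO.mono hK⟩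

theorem bounded (hf : VarDer Set.univ f φ) : VarDer {0} f φ := hf.mono (Set.subset_univ _)

theorem tendsto_coe : Tendsto (fun ε : ℝ => (ε : ℂ)) (𝓝[≠] 0) (𝓝 0) := by
  have : Tendsto (fun ε : ℝ => (ε : ℂ)) (𝓝 0) (𝓝 ((0 : ℝ) : ℂ)) :=
    Complex.continuous_ofReal.tendsto 0
  rw [Complex.ofReal_zero] at this
  exact this.mono_left nhdsWithin_le_nhds

theorem tower_sub (hf : VarDer K f φ) (n : ℕ) :
    Tower (LittleO K (𝓝[≠] (0 : ℝ))) n fun ε x => f ε x - f 0 x := by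
  have h1 : Tower (BigO K (𝓝[≠] (0 : ℝ))) n fun ε x =>
      ((ε : ℂ)⁻¹ * (f ε x - f 0 x) - φ x) + φ x :=
    ((hf.2.2 n).map fun _ => LittleO.bigO).add (fun _ _ => BigO.add) (hf.cls.tower n)
  have h2 := h1.smul (p' := LittleO K (𝓝[≠] (0 : ℝ))) (fun ε : ℝ => (ε : ℂ))
    fun _ h => h.small_mul tendsto_coe
  refine cast (congrArg _ ?_) h2
  funext ε x
  rcases eq_or_ne ε 0 with rfl | hε
  · simp
  · have : (ε : ℂ) ≠ 0 := by exact_mod_cast hε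
    field_simp
    ring

theorem tower_bigO (hf : VarDer {0} f φ) (n : ℕ) : Tower (BigO {0} (𝓝[≠] (0 : ℝ))) n f := by
  have := ((hf.tower_sub n).map fun _ => LittleO.bigO).add (fun _ _ => BigO.add)
    ((hf.smb 0).tower n)
  simpa using this

theorem congr_fun (hf : VarDer K f φ) (h : ∀ ε x, f ε x = g ε x) : VarDer K g φ := by
  have : f = g := by funext ε x; exact h ε x
  exact this ▸ hf

theorem congr_der (hf : VarDer K f φ) (h : ∀ x, φ x = ψ x) : VarDer K f ψ := by
  have : φ = ψ := by funext x; exact h x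
  exact this ▸ hf

theorem const {c : ℝ → ℂ} (hc : Smb c) : VarDer K (fun _ => c) fun _ => 0 := by
  refine ⟨fun _ => hc, Cls.zero, fun n => ?_⟩
  have := ((Cls.zero (K := K)).tower (l := 𝓝[≠] (0 : ℝ)) n).smul
    (p' := LittleO K (𝓝[≠] (0 : ℝ))) (fun ε : ℝ => (ε : ℂ)) fun _ h => h.small_mul tendsto_coe
  simpa using this

theorem add (hf : VarDer K f φ) (hg : VarDer K g ψ) :
    VarDer K (fun ε x => f ε x + g ε x) fun x => φ x + ψ x := by
  refine ⟨fun ε => (hf.smb ε).add (hg.smb ε), hf.cls.add hg.cls, fun n => ?_⟩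
  refine cast (congrArg _ ?_) ((hf.2.2 n).add (fun _ _ => LittleO.add) (hg.2.2 n))
  funext ε x
  ring

theorem const_mul (hf : VarDer K f φ) (c : ℂ) :
    VarDer K (fun ε x => c * f ε x) fun x => c * φ x := by
  refine ⟨fun ε => (hf.smb ε).const_mul c, hf.cls.const_mul c, fun n => ?_⟩
  refine cast (congrArg _ ?_) ((hf.2.2 n).smul (p' := LittleO K _) (fun _ => c)
    fun _ h => h.const_mul c)
  funext ε x
  ring

theorem neg (hf : VarDer K f φ) : VarDer K (fun ε x => -f ε x) fun x => -φ x := by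
  simpa only [neg_one_mul] using hf.const_mul (-1)

theorem sub (hf : VarDer K f φ) (hg : VarDer K g ψ) :
    VarDer K (fun ε x => f ε x - g ε x) fun x => φ x - ψ x := by
  simpa only [sub_eq_add_neg] using hf.add hg.neg

theorem sum {κ : Type*} (s : Finset κ) {f : κ → ℝ → ℝ → ℂ} {φ : κ → ℝ → ℂ}
    (h : ∀ k ∈ s, VarDer K (f k) (φ k)) :
    VarDer K (fun ε x => ∑ k ∈ s, f k ε x) fun x => ∑ k ∈ s, φ k x := by
  classical
  induction s using Finset.induction_on with
  | empty => simpa using const (K := K) Cls.zero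
  | insert a s ha ih =>
    simp only [Finset.sum_insert ha]
    exact (h a (Finset.mem_insert_self _ _)).add
      (ih fun k hk => h k (Finset.mem_insert_of_mem hk))

/-- Leibniz rule, given the convergence of the difference quotients of the second factor multiplied by
the initial value of the first one. -/
theorem mul_aux (hf : VarDer K f φ) (hg : VarDer {0} g ψ)
    (h : ∀ n, Tower (LittleO K (𝓝[≠] (0 : ℝ))) n
      fun ε x => f 0 x * ((ε : ℂ)⁻¹ * (g ε x - g 0 x) - ψ x))
    (hcls : Cls K fun x => f 0 x * ψ x) :
    VarDer K (fun ε x => f ε x * g ε x) fun x => φ x * g 0 x + f 0 x * ψ x := by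
  refine ⟨fun ε => (hf.smb ε).mul (hg.smb ε), (hf.cls.mul (hg.smb 0)).add hcls, fun n => ?_⟩
  have h1 := (hf.2.2 n).mul (p'' := LittleO K (𝓝[≠] (0 : ℝ))) (fun _ _ => LittleO.add)
    (fun _ _ => LittleO.mul_bigO) (hg.tower_bigO n)
  have h2 := (hf.cls.tower (l := 𝓝[≠] (0 : ℝ)) n).mul (p'' := LittleO K (𝓝[≠] (0 : ℝ)))
    (fun _ _ => LittleO.add) (fun _ _ => BigO.mul_littleO) (hg.tower_sub n)
  refine cast (congrArg _ ?_) ((h1.add (fun _ _ => LittleO.add) h2).add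
    (fun _ _ => LittleO.add) (h n))
  funext ε x
  ring

/-- Leibniz rule; the second curve need not have a rapidly decreasing derivative if the first
curve starts at a rapidly decreasing function. -/
theorem mul_bounded (hf : VarDer K f φ) (h0 : Cls K (f 0)) (hg : VarDer {0} g ψ) :
    VarDer K (fun ε x => f ε x * g ε x) fun x => φ x * g 0 x + f 0 x * ψ x :=
  hf.mul_aux hg (fun n => (h0.tower n).mul (fun _ _ => LittleO.add)
    (fun _ _ => BigO.mul_littleO) (hg.2.2 n)) (h0.mul hg.cls)

theorem mul (h0 : 0 ∈ K) (hf : VarDer K f φ) (hg : VarDer K g ψ) :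
    VarDer K (fun ε x => f ε x * g ε x) fun x => φ x * g 0 x + f 0 x * ψ x := by
  refine hf.mul_aux (hg.mono (Set.singleton_subset_iff.2 h0)) (fun n => ?_)
    ((hf.smb 0).mul' hg.cls)
  have := (hg.2.2 n).mul (p'' := LittleO K (𝓝[≠] (0 : ℝ))) (fun _ _ => LittleO.add)
    (fun _ _ => LittleO.mul_bigO) ((hf.smb 0).tower n)
  simpa only [mul_comm] using this

theorem deriv (hf : VarDer K f φ) :
    VarDer K (fun ε => deriv (f ε)) (deriv φ) := by
  refine ⟨fun ε => (hf.smb ε).deriv, hf.cls.deriv, fun n => ?_⟩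
  refine cast (congrArg _ ?_) (hf.2.2 (n + 1)).2.2
  funext ε x
  exact (((((hf.smb ε).hasDerivAt x).sub ((hf.smb 0).hasDerivAt x)).const_mul _).sub
    (hf.cls.hasDerivAt x)).deriv

theorem sch_quot (hf : VarDer Set.univ f φ) (hs : ∀ ε, Sch (f ε)) (ε : ℝ) :
    Sch fun x => (ε : ℂ)⁻¹ * (f ε x - f 0 x) - φ x :=
  (((hs ε).sub (hs 0)).const_mul _).sub hf.cls

theorem hasDerivAt (hf : VarDer {0} f φ) (x : ℝ) :
    HasDerivAt (fun ε => f ε x) (φ x) 0 := by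
  rw [hasDerivAt_iff_tendsto_slope_zero, tendsto_iff_norm_sub_tendsto_zero,
    Metric.tendsto_nhds]
  intro δ hδ
  filter_upwards [(hf.2.2 0) 0 rfl (δ / 2) (half_pos hδ)] with ε h
  have := h x
  rw [pow_zero, one_mul] at this
  simp only [zero_add, real_smul, ofReal_inv, dist_zero_right, norm_norm]
  linarith

/-- Two curves which agree have the same derivative. -/
theorem unique (hf : VarDer {0} f φ) (hg : VarDer {0} f ψ) : φ = ψ :=
  funext fun x => (hf.hasDerivAt x).unique (hg.hasDerivAt x)

theorem tendsto_integral_norm (hf : VarDer Set.univ f φ) :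
    ∀ δ > 0, ∀ᶠ ε : ℝ in 𝓝[≠] 0,
      ∫ x, ‖(ε : ℂ)⁻¹ * (f ε x - f 0 x) - φ x‖ ≤ δ := by
  intro δ hδ
  have hp := Real.pi_pos
  filter_upwards [(hf.2.2 0) 0 trivial (δ / (2 * Real.pi)) (by positivity),
    (hf.2.2 0) 2 trivial (δ / (2 * Real.pi)) (by positivity)] with ε h0 h2
  calc ∫ x, ‖(ε : ℂ)⁻¹ * (f ε x - f 0 x) - φ x‖
      ≤ ∫ x : ℝ, 2 * (δ / (2 * Real.pi)) * (1 + x ^ 2)⁻¹ := by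
        refine integral_mono_of_nonneg (Eventually.of_forall fun x => norm_nonneg _)
          (integrable_inv_one_add_sq.const_mul _) (Eventually.of_forall fun x => ?_)
        refine le_inv_one_add_sq ?_ (h2 x)
        have := h0 x
        rwa [pow_zero, one_mul] at this
    _ = δ := by
        rw [integral_const_mul, integral_univ_inv_one_add_sq]
        field_simp

theorem integral (hf : VarDer Set.univ f φ) (hs : ∀ ε, Sch (f ε)) :
    HasDerivAt (fun ε => ∫ x, f ε x) (∫ x, φ x) 0 := by
  rw [hasDerivAt_iff_tendsto_slope_zero, tendsto_iff_norm_sub_tendsto_zero,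
    Metric.tendsto_nhds]
  intro δ hδ
  filter_upwards [hf.tendsto_integral_norm (δ / 2) (half_pos hδ)] with ε h
  have : (ε⁻¹ : ℝ) • ((∫ x, f (0 + ε) x) - ∫ x, f 0 x) - ∫ x, φ x =
      ∫ x, ((ε : ℂ)⁻¹ * (f ε x - f 0 x) - φ x) := by
    rw [integral_sub (((hs ε).sub (hs 0)).const_mul _).integrable hf.cls.integrable,
      integral_const_mul, integral_sub (hs ε).integrable (hs 0).integrable, zero_add, real_smul,
      ofReal_inv]
  rw [this, dist_zero_right, norm_norm]
  linarith [norm_integral_le_integral_norm (μ := volume)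
    (fun x => (ε : ℂ)⁻¹ * (f ε x - f 0 x) - φ x)]

theorem invD_quot (hf : VarDer Set.univ f φ) (hs : ∀ ε, Sch (f ε)) (ε x : ℝ) :
    (ε : ℂ)⁻¹ * (invD (f ε) x - invD (f 0) x) - invD φ x =
      invD (fun x => (ε : ℂ)⁻¹ * (f ε x - f 0 x) - φ x) x := by
  rw [invD_sub (((hs ε).sub (hs 0)).const_mul _).integrable hf.cls.integrable, invD_const_mul,
    invD_sub (hs ε).integrable (hs 0).integrable]

theorem deriv_invD_quot (hf : VarDer Set.univ f φ) (hs : ∀ ε, Sch (f ε)) (ε : ℝ) :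
    _root_.deriv (fun x => (ε : ℂ)⁻¹ * (invD (f ε) x - invD (f 0) x) - invD φ x) =
      fun x => (ε : ℂ)⁻¹ * (f ε x - f 0 x) - φ x := by
  funext x
  rw [funext (hf.invD_quot hs ε)]
  exact (invD_hasDerivAt (hf.sch_quot hs ε).integrable (hf.sch_quot hs ε).continuous x).deriv

theorem invD (hf : VarDer Set.univ f φ) (hs : ∀ ε, Sch (f ε)) :
    VarDer {0} (fun ε => invD (f ε)) (invD φ) := by
  refine ⟨fun ε => (hs ε).invD, hf.cls.invD, fun n => ?_⟩
  have h0 : LittleO {0} (𝓝[≠] (0 : ℝ)) fun ε x =>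
      (ε : ℂ)⁻¹ * (KaupNewell.invD (f ε) x - KaupNewell.invD (f 0) x) - KaupNewell.invD φ x := by
    intro k hk δ hδ
    rw [Set.mem_singleton_iff] at hk
    subst hk
    filter_upwards [hf.tendsto_integral_norm δ hδ] with ε h x
    rw [pow_zero, one_mul, hf.invD_quot hs]
    exact (norm_invD_le (hf.sch_quot hs ε).integrable x).trans h
  cases n with
  | zero => exact h0
  | succ n =>
    refine ⟨h0, fun ε => ((((hs ε).invD.sub (hs 0).invD).const_mul _).sub
      hf.cls.invD).differentiable, ?_⟩
    rw [funext (hf.deriv_invD_quot hs)]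
    exact hf.bounded.2.2 n

/-- On curves of rapidly decreasing functions with rapidly decreasing mean primitive, `∂⁻¹`
preserves differentiability in the topology of rapidly decreasing functions. -/
theorem invD_sch (hf : VarDer Set.univ f φ) (hs : ∀ ε, Sch (f ε))
    (hi : ∀ ε, Sch (KaupNewell.invD (f ε))) :
    VarDer Set.univ (fun ε => KaupNewell.invD (f ε)) (KaupNewell.invD φ) := by
  have hz : ∀ ε, ∫ x, f ε x = 0 := fun ε => (hs ε).integral_eq_zero_of_invD (hi ε)
  have hφ : ∫ x, φ x = 0 := by
    have h1 := hf.integral hs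
    simp only [hz] at h1
    exact h1.unique (hasDerivAt_const _ _)
  refine ⟨fun ε => (hi ε).smb, hf.cls.invD_of_integral_eq_zero hφ, fun n => ?_⟩
  have h0 : LittleO Set.univ (𝓝[≠] (0 : ℝ)) fun ε x =>
      (ε : ℂ)⁻¹ * (KaupNewell.invD (f ε) x - KaupNewell.invD (f 0) x) - KaupNewell.invD φ x := by
    intro k _ δ hδ
    have hp := Real.pi_pos
    filter_upwards [(hf.2.2 0) k trivial (δ / (2 * Real.pi)) (by positivity),
      (hf.2.2 0) (k + 2) trivial (δ / (2 * Real.pi)) (by positivity)] with ε h1 h2 x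
    rw [hf.invD_quot hs]
    have hq : ∫ x, ((ε : ℂ)⁻¹ * (f ε x - f 0 x) - φ x) = 0 := by
      rw [integral_sub (((hs ε).sub (hs 0)).const_mul _).integrable hf.cls.integrable,
        integral_const_mul, integral_sub (hs ε).integrable (hs 0).integrable, hz, hz, hφ]
      simp
    refine (pow_mul_norm_invD_le (hf.sch_quot hs ε).integrable hq h1 h2 x).trans_eq ?_
    field_simp
  cases n with
  | zero => exact h0
  | succ n =>
    refine ⟨h0, fun ε => ((((hs ε).invD.sub (hs 0).invD).const_mul _).sub
      hf.cls.invD).differentiable, ?_⟩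
    rw [funext (hf.deriv_invD_quot hs)]
    exact hf.2.2 n

end VarDer

/-! ### Components of the phase space -/

section Phase

variable {N : ℕ}

/-- The coordinate `q_j` as a functional. -/
def qCoord (j : Fin N) : (Vec N × Vec N) →L[ℝ] ℂ :=
  (ContinuousLinearMap.proj j).comp (ContinuousLinearMap.fst ℝ (Vec N) (Vec N))

/-- The coordinate `r_j` as a functional. -/
def rCoord (j : Fin N) : (Vec N × Vec N) →L[ℝ] ℂ :=
  (ContinuousLinearMap.proj j).comp (ContinuousLinearMap.snd ℝ (Vec N) (Vec N))

theorem sch_fst (f : Phase N) (j : Fin N) : Sch fun x => (f x).1 j :=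
  sch_schwartzMap (f.postcompCLM (qCoord j))

theorem sch_snd (f : Phase N) (j : Fin N) : Sch fun x => (f x).2 j :=
  sch_schwartzMap (f.postcompCLM (rCoord j))

theorem isSchwartz_iff {f : VField N} :
    IsSchwartz f ↔ (∀ j, Sch fun x => (f x).1 j) ∧ ∀ j, Sch fun x => (f x).2 j := by
  constructor
  · rintro ⟨g, rfl⟩
    exact ⟨sch_fst g, sch_snd g⟩
  · rintro ⟨h1, h2⟩
    choose u hu using fun j => (h1 j).exists_schwartzMap
    choose v hv using fun j => (h2 j).exists_schwartzMap
    refine ⟨∑ j, (u j).postcompCLM ((ContinuousLinearMap.inl ℝ (Vec N) (Vec N)).comp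
      (ContinuousLinearMap.single ℝ (fun _ : Fin N => ℂ) j)) +
      ∑ j, (v j).postcompCLM ((ContinuousLinearMap.inr ℝ (Vec N) (Vec N)).comp
      (ContinuousLinearMap.single ℝ (fun _ : Fin N => ℂ) j)), ?_⟩
    funext x
    have hu' : ∀ j, u j x = (f x).1 j := fun j => congrFun (hu j) x
    have hv' : ∀ j, v j x = (f x).2 j := fun j => congrFun (hv j) x
    simp only [_root_.add_apply, _root_.sum_apply, SchwartzMap.postcompCLM_apply,
      ContinuousLinearMap.comp_apply, hu', hv']
    ext j <;> simp [Finset.sum_apply, Prod.fst_sum, Prod.snd_sum, Pi.single_apply]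

theorem varDer_of_tendsto {γ : ℝ → Phase N} {φ : Phase N}
    (h : Tendsto (fun ε : ℝ => ε⁻¹ • (γ ε - γ 0)) (𝓝[≠] 0) (𝓝 φ))
    (L : (Vec N × Vec N) →L[ℝ] ℂ) :
    VarDer Set.univ (fun ε x => L (γ ε x)) fun x => L (φ x) := by
  refine ⟨fun ε => (sch_schwartzMap ((γ ε).postcompCLM L)).smb,
    sch_schwartzMap (φ.postcompCLM L), fun n => ?_⟩
  have h1 : Tendsto (fun ε : ℝ => (ε⁻¹ • (γ ε - γ 0) - φ).postcompCLM L) (𝓝[≠] 0) (𝓝 0) := by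
    have h2 : Tendsto (fun ε : ℝ => ε⁻¹ • (γ ε - γ 0) - φ) (𝓝[≠] 0) (𝓝 0) := by
      simpa using h.sub_const φ
    have h3 := ((SchwartzMap.postcompCLM (E := ℝ) L).continuous.tendsto 0).comp h2
    rwa [map_zero] at h3
  refine cast (congrArg _ ?_) (tower_of_tendsto_schwartzMap _ h1 n)
  funext ε x
  simp

end Phase

/-! ### Linear equations on the line with integrable coefficients -/

section LinearODE

variable {V : Type*} [NormedAddCommGroup V] [NormedSpace ℝ V] [CompleteSpace V]

theorem hasDerivAt_integral_Iic {G : ℝ → V} (hi : Integrable G) (hc : Continuous G) (x : ℝ) :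
    HasDerivAt (fun x => ∫ y in Set.Iic x, G y) (G x) x := by
  have h : ∀ y, ∫ t in Set.Iic y, G t = (∫ t in Set.Iic 0, G t) + ∫ t in (0 : ℝ)..y, G t :=
    fun y => by
      rw [← intervalIntegral.integral_Iic_sub_Iic hi.integrableOn hi.integrableOn]
      abel
  rw [funext h]
  exact (intervalIntegral.integral_hasDerivAt_right hi.intervalIntegrable
    (hc.stronglyMeasurableAtFilter _ _) hc.continuousAt).const_add _

/-- The equation `D' = A(x) D + F` with integrable Lipschitz constant `κ` of `A` has a bounded
solution vanishing at `-∞`. The integral equation is a contraction for the norm weighted by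
`exp (-2 ∫_{-∞}^x κ)`. -/
theorem exists_bounded_solution_atBot {A : ℝ → V → V} {F : ℝ → V} {κ : ℝ → ℝ}
    (hκc : Continuous κ) (hκi : Integrable κ) (hκ0 : ∀ x, 0 ≤ κ x)
    (hA : Continuous fun p : ℝ × V => A p.1 p.2) (hA0 : ∀ x, A x 0 = 0)
    (hL : ∀ x v w, ‖A x v - A x w‖ ≤ κ x * ‖v - w‖)
    (hFc : Continuous F) (hFi : Integrable F) :
    ∃ D : ℝ → V, (∀ x, HasDerivAt D (A x (D x) + F x) x) ∧ Tendsto D atBot (𝓝 0) ∧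
      ∃ C, ∀ x, ‖D x‖ ≤ C := by
  set H : ℝ → ℝ := fun x => ∫ y in Set.Iic x, κ y with hH
  have hHd : ∀ x, HasDerivAt H (κ x) x := hasDerivAt_integral_Iic hκi hκc
  have hHc : Continuous H := continuous_iff_continuousAt.2 fun x => (hHd x).continuousAt
  have hH0 : ∀ x, 0 ≤ H x := fun x => integral_nonneg hκ0
  have hHb : ∀ x, H x ≤ ∫ y, κ y := fun x =>
    setIntegral_le_integral hκi (Eventually.of_forall hκ0)
  set T : ℝ := ∫ y, κ y with hT
  have hA1 : ∀ x v, ‖A x v‖ ≤ κ x * ‖v‖ := fun x v => by simpa [hA0] using hL x v 0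
  have hE1 : ∀ x, Real.exp (2 * H x) ≤ Real.exp (2 * T) := fun x =>
    Real.exp_le_exp.2 (by linarith [hHb x])
  -- the integrand of the integral equation, in terms of the weighted unknown `u`
  let G : BoundedContinuousFunction ℝ V → ℝ → V := fun u y =>
    A y (Real.exp (2 * H y) • u y) + F y
  have hAu : ∀ u : BoundedContinuousFunction ℝ V,
      Continuous fun y => A y (Real.exp (2 * H y) • u y) := fun u =>
    hA.comp (continuous_id.prodMk
      ((Real.continuous_exp.comp (continuous_const.mul hHc)).smul u.continuous))
  have hAui : ∀ u : BoundedContinuousFunction ℝ V,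
      Integrable fun y => A y (Real.exp (2 * H y) • u y) := fun u => by
    refine (hκi.mul_const (Real.exp (2 * T) * ‖u‖)).mono' (hAu u).aestronglyMeasurable
      (Eventually.of_forall fun y => (hA1 _ _).trans ?_)
    refine mul_le_mul_of_nonneg_left ?_ (hκ0 y)
    rw [norm_smul, Real.norm_eq_abs, abs_of_pos (Real.exp_pos _)]
    exact mul_le_mul (hE1 y) (u.norm_coe_le_norm y) (norm_nonneg _) (Real.exp_pos _).le
  have hGc : ∀ u, Continuous (G u) := fun u => (hAu u).add hFc
  have hGi : ∀ u, Integrable (G u) := fun u => (hAui u).add hFi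
  have hΦc : ∀ u, Continuous fun x => Real.exp (-(2 * H x)) • ∫ y in Set.Iic x, G u y := fun u =>
    (Real.continuous_exp.comp (continuous_const.mul hHc).neg).smul
      (continuous_iff_continuousAt.2 fun x =>
        (hasDerivAt_integral_Iic (hGi u) (hGc u) x).continuousAt)
  have hle1 : ∀ x, Real.exp (-(2 * H x)) ≤ 1 := fun x =>
    Real.exp_le_one_iff.2 (by linarith [hH0 x])
  let Φ : BoundedContinuousFunction ℝ V → BoundedContinuousFunction ℝ V := fun u =>
    BoundedContinuousFunction.ofNormedAddCommGroup _ (hΦc u) (∫ y, ‖G u y‖) fun x => by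
      rw [norm_smul, Real.norm_eq_abs, abs_of_pos (Real.exp_pos _)]
      calc Real.exp (-(2 * H x)) * ‖∫ y in Set.Iic x, G u y‖
          ≤ 1 * ∫ y, ‖G u y‖ := by
            refine mul_le_mul (hle1 x) ?_ (norm_nonneg _) zero_le_one
            exact (norm_integral_le_integral_norm _).trans (setIntegral_le_integral (hGi u).norm
              (Eventually.of_forall fun _ => norm_nonneg _))
        _ = _ := one_mul _
  have hΦ : ContractingWith (1 / 2) Φ := by
    refine ⟨by norm_num, LipschitzWith.of_dist_le_mul fun u v => ?_⟩
    rw [BoundedContinuousFunction.dist_le (by positivity)]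
    intro x
    have hx : Φ u x - Φ v x = Real.exp (-(2 * H x)) • ∫ y in Set.Iic x,
        (A y (Real.exp (2 * H y) • u y) - A y (Real.exp (2 * H y) • v y)) := by
      change Real.exp (-(2 * H x)) • (∫ y in Set.Iic x, G u y) -
        Real.exp (-(2 * H x)) • (∫ y in Set.Iic x, G v y) = _
      rw [← smul_sub, ← integral_sub (hGi u).integrableOn (hGi v).integrableOn]
      simp only [G, add_sub_add_right_eq_sub]
    -- `κ exp (2 H)` is the derivative of `exp (2 H) / 2`
    have hw : ∀ y, HasDerivAt (fun y => Real.exp (2 * H y) / 2) (κ y * Real.exp (2 * H y)) y :=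
      fun y => by
        have := (((hHd y).const_mul 2).exp).div_const 2
        refine this.congr_deriv ?_
        ring
    have hwi : Integrable fun y => κ y * Real.exp (2 * H y) := by
      refine (hκi.mul_const (Real.exp (2 * T))).mono' ((hκc.mul (Real.continuous_exp.comp
        (continuous_const.mul hHc))).aestronglyMeasurable) (Eventually.of_forall fun y => ?_)
      rw [norm_mul, Real.norm_eq_abs, Real.norm_eq_abs, abs_of_nonneg (hκ0 y),
        abs_of_pos (Real.exp_pos _)]
      exact mul_le_mul_of_nonneg_left (hE1 y) (hκ0 y)
    have hlim : Tendsto (fun y => Real.exp (2 * H y) / 2) atBot (𝓝 (1 / 2)) := by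
      have h0 : Tendsto H atBot (𝓝 0) := tendsto_integral_Iic_zero tendsto_id
      have := (Real.continuous_exp.tendsto _).comp (h0.const_mul 2)
      simpa using this.div_const 2
    have hint : ∫ y in Set.Iic x, κ y * Real.exp (2 * H y) = Real.exp (2 * H x) / 2 - 1 / 2 :=
      integral_Iic_of_hasDerivAt_of_tendsto' (fun y _ => hw y) hwi.integrableOn hlim
    rw [dist_eq_norm, hx, norm_smul, Real.norm_eq_abs, abs_of_pos (Real.exp_pos _)]
    calc Real.exp (-(2 * H x)) * ‖∫ y in Set.Iic x,
          (A y (Real.exp (2 * H y) • u y) - A y (Real.exp (2 * H y) • v y))‖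
        ≤ Real.exp (-(2 * H x)) * ∫ y in Set.Iic x, κ y * Real.exp (2 * H y) * dist u v := by
          refine mul_le_mul_of_nonneg_left ?_ (Real.exp_pos _).le
          refine (norm_integral_le_integral_norm _).trans (integral_mono
            ((hAui u).sub (hAui v)).norm.integrableOn (hwi.mul_const _).integrableOn fun y => ?_)
          refine (hL y _ _).trans ?_
          rw [mul_assoc, ← smul_sub, norm_smul, Real.norm_eq_abs, abs_of_pos (Real.exp_pos _),
            ← dist_eq_norm]
          exact mul_le_mul_of_nonneg_left (mul_le_mul_of_nonneg_left
            (BoundedContinuousFunction.dist_coe_le_dist y) (Real.exp_pos _).le) (hκ0 y)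
      _ = (1 / 2 - Real.exp (-(2 * H x)) / 2) * dist u v := by
          have h1 : Real.exp (-(2 * H x)) * Real.exp (2 * H x) = 1 := by
            rw [← Real.exp_add]; simp
          rw [integral_mul_const, hint]
          linear_combination (dist u v / 2) * h1
      _ ≤ ((1 / 2 : NNReal) : ℝ) * dist u v := by
          refine mul_le_mul_of_nonneg_right ?_ dist_nonneg
          push_cast
          linarith [Real.exp_pos (-(2 * H x))]
  let u := hΦ.fixedPoint Φ
  have hu : ∀ x, u x = Real.exp (-(2 * H x)) • ∫ y in Set.Iic x, G u y := fun x => by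
    have h1 : Φ u = u := hΦ.fixedPoint_isFixedPt
    conv_lhs => rw [← h1]
    rfl
  have hD : ∀ x, Real.exp (2 * H x) • u x = ∫ y in Set.Iic x, G u y := fun x => by
    rw [hu x, smul_smul, ← Real.exp_add]
    simp
  refine ⟨fun x => Real.exp (2 * H x) • u x, fun x => ?_, ?_, Real.exp (2 * T) * ‖u‖, fun x => ?_⟩
  · rw [funext hD]
    have := hasDerivAt_integral_Iic (hGi u) (hGc u) x
    simp only [G] at this ⊢
    rwa [hD x] at this
  · rw [funext hD]
    exact tendsto_integral_Iic_zero tendsto_id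
  · rw [norm_smul, Real.norm_eq_abs, abs_of_pos (Real.exp_pos _)]
    exact mul_le_mul (hE1 x) (u.norm_coe_le_norm x) (norm_nonneg _) (Real.exp_pos _).le

theorem exists_bounded_solution_atTop {A : ℝ → V → V} {F : ℝ → V} {κ : ℝ → ℝ}
    (hκc : Continuous κ) (hκi : Integrable κ) (hκ0 : ∀ x, 0 ≤ κ x)
    (hA : Continuous fun p : ℝ × V => A p.1 p.2) (hA0 : ∀ x, A x 0 = 0)
    (hL : ∀ x v w, ‖A x v - A x w‖ ≤ κ x * ‖v - w‖)
    (hFc : Continuous F) (hFi : Integrable F) :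
    ∃ D : ℝ → V, (∀ x, HasDerivAt D (A x (D x) + F x) x) ∧ Tendsto D atTop (𝓝 0) ∧
      ∃ C, ∀ x, ‖D x‖ ≤ C := by
  obtain ⟨D, h1, h2, C, h3⟩ := exists_bounded_solution_atBot (A := fun x v => -A (-x) v)
    (F := fun x => -F (-x)) (κ := fun x => κ (-x)) (hκc.comp continuous_neg) hκi.comp_neg
    (fun x => hκ0 _) (hA.comp (continuous_fst.neg.prodMk continuous_snd)).neg
    (fun x => by simp [hA0]) (fun x v w => by
      rw [neg_sub_neg, norm_sub_rev]; exact hL _ _ _)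
    (hFc.comp continuous_neg).neg hFi.comp_neg.neg
  refine ⟨fun x => D (-x), fun x => ?_, h2.comp tendsto_neg_atTop_atBot, C, fun x => h3 _⟩
  have := (h1 (-x)).scomp x (hasDerivAt_neg x)
  refine this.congr_deriv ?_
  simp [add_comm]

/-- Gronwall's inequality on an infinite interval: `exp (-∫ κ) f` is monotone and tends to zero. -/
theorem eq_zero_of_deriv_le_atBot {f f' κ : ℝ → ℝ} (hκc : Continuous κ) (hκi : Integrable κ)
    (hf : ∀ x, HasDerivAt f (f' x) x) (h0 : ∀ x, 0 ≤ f x) (hle : ∀ x, |f' x| ≤ κ x * f x)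
    (hl : Tendsto f atBot (𝓝 0)) (x : ℝ) : f x = 0 := by
  set H : ℝ → ℝ := fun x => ∫ y in Set.Iic x, κ y with hH
  have hHd : ∀ x, HasDerivAt H (κ x) x := hasDerivAt_integral_Iic hκi hκc
  have hd : ∀ x, HasDerivAt (fun x => Real.exp (-H x) * f x)
      (Real.exp (-H x) * (f' x - κ x * f x)) x := fun x => by
    refine ((hHd x).neg.exp.mul (hf x)).congr_deriv ?_
    simp only [Pi.neg_apply]
    ring
  have hanti : Antitone fun x => Real.exp (-H x) * f x :=
    antitone_of_deriv_nonpos (fun x => (hd x).differentiableAt) fun x => by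
      rw [(hd x).deriv]
      exact mul_nonpos_of_nonneg_of_nonpos (Real.exp_pos _).le
        (by linarith [le_abs_self (f' x), hle x])
  have hlim : Tendsto (fun x => Real.exp (-H x) * f x) atBot (𝓝 0) := by
    have hH0 : Tendsto H atBot (𝓝 0) := tendsto_integral_Iic_zero tendsto_id
    simpa using ((Real.continuous_exp.tendsto _).comp hH0.neg).mul hl
  have h1 := hanti.ge_of_tendsto hlim x
  exact le_antisymm (nonpos_of_mul_nonpos_right h1 (Real.exp_pos (-H x))) (h0 x)

theorem eq_zero_of_deriv_le {l : Filter ℝ} (hbt : l = atBot ∨ l = atTop) {f f' κ : ℝ → ℝ}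
    (hκc : Continuous κ) (hκi : Integrable κ)
    (hf : ∀ x, HasDerivAt f (f' x) x) (h0 : ∀ x, 0 ≤ f x) (hle : ∀ x, |f' x| ≤ κ x * f x)
    (hl : Tendsto f l (𝓝 0)) (x : ℝ) : f x = 0 := by
  rcases hbt with rfl | rfl
  · exact eq_zero_of_deriv_le_atBot hκc hκi hf h0 hle hl x
  · have h := eq_zero_of_deriv_le_atBot (f := fun x => f (-x)) (f' := fun x => -f' (-x))
      (κ := fun x => κ (-x)) (hκc.comp continuous_neg) hκi.comp_neg
      (fun x => ((hf (-x)).scomp x (hasDerivAt_neg x)).congr_deriv (by simp))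
      (fun x => h0 _) (fun x => by rw [abs_neg]; exact hle _)
      (hl.comp tendsto_neg_atBot_atTop) (-x)
    simpa using h

end LinearODE

/-! ### The transport equation `D' = F + s [X, D]` -/

section Transport

variable {n : Type*}

/-- Entrywise derivative of a matrix function. -/
def MDeriv (D D' : ℝ → Matrix n n ℂ) : Prop := ∀ x i j, HasDerivAt (fun y => D y i j) (D' x i j) x

/-- All entries of the matrix function belong to the class `K`. -/
def MCls (K : Set ℕ) (D : ℝ → Matrix n n ℂ) : Prop := ∀ i j, Cls K fun x => D x i j

/-- Matrix functions with rapidly decreasing entries. -/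
abbrev MSch (D : ℝ → Matrix n n ℂ) : Prop := MCls Set.univ D

/-- Matrix functions with bounded smooth entries. -/
abbrev MSmb (D : ℝ → Matrix n n ℂ) : Prop := MCls {0} D

namespace MCls

variable {K : Set ℕ} {D E : ℝ → Matrix n n ℂ}

theorem smb (h : MSch D) : MSmb D := fun i j => (h i j).smb

theorem add (h : MCls K D) (h' : MCls K E) : MCls K fun x => D x + E x :=
  fun i j => (h i j).add (h' i j)

theorem sub (h : MCls K D) (h' : MCls K E) : MCls K fun x => D x - E x :=
  fun i j => (h i j).sub (h' i j)

theorem neg (h : MCls K D) : MCls K fun x => -D x := fun i j => (h i j).neg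

theorem smul (c : ℂ) (h : MCls K D) : MCls K fun x => c • D x := fun i j => (h i j).const_mul c

theorem const (M : Matrix n n ℂ) : MSmb fun _ => M := fun _ _ => Cls.const _

theorem zero : MCls K fun _ => (0 : Matrix n n ℂ) := fun _ _ => Cls.zero

theorem sum {κ : Type*} (s : Finset κ) {F : κ → ℝ → Matrix n n ℂ} (h : ∀ k ∈ s, MCls K (F k)) :
    MCls K fun x => ∑ k ∈ s, F k x := fun i j => by
  simp only [Matrix.sum_apply]
  exact Cls.sum _ fun k hk => h k hk i j

theorem tendsto_zero (h : MSch D) {l : Filter ℝ} (hl : l = atBot ∨ l = atTop) :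
    Tendsto D l (𝓝 0) := by
  refine tendsto_pi_nhds.2 fun i => tendsto_pi_nhds.2 fun j => ?_
  rcases hl with rfl | rfl
  · exact (h i j).tendsto_atBot
  · exact (h i j).tendsto_atTop

variable [Fintype n]

theorem mul (h : MCls K D) (h' : MSmb E) : MCls K fun x => D x * E x := fun i j => by
  simp only [Matrix.mul_apply]
  exact Cls.sum _ fun k _ => (h i k).mul (h' k j)

theorem mul' (h : MSmb D) (h' : MCls K E) : MCls K fun x => D x * E x := fun i j => by
  simp only [Matrix.mul_apply]
  exact Cls.sum _ fun k _ => (h i k).mul' (h' k j)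

theorem trace (h : MCls K D) : Cls K fun x => (D x).trace := by
  simp only [Matrix.trace, Matrix.diag_apply]
  exact Cls.sum _ fun k _ => h k k

end MCls

namespace MDeriv

variable {D D' E E' : ℝ → Matrix n n ℂ}

theorem add (h : MDeriv D D') (h' : MDeriv E E') :
    MDeriv (fun x => D x + E x) fun x => D' x + E' x :=
  fun x i j => (h x i j).add (h' x i j)

theorem sub (h : MDeriv D D') (h' : MDeriv E E') :
    MDeriv (fun x => D x - E x) fun x => D' x - E' x :=
  fun x i j => (h x i j).sub (h' x i j)

theorem smul (c : ℂ) (h : MDeriv D D') : MDeriv (fun x => c • D x) fun x => c • D' x :=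
  fun x i j => (h x i j).const_mul c

theorem const (M : Matrix n n ℂ) : MDeriv (fun _ => M) fun _ => 0 :=
  fun x _ _ => hasDerivAt_const x _

theorem sum {κ : Type*} (s : Finset κ) {F F' : κ → ℝ → Matrix n n ℂ}
    (h : ∀ k ∈ s, MDeriv (F k) (F' k)) :
    MDeriv (fun x => ∑ k ∈ s, F k x) fun x => ∑ k ∈ s, F' k x := fun x i j => by
  simp only [Matrix.sum_apply]
  exact HasDerivAt.fun_sum fun k hk => h k hk x i j

theorem congr (h : MDeriv D D') (h' : ∀ x, D' x = E' x) : MDeriv D E' :=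
  fun x i j => by rw [← h' x]; exact h x i j

theorem unique (h : MDeriv D D') (h' : MDeriv D E') (x : ℝ) : D' x = E' x := by
  ext i j; exact (h x i j).unique (h' x i j)

theorem eq_const (h : MDeriv D fun _ => 0) (x y : ℝ) : D x = D y := by
  ext i j
  exact is_const_of_deriv_eq_zero (fun x => (h x i j).differentiableAt)
    (fun x => (h x i j).deriv) x y

variable [Fintype n]

theorem mul (h : MDeriv D D') (h' : MDeriv E E') :
    MDeriv (fun x => D x * E x) fun x => D' x * E x + D x * E' x := fun x i j => by
  simp only [Matrix.mul_apply, Matrix.add_apply]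
  rw [← Finset.sum_add_distrib]
  exact HasDerivAt.fun_sum fun k _ => (h x i k).mul (h' x k j)

theorem trace (h : MDeriv D D') (x : ℝ) :
    HasDerivAt (fun y => (D y).trace) (D' x).trace x := by
  simp only [Matrix.trace, Matrix.diag_apply]
  exact HasDerivAt.fun_sum fun k _ => h x k k

end MDeriv

theorem MCls.mDeriv {K : Set ℕ} {D : ℝ → Matrix n n ℂ} (h : MCls K D) :
    MDeriv D fun x => of fun i j => deriv (fun y => D y i j) x :=
  fun x i j => (h i j).hasDerivAt x

variable [Fintype n] {s : ℂ} {X F D E : ℝ → Matrix n n ℂ}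

/-- A bounded solution of the transport equation has bounded derivatives of all orders. -/
theorem mSmb_of_transport (hX : MSmb X) (hF : MSmb F)
    (hD : MDeriv D fun x => F x + s • (X x * D x - D x * X x))
    (hb : ∃ C, ∀ x i j, ‖D x i j‖ ≤ C) : MSmb D := by
  obtain ⟨C, hC⟩ := hb
  have h0 : ∀ i j, BigO {0} (pure ()) fun (_ : Unit) x => D x i j := fun i j k hk => by
    rw [Set.mem_singleton_iff] at hk
    subst hk
    exact ⟨C, by simpa using fun x => hC x i j⟩
  have hadd : ∀ f g : Unit → ℝ → ℂ, BigO {0} (pure ()) f → BigO {0} (pure ()) g →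
    BigO {0} (pure ()) fun i x => f i x + g i x := fun _ _ => BigO.add
  have key : ∀ m i j, Tower (BigO {0} (pure ())) m fun (_ : Unit) x => D x i j := by
    intro m
    induction m with
    | zero => exact h0
    | succ m ih =>
      intro i j
      refine ⟨h0 i j, fun _ x => (hD x i j).differentiableAt, ?_⟩
      have hd : (deriv fun x => D x i j) = fun x => F x i j +
          s * ((∑ k, X x i k * D x k j) + (-1) * ∑ k, D x i k * X x k j) := funext fun x => by
        rw [(hD x i j).deriv]
        simp [Matrix.mul_apply, sub_eq_add_neg, mul_add]
      have hsum : ∀ f : n → ℝ → ℂ, (∀ k, Tower (BigO {0} (pure ())) m fun _ : Unit => f k) →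
          Tower (BigO {0} (pure ())) m fun (_ : Unit) x => ∑ k, f k x := fun f hf => by
        classical
        suffices h : ∀ t : Finset n,
            Tower (BigO {0} (pure ())) m fun (_ : Unit) x => ∑ k ∈ t, f k x from h _
        intro t
        induction t using Finset.induction_on with
        | empty => simpa using (Cls.zero (K := {0})) m
        | insert a t ha iht =>
          simp only [Finset.sum_insert ha]
          exact Tower.add hadd (hf a) iht
      have hmul : ∀ f g : ℝ → ℂ, Tower (BigO {0} (pure ())) m (fun _ : Unit => f) →
          Tower (BigO {0} (pure ())) m (fun _ : Unit => g) →
          Tower (BigO {0} (pure ())) m fun (_ : Unit) x => f x * g x := fun f g hf hg =>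
        Tower.mul hadd (fun _ _ => BigO.mul) hf hg
      change Tower (BigO {0} (pure ())) m fun _ : Unit => deriv fun x => D x i j
      rw [hd]
      refine Tower.add hadd (hF i j m) (Tower.smul (fun _ => s) (fun _ h => h.const_mul s)
        (Tower.add hadd (hsum _ fun k => hmul _ _ (hX i k m) (ih k j))
          (Tower.smul (fun _ => -1) (fun _ h => h.const_mul (-1))
            (hsum _ fun k => hmul _ _ (ih i k) (hX k j m)))))
  exact fun i j m => key m i j

theorem norm_mul_entry_le (A B : Matrix n n ℂ) {c : ℝ} (hc : ∀ k l, ‖B k l‖ ≤ c) (i j : n) :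
    ‖(A * B) i j‖ ≤ (∑ k, ∑ l, ‖A k l‖) * c := by
  rw [Matrix.mul_apply]
  calc ‖∑ k, A i k * B k j‖ ≤ ∑ k, ‖A i k‖ * c :=
        norm_sum_le_of_le _ fun k _ => by
          rw [norm_mul]; exact mul_le_mul_of_nonneg_left (hc k j) (norm_nonneg _)
    _ = (∑ k, ‖A i k‖) * c := (Finset.sum_mul _ _ _).symm
    _ ≤ (∑ k, ∑ l, ‖A k l‖) * c := by
        refine mul_le_mul_of_nonneg_right ?_ ((norm_nonneg _).trans (hc i j))
        exact Finset.single_le_sum (f := fun k => ∑ l, ‖A k l‖)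
          (fun k _ => Finset.sum_nonneg fun l _ => norm_nonneg _) (Finset.mem_univ i)

theorem norm_mul_entry_le' (A B : Matrix n n ℂ) {c : ℝ} (hc : ∀ k l, ‖B k l‖ ≤ c) (i j : n) :
    ‖(B * A) i j‖ ≤ (∑ k, ∑ l, ‖A k l‖) * c := by
  have := norm_mul_entry_le Aᵀ Bᵀ (fun k l => hc l k) j i
  rw [← Matrix.transpose_mul, Matrix.transpose_apply] at this
  refine this.trans_eq ?_
  rw [Finset.sum_comm]
  rfl

theorem norm_commutator_entry_le (s : ℂ) (A B : Matrix n n ℂ) {c : ℝ} (hc : ∀ k l, ‖B k l‖ ≤ c)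
    (i j : n) : ‖(s • (A * B - B * A)) i j‖ ≤ 2 * ‖s‖ * (∑ k, ∑ l, ‖A k l‖) * c := by
  rw [Matrix.smul_apply, Matrix.sub_apply, smul_eq_mul, norm_mul]
  have h1 := norm_mul_entry_le A B hc i j
  have h2 := norm_mul_entry_le' A B hc i j
  calc ‖s‖ * ‖(A * B) i j - (B * A) i j‖
      ≤ ‖s‖ * ((∑ k, ∑ l, ‖A k l‖) * c + (∑ k, ∑ l, ‖A k l‖) * c) := by
        refine mul_le_mul_of_nonneg_left ((norm_sub_le _ _).trans (add_le_add h1 h2))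
          (norm_nonneg _)
    _ = _ := by ring

theorem continuous_sum_norm (hX : MSch X) : Continuous fun x => ∑ k, ∑ l, ‖X x k l‖ :=
  continuous_finsetSum _ fun k _ => continuous_finsetSum _ fun l _ => (hX k l).continuous.norm

theorem integrable_sum_norm (hX : MSch X) : Integrable fun x => ∑ k, ∑ l, ‖X x k l‖ :=
  integrable_finsetSum _ fun k _ => integrable_finsetSum _ fun l _ => (hX k l).integrable.norm

/-- Existence of the solution vanishing at one end. -/
theorem exists_transport {l : Filter ℝ} (hl : l = atBot ∨ l = atTop) (hX : MSch X)
    (hF : MSch F) (s : ℂ) :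
    ∃ D : ℝ → Matrix n n ℂ, MDeriv D (fun x => F x + s • (X x * D x - D x * X x)) ∧
      Tendsto D l (𝓝 0) ∧ MSmb D := by
  let A : ℝ → (n → n → ℂ) → n → n → ℂ := fun x v i j =>
    s * ((∑ k, X x i k * v k j) - ∑ k, v i k * X x k j)
  have hAof : ∀ x v i j, A x v i j = (s • (X x * of v - of v * X x)) i j := fun x v i j => by
    simp [A, Matrix.mul_apply]
  let F' : ℝ → n → n → ℂ := fun x => F x
  let κ : ℝ → ℝ := fun x => 2 * ‖s‖ * ∑ k, ∑ l, ‖X x k l‖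
  have hκc : Continuous κ := continuous_const.mul (continuous_sum_norm hX)
  have hκi : Integrable κ := (integrable_sum_norm hX).const_mul _
  have hκ0 : ∀ x, 0 ≤ κ x := fun x => by positivity
  have hXc : ∀ i j, Continuous fun p : ℝ × (n → n → ℂ) => X p.1 i j := fun i j =>
    (hX i j).continuous.comp continuous_fst
  have hA : Continuous fun p : ℝ × (n → n → ℂ) => A p.1 p.2 := by
    refine continuous_pi fun i => continuous_pi fun j => ?_
    refine continuous_const.mul (Continuous.sub ?_ ?_)
    · exact continuous_finsetSum _ fun k _ => (hXc i k).mul (by fun_prop)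
    · exact continuous_finsetSum _ fun k _ => Continuous.mul (by fun_prop) (hXc k j)
  have hA0 : ∀ x, A x 0 = 0 := fun x => by
    funext i j
    simp [A]
  have hL : ∀ x v w, ‖A x v - A x w‖ ≤ κ x * ‖v - w‖ := fun x v w => by
    refine (pi_norm_le_iff_of_nonneg (mul_nonneg (hκ0 x) (norm_nonneg _))).2 fun i =>
      (pi_norm_le_iff_of_nonneg (mul_nonneg (hκ0 x) (norm_nonneg _))).2 fun j => ?_
    have := norm_commutator_entry_le s (X x) (of (v - w)) (c := ‖v - w‖)
      (fun k l => (norm_le_pi_norm ((v - w) k) l).trans (norm_le_pi_norm (v - w) k)) i j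
    refine le_of_eq_of_le (congrArg _ ?_) this
    rw [← hAof, Pi.sub_apply, Pi.sub_apply]
    simp only [A, Pi.sub_apply, mul_sub, sub_mul, Finset.sum_sub_distrib]
    ring
  have hFc : Continuous F' := continuous_pi fun i => continuous_pi fun j => (hF i j).continuous
  have hFi : Integrable F' := Integrable.of_eval fun i => Integrable.of_eval fun j =>
    (hF i j).integrable
  have key : ∃ D : ℝ → n → n → ℂ, (∀ x, HasDerivAt D (A x (D x) + F' x) x) ∧
      Tendsto D l (𝓝 0) ∧ ∃ C, ∀ x, ‖D x‖ ≤ C := by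
    rcases hl with rfl | rfl
    · exact exists_bounded_solution_atBot hκc hκi hκ0 hA hA0 hL hFc hFi
    · exact exists_bounded_solution_atTop hκc hκi hκ0 hA hA0 hL hFc hFi
  obtain ⟨D, h1, h2, C, h3⟩ := key
  have hD : MDeriv (fun x => of (D x)) (fun x => F x + s • (X x * of (D x) - of (D x) * X x)) :=
    fun x i j => by
      have := hasDerivAt_pi.1 (hasDerivAt_pi.1 (h1 x) i) j
      refine this.congr_deriv ?_
      rw [Pi.add_apply, Pi.add_apply, hAof, add_comm]
      rfl
  refine ⟨fun x => of (D x), hD, h2, mSmb_of_transport hX.smb hF.smb hD ⟨C, fun x i j => ?_⟩⟩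
  exact ((norm_le_pi_norm (D x i) j).trans (norm_le_pi_norm (D x) i)).trans (h3 x)

/-- A solution of the homogeneous transport equation that vanishes at one end is zero: the
logarithmic derivative of its Hilbert-Schmidt norm is integrable. -/
theorem transport_unique {l : Filter ℝ} (hl : l = atBot ∨ l = atTop) (hX : MSch X)
    (hE : MDeriv E fun x => s • (X x * E x - E x * X x)) (h0 : Tendsto E l (𝓝 0)) (x : ℝ) :
    E x = 0 := by
  set f : ℝ → ℝ := fun x => ∑ i, ∑ j, ‖E x i j‖ ^ 2 with hf
  set f' : ℝ → ℝ := fun x => ∑ i, ∑ j,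
    2 * inner ℝ (E x i j) ((s • (X x * E x - E x * X x)) i j) with hf'
  set σ : ℝ → ℝ := fun x => ∑ k, ∑ l, ‖X x k l‖ with hσ
  set c : ℝ := ∑ _i : n, ∑ _j : n, 1 with hc
  have hfd : ∀ x, HasDerivAt f (f' x) x := fun x =>
    HasDerivAt.fun_sum fun i _ => HasDerivAt.fun_sum fun j _ => (hE x i j).norm_sq
  have hent : ∀ x i j, ‖E x i j‖ ^ 2 ≤ f x := fun x i j =>
    (Finset.single_le_sum (f := fun j => ‖E x i j‖ ^ 2) (fun _ _ => by positivity)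
      (Finset.mem_univ j)).trans (Finset.single_le_sum (f := fun i => ∑ j, ‖E x i j‖ ^ 2)
        (fun _ _ => by positivity) (Finset.mem_univ i))
  have hf0 : ∀ x, 0 ≤ f x := fun x => by positivity
  have hent' : ∀ x i j, ‖E x i j‖ ≤ Real.sqrt (f x) := fun x i j => Real.le_sqrt_of_sq_le (hent x i j)
  have hle : ∀ x, |f' x| ≤ c * (2 * (2 * ‖s‖ * σ x)) * f x := fun x => by
    have : ∀ i j, |2 * inner ℝ (E x i j) ((s • (X x * E x - E x * X x)) i j)| ≤
        1 * ((2 * (2 * ‖s‖ * σ x)) * f x) := fun i j => by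
      rw [abs_mul, abs_two, one_mul]
      have h1 := abs_real_inner_le_norm (E x i j) ((s • (X x * E x - E x * X x)) i j)
      have h2 := norm_commutator_entry_le s (X x) (E x) (hent' x) i j
      have h3 : ‖E x i j‖ * ‖(s • (X x * E x - E x * X x)) i j‖ ≤
          Real.sqrt (f x) * (2 * ‖s‖ * σ x * Real.sqrt (f x)) :=
        mul_le_mul (hent' x i j) h2 (norm_nonneg _) (Real.sqrt_nonneg _)
      have h4 := Real.mul_self_sqrt (hf0 x)
      calc _ ≤ 2 * (Real.sqrt (f x) * (2 * ‖s‖ * σ x * Real.sqrt (f x))) := by linarith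
        _ = (2 * (2 * ‖s‖ * σ x)) * (Real.sqrt (f x) * Real.sqrt (f x)) := by ring
        _ = _ := by rw [h4]
    calc |f' x| ≤ ∑ i, ∑ j, |2 * inner ℝ (E x i j) ((s • (X x * E x - E x * X x)) i j)| :=
          (Finset.abs_sum_le_sum_abs _ _).trans
            (Finset.sum_le_sum fun i _ => Finset.abs_sum_le_sum_abs _ _)
      _ ≤ ∑ _i : n, ∑ _j : n, 1 * ((2 * (2 * ‖s‖ * σ x)) * f x) :=
          Finset.sum_le_sum fun i _ => Finset.sum_le_sum fun j _ => this i j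
      _ = _ := by
          simp only [← Finset.sum_mul, hc]
          ring
  have hlim : Tendsto f l (𝓝 0) := by
    have : Tendsto f l (𝓝 (∑ i : n, ∑ j : n, ‖(0 : Matrix n n ℂ) i j‖ ^ 2)) :=
      tendsto_finsetSum _ fun i _ => tendsto_finsetSum _ fun j _ =>
        ((tendsto_pi_nhds.1 (tendsto_pi_nhds.1 h0 i) j).norm).pow 2
    simpa using this
  have hz := eq_zero_of_deriv_le hl (κ := fun x => c * (2 * (2 * ‖s‖ * σ x)))
    (by have := continuous_sum_norm hX; fun_prop)
    (by have := integrable_sum_norm hX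
        exact ((this.const_mul _).const_mul _).const_mul _) hfd hf0 hle hlim x
  ext i j
  have := hent x i j
  rw [hz] at this
  have h2 : ‖E x i j‖ = 0 := by
    have := le_antisymm this (by positivity)
    exact pow_eq_zero_iff (two_ne_zero) |>.1 this
  simpa using h2

theorem transport_sub {F' : ℝ → Matrix n n ℂ}
    (hD : MDeriv D fun x => F x + s • (X x * D x - D x * X x))
    (hE : MDeriv E fun x => F' x + s • (X x * E x - E x * X x)) :
    MDeriv (fun x => D x - E x)
      fun x => (F x - F' x) + s • (X x * (D x - E x) - (D x - E x) * X x) :=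
  (hD.sub hE).congr fun x => by
    simp only [Matrix.mul_sub, Matrix.sub_mul, smul_sub]
    abel

theorem transport_eq {l : Filter ℝ} (hl : l = atBot ∨ l = atTop) (hX : MSch X)
    (hD : MDeriv D fun x => F x + s • (X x * D x - D x * X x))
    (hE : MDeriv E fun x => F x + s • (X x * E x - E x * X x))
    (h0 : Tendsto D l (𝓝 0)) (h0' : Tendsto E l (𝓝 0)) : D = E := by
  funext x
  refine sub_eq_zero.1 (transport_unique (E := fun x => D x - E x) (s := s) hl hX
    ((transport_sub hD hE).congr fun x => ?_) (by simpa using h0.sub h0') x)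
  rw [sub_self, zero_add]

end Transport

section VanishingSol

variable {N : ℕ} {s : ℂ} {X F G : ℝ → Matrix (Fin N) (Fin N) ℂ} {l : Filter ℝ}

theorem vanishingSol_spec (hl : l = atBot ∨ l = atTop) (hX : MSch X) (hF : MSch F) (s : ℂ) :
    MDeriv (vanishingSol l s X F)
      (fun x => F x + s • (X x * vanishingSol l s X F x - vanishingSol l s X F x * X x)) ∧
      Tendsto (vanishingSol l s X F) l (𝓝 0) ∧ MSmb (vanishingSol l s X F) := by
  obtain ⟨D, h1, h2, h3⟩ := exists_transport hl hX hF s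
  have h : ∃ D, SolvesTransport s X F D ∧ Tendsto D l (𝓝 0) := ⟨D, h1, h2⟩
  have he : vanishingSol l s X F = h.choose := dif_pos h
  have hs := h.choose_spec
  have hD : h.choose = D := transport_eq hl hX hs.1 h1 hs.2 h2
  rw [he, hD]
  exact ⟨h1, h2, h3⟩

theorem vanishingSol_eq (hl : l = atBot ∨ l = atTop) (hX : MSch X) (hF : MSch F)
    {D : ℝ → Matrix (Fin N) (Fin N) ℂ}
    (hD : MDeriv D fun x => F x + s • (X x * D x - D x * X x)) (h0 : Tendsto D l (𝓝 0)) :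
    vanishingSol l s X F = D :=
  transport_eq hl hX (vanishingSol_spec hl hX hF s).1 hD (vanishingSol_spec hl hX hF s).2.1 h0

theorem vanishingSol_add (hl : l = atBot ∨ l = atTop) (hX : MSch X) (hF : MSch F) (hG : MSch G) :
    vanishingSol l s X (fun x => F x + G x) =
      fun x => vanishingSol l s X F x + vanishingSol l s X G x := by
  have h1 := vanishingSol_spec hl hX hF s
  have h2 := vanishingSol_spec hl hX hG s
  refine vanishingSol_eq hl hX (hF.add hG) ((h1.1.add h2.1).congr fun x => ?_)
    (by simpa using h1.2.1.add h2.2.1)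
  simp only [Matrix.mul_add, Matrix.add_mul]
  module

theorem invTransport_add (hX : MSch X) (hF : MSch F) (hG : MSch G) (x : ℝ) :
    invTransport s X (fun x => F x + G x) x = invTransport s X F x + invTransport s X G x := by
  simp only [invTransport, vanishingSol_add (Or.inl rfl) hX hF hG,
    vanishingSol_add (Or.inr rfl) hX hF hG]
  module

theorem MCls.transpose {n : Type*} {K : Set ℕ} {D : ℝ → Matrix n n ℂ}
    (h : MCls K D) : MCls K fun x => (D x)ᵀ := fun i j => h j i

theorem vanishingSol_transpose (hl : l = atBot ∨ l = atTop) (hX : MSch X) (hF : MSch F) :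
    vanishingSol l (-s) (fun x => (X x)ᵀ) (fun x => (F x)ᵀ) =
      fun x => (vanishingSol l s X F x)ᵀ := by
  have h1 := vanishingSol_spec hl hX hF s
  refine vanishingSol_eq hl hX.transpose hF.transpose
    (MDeriv.congr (D' := fun x => (F x + s • (X x * vanishingSol l s X F x -
      vanishingSol l s X F x * X x))ᵀ) (fun x i j => h1.1 x j i) fun x => ?_) ?_
  · simp only [Matrix.transpose_add, Matrix.transpose_smul, Matrix.transpose_sub,
      Matrix.transpose_mul]
    module
  · refine tendsto_pi_nhds.2 fun i => tendsto_pi_nhds.2 fun j => ?_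
    exact tendsto_pi_nhds.1 (tendsto_pi_nhds.1 h1.2.1 j) i

theorem invTransport_transpose (hX : MSch X) (hF : MSch F) (x : ℝ) :
    invTransport (-s) (fun x => (X x)ᵀ) (fun x => (F x)ᵀ) x = (invTransport s X F x)ᵀ := by
  simp only [invTransport, vanishingSol_transpose (Or.inl rfl) hX hF,
    vanishingSol_transpose (Or.inr rfl) hX hF, Matrix.transpose_smul, Matrix.transpose_add]

end VanishingSol

/-! ### Mean solutions of the transport equation -/

section Mean

variable {n : Type*} [Fintype n] {s : ℂ} {X F : ℝ → Matrix n n ℂ}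

/-- `E` is the mean of the solutions of `D' = F + s [X, D]` that vanish at `-∞` and at `+∞`, both
bounded with all their derivatives. -/
def IsMeanSol (s : ℂ) (X F E : ℝ → Matrix n n ℂ) : Prop :=
  ∃ D₁ D₂ : ℝ → Matrix n n ℂ,
    (MDeriv D₁ (fun x => F x + s • (X x * D₁ x - D₁ x * X x)) ∧ Tendsto D₁ atBot (𝓝 0) ∧ MSmb D₁) ∧
    (MDeriv D₂ (fun x => F x + s • (X x * D₂ x - D₂ x * X x)) ∧ Tendsto D₂ atTop (𝓝 0) ∧ MSmb D₂) ∧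
    ∀ x, E x = (1 / 2 : ℂ) • (D₁ x + D₂ x)

theorem tendsto_matrix_zero {n : Type*} {l : Filter ℝ} {D : ℝ → Matrix n n ℂ} :
    Tendsto D l (𝓝 0) ↔ ∀ i j, Tendsto (fun x => D x i j) l (𝓝 0) := by
  constructor
  · exact fun h i j => tendsto_pi_nhds.1 (tendsto_pi_nhds.1 h i) j
  · exact fun h => tendsto_pi_nhds.2 fun i => tendsto_pi_nhds.2 fun j => h i j

theorem tendsto_zero_mul_bounded {l : Filter ℝ} {f g : ℝ → ℂ} (hf : Tendsto f l (𝓝 0))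
    (hg : Smb g) : Tendsto (fun x => f x * g x) l (𝓝 0) := by
  obtain ⟨C, hC⟩ := hg.bounded
  exact hf.zero_mul_isBoundedUnder_le ⟨C, eventually_map.2 (Eventually.of_forall hC)⟩

theorem tendsto_trace_mul {l : Filter ℝ} {A B : ℝ → Matrix n n ℂ} (hA : Tendsto A l (𝓝 0))
    (hB : MSmb B) : Tendsto (fun x => (A x * B x).trace) l (𝓝 0) := by
  simp only [Matrix.trace, Matrix.diag_apply, Matrix.mul_apply]
  rw [← Finset.sum_const_zero (s := (Finset.univ : Finset n))]
  refine tendsto_finsetSum _ fun i _ => ?_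
  rw [← Finset.sum_const_zero (s := (Finset.univ : Finset n))]
  exact tendsto_finsetSum _ fun k _ =>
    tendsto_zero_mul_bounded (tendsto_matrix_zero.1 hA i k) (hB k i)

theorem IsMeanSol.mSmb {E : ℝ → Matrix n n ℂ} (h : IsMeanSol s X F E) : MSmb E := by
  obtain ⟨D₁, D₂, h1, h2, hE⟩ := h
  rw [funext hE]
  exact (h1.2.2.add h2.2.2).smul _

theorem IsMeanSol.mDeriv {E : ℝ → Matrix n n ℂ} (h : IsMeanSol s X F E) :
    MDeriv E fun x => F x + s • (X x * E x - E x * X x) := by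
  obtain ⟨D₁, D₂, h1, h2, hE⟩ := h
  obtain rfl : E = _ := funext hE
  refine ((h1.1.add h2.1).smul (1 / 2)).congr fun x => ?_
  simp only [Matrix.mul_smul, Matrix.smul_mul, Matrix.mul_add, Matrix.add_mul]
  module

/-- The inverse of `∂ - s ad_X` is skew-symmetric for the trace form. The boundary terms at the
two ends are equal, because the trace of a product of two solutions of the homogeneous equation is
constant. -/
theorem IsMeanSol.integral_trace_mul {F' E E' : ℝ → Matrix n n ℂ} (hF : MSch F)
    (hF' : MSch F') (hE : IsMeanSol s X F E) (hE' : IsMeanSol s X F' E') :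
    ∫ x, (E x * F' x).trace = -∫ x, (E' x * F x).trace := by
  have hEs := hE.mSmb
  have hEs' := hE'.mSmb
  have hEd := hE.mDeriv
  have hEd' := hE'.mDeriv
  obtain ⟨D₁, D₂, h1, h2, hm⟩ := hE
  obtain ⟨D₁', D₂', h1', h2', hm'⟩ := hE'
  have hΔ : MDeriv (fun x => D₁ x - D₂ x)
      fun x => s • (X x * (D₁ x - D₂ x) - (D₁ x - D₂ x) * X x) :=
    (transport_sub h1.1 h2.1).congr fun x => by rw [sub_self, zero_add]
  have hΔ' : MDeriv (fun x => D₁' x - D₂' x)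
      fun x => s • (X x * (D₁' x - D₂' x) - (D₁' x - D₂' x) * X x) :=
    (transport_sub h1'.1 h2'.1).congr fun x => by rw [sub_self, zero_add]
  have htr : ∀ A B Y : Matrix n n ℂ,
      ((s • (Y * A - A * Y)) * B + A * (s • (Y * B - B * Y))).trace = 0 := fun A B Y => by
    have : (s • (Y * A - A * Y)) * B + A * (s • (Y * B - B * Y)) =
        s • (Y * (A * B) - (A * B) * Y) := by
      simp only [Matrix.smul_mul, Matrix.mul_smul, ← smul_add, Matrix.sub_mul, Matrix.mul_sub,
        Matrix.mul_assoc]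
      congr 1
      abel
    rw [this, Matrix.trace_smul, Matrix.trace_sub, Matrix.trace_mul_comm, sub_self, smul_zero]
  -- with `Δ = D₁ - D₂`, a constant multiple of the constant `tr (Δ Δ')` removes the boundary terms:
  -- `tr (E E') - tr (Δ Δ') / 4` vanishes at both ends
  have hd : ∀ x, HasDerivAt
      (fun x => (E x * E' x).trace - 1 / 4 * ((D₁ x - D₂ x) * (D₁' x - D₂' x)).trace)
      ((E x * F' x).trace + (E' x * F x).trace) x := fun x => by
    refine (((hEd.mul hEd').trace x).sub (((hΔ.mul hΔ').trace x).const_mul (1 / 4))).congr_deriv ?_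
    rw [htr, mul_zero, sub_zero, Matrix.add_mul, Matrix.mul_add, add_add_add_comm,
      Matrix.trace_add, htr, add_zero, Matrix.trace_add, Matrix.trace_mul_comm (F x), add_comm]
  have hΔs : MSmb fun x => D₁ x - D₂ x := h1.2.2.sub h2.2.2
  have hΔs' : MSmb fun x => D₁' x - D₂' x := h1'.2.2.sub h2'.2.2
  have hbot : Tendsto (fun x => (E x * E' x).trace -
      1 / 4 * ((D₁ x - D₂ x) * (D₁' x - D₂' x)).trace) atBot (𝓝 0) := by
    have e : ∀ x, (E x * E' x).trace - 1 / 4 * ((D₁ x - D₂ x) * (D₁' x - D₂' x)).trace =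
        (D₁ x * E' x).trace + (D₁' x * ((-(1 / 2) : ℂ) • (D₁ x - D₂ x))).trace := fun x => by
      rw [hm, hm', Matrix.trace_mul_comm (D₁' x)]
      simp only [Matrix.smul_mul, Matrix.mul_smul, Matrix.add_mul, Matrix.mul_add, Matrix.sub_mul,
        Matrix.mul_sub, Matrix.trace_add, Matrix.trace_sub, Matrix.trace_smul, smul_eq_mul]
      ring
    rw [funext e]
    rw [← add_zero (0 : ℂ)]
    exact (tendsto_trace_mul h1.2.1 hEs').add (tendsto_trace_mul h1'.2.1 (hΔs.smul _))
  have htop : Tendsto (fun x => (E x * E' x).trace -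
      1 / 4 * ((D₁ x - D₂ x) * (D₁' x - D₂' x)).trace) atTop (𝓝 0) := by
    have e : ∀ x, (E x * E' x).trace - 1 / 4 * ((D₁ x - D₂ x) * (D₁' x - D₂' x)).trace =
        (D₂ x * E' x).trace + (D₂' x * ((1 / 2 : ℂ) • (D₁ x - D₂ x))).trace := fun x => by
      rw [hm, hm', Matrix.trace_mul_comm (D₂' x)]
      simp only [Matrix.smul_mul, Matrix.mul_smul, Matrix.add_mul, Matrix.mul_add, Matrix.sub_mul,
        Matrix.mul_sub, Matrix.trace_add, Matrix.trace_sub, Matrix.trace_smul, smul_eq_mul]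
      ring
    rw [funext e]
    rw [← add_zero (0 : ℂ)]
    exact (tendsto_trace_mul h2.2.1 hEs').add (tendsto_trace_mul h2'.2.1 (hΔs.smul _))
  have hi1 : Integrable fun x => (E x * F' x).trace := (hEs.mul' hF').trace.integrable
  have hi2 : Integrable fun x => (E' x * F x).trace := (hEs'.mul' hF).trace.integrable
  have := integral_of_hasDerivAt_of_tendsto hd (hi1.add hi2) hbot htop
  rw [integral_add hi1 hi2, sub_zero] at this
  exact eq_neg_of_add_eq_zero_left this

/-- If a solution `e` of the homogeneous equation behaves like `S w` at both ends, where `w` is a mean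
solution and the constant matrix `S` commutes with `X`, then `e = 0`: with `Δ` the difference of the
two solutions of which `w` is the mean, both `e + S Δ / 2` and `e - S Δ / 2` vanish at one end, hence
everywhere. -/
theorem IsMeanSol.eq_zero {w e : ℝ → Matrix n n ℂ} {S : Matrix n n ℂ} (hX : MSch X)
    (hS : ∀ x, S * X x = X x * S) (hw : IsMeanSol s X F w)
    (he : MDeriv e fun x => s • (X x * e x - e x * X x))
    (hbot : Tendsto (fun x => e x - S * w x) atBot (𝓝 0))
    (htop : Tendsto (fun x => e x - S * w x) atTop (𝓝 0)) (x : ℝ) : e x = 0 := by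
  obtain ⟨D₁, D₂, h1, h2, hm⟩ := hw
  have hΔ : MDeriv (fun x => D₁ x - D₂ x)
      fun x => s • (X x * (D₁ x - D₂ x) - (D₁ x - D₂ x) * X x) :=
    (transport_sub h1.1 h2.1).congr fun x => by rw [sub_self, zero_add]
  have hSΔ : ∀ c : ℂ, MDeriv (fun x => e x + c • (S * (D₁ x - D₂ x)))
      fun x => s • (X x * (e x + c • (S * (D₁ x - D₂ x))) -
        (e x + c • (S * (D₁ x - D₂ x))) * X x) := fun c => by
    refine (he.add (((MDeriv.const S).mul hΔ).smul c)).congr fun x => ?_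
    have := hS x
    simp only [Matrix.zero_mul, Matrix.mul_add, Matrix.add_mul, Matrix.mul_smul,
      Matrix.smul_mul, Matrix.mul_sub, Matrix.sub_mul, ← Matrix.mul_assoc, this]
    module
  have hS0 : ∀ {l : Filter ℝ} {D : ℝ → Matrix n n ℂ}, Tendsto D l (𝓝 0) →
      Tendsto (fun x => S * D x) l (𝓝 0) := fun {l D} hD => by
    have : Tendsto (fun x => S * D x) l (𝓝 (S * 0)) := tendsto_const_nhds.mul hD
    rwa [Matrix.mul_zero] at this
  have ebot : ∀ x, e x + (1 / 2 : ℂ) • (S * (D₁ x - D₂ x)) = 0 :=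
    transport_unique (Or.inl rfl) hX (hSΔ (1 / 2)) (by
      have := hbot.add (hS0 h1.2.1)
      rw [add_zero] at this
      refine this.congr fun x => ?_
      rw [hm]
      simp only [Matrix.mul_smul, Matrix.mul_add, Matrix.mul_sub]
      module)
  have etop : ∀ x, e x + (-(1 / 2) : ℂ) • (S * (D₁ x - D₂ x)) = 0 :=
    transport_unique (Or.inr rfl) hX (hSΔ (-(1 / 2))) (by
      have := htop.add (hS0 h2.2.1)
      rw [add_zero] at this
      refine this.congr fun x => ?_
      rw [hm]
      simp only [Matrix.mul_smul, Matrix.mul_add, Matrix.mul_sub]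
      module)
  have h : (2 : ℂ) • e x = 0 := by
    rw [← add_zero (0 : Matrix n n ℂ)]
    nth_rewrite 1 [← ebot x]
    rw [← etop x]
    module
  simpa using h

end Mean

section MeanPhase

variable {N : ℕ}

theorem invTransport_isMeanSol {s : ℂ} {X F : ℝ → Matrix (Fin N) (Fin N) ℂ} (hX : MSch X)
    (hF : MSch F) : IsMeanSol s X F (invTransport s X F) :=
  ⟨_, _, vanishingSol_spec (Or.inl rfl) hX hF s, vanishingSol_spec (Or.inr rfl) hX hF s,
    fun _ => rfl⟩

end MeanPhase

/-! ### The operators of the positive hierarchy -/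

section OpL

variable {N : ℕ} (ω : Phase N)

theorem sch_q (j : Fin N) : Sch fun x => qOf ω x j := sch_fst ω j

theorem sch_r (j : Fin N) : Sch fun x => rOf ω x j := sch_snd ω j

/-- Vector functions with components in the class `K`. -/
def VCls {N : ℕ} (K : Set ℕ) (f : ℝ → Vec N) : Prop := ∀ j, Cls K fun x => f x j

/-- Vector functions with rapidly decreasing components. -/
abbrev VSch {N : ℕ} (f : ℝ → Vec N) : Prop := VCls Set.univ f

/-- Vector functions with bounded smooth components. -/
abbrev VSmb {N : ℕ} (f : ℝ → Vec N) : Prop := VCls {0} f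

namespace VCls

variable {N : ℕ} {K : Set ℕ} {f g : ℝ → Vec N}

theorem smb (hf : VSch f) : VSmb f := fun j => (hf j).smb

theorem differentiableAt (hf : VCls K f) (x : ℝ) : DifferentiableAt ℝ f x :=
  differentiableAt_pi.2 fun j => (hf j).differentiable x

theorem deriv_apply (hf : VCls K f) (x : ℝ) (j : Fin N) :
    _root_.deriv f x j = _root_.deriv (fun y => f y j) x := by
  have := hasDerivAt_pi.1 (hf.differentiableAt x).hasDerivAt j
  exact this.deriv.symm

theorem deriv (hf : VCls K f) : VCls K (_root_.deriv f) := fun j => by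
  rw [funext fun x => hf.deriv_apply x j]
  exact (hf j).deriv

theorem hasDerivAt (hf : VCls K f) (x : ℝ) (j : Fin N) :
    HasDerivAt (fun y => f y j) (_root_.deriv f x j) x := by
  rw [hf.deriv_apply]
  exact (hf j).hasDerivAt x

theorem add (hf : VCls K f) (hg : VCls K g) : VCls K fun x => f x + g x :=
  fun j => (hf j).add (hg j)

theorem sub (hf : VCls K f) (hg : VCls K g) : VCls K fun x => f x - g x :=
  fun j => (hf j).sub (hg j)

theorem neg (hf : VCls K f) : VCls K fun x => -f x := fun j => (hf j).neg

theorem const_smul (hf : VCls K f) (c : ℂ) : VCls K fun x => c • f x :=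
  fun j => (hf j).const_mul c

theorem smul (hf : VCls K f) {a : ℝ → ℂ} (ha : Smb a) : VCls K fun x => a x • f x :=
  fun j => Cls.mul' ha (hf j)

theorem dotProduct (hf : VCls K f) (hg : VSmb g) : Cls K fun x => f x ⬝ᵥ g x :=
  Cls.sum _ fun j _ => (hf j).mul (hg j)

theorem dotProduct' (hf : VSmb f) (hg : VCls K g) : Cls K fun x => f x ⬝ᵥ g x :=
  Cls.sum _ fun j _ => (hf j).mul' (hg j)

theorem mulVec {D : ℝ → Matrix (Fin N) (Fin N) ℂ} (hf : VCls K f) (hD : MSmb D) :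
    VCls K fun x => D x *ᵥ f x :=
  fun j => by
    simp only [Matrix.mulVec, _root_.dotProduct]
    exact Cls.sum _ fun k _ => (hD j k).mul' (hf k)

theorem vecMulVec (hf : VCls K f) (hg : VSmb g) : MCls K fun x => vecMulVec (f x) (g x) :=
  fun i j => (hf i).mul (hg j)

end VCls

theorem vSch_q : VSch (qOf ω) := sch_q ω

theorem vSch_r : VSch (rOf ω) := sch_r ω

theorem mSch_qrT : MSch (qrT ω) := (vSch_q ω).vecMulVec (vSch_r ω).smb

variable {ω}

/-- The right-hand side of the transport equation which enters `L`. -/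
def rankTwo (ω : Phase N) (f₁ f₂ : ℝ → Vec N) (y : ℝ) : Matrix (Fin N) (Fin N) ℂ :=
  vecMulVec (f₂ y) (rOf ω y) + vecMulVec (qOf ω y) (f₁ y)

theorem mSch_rankTwo {f₁ f₂ : ℝ → Vec N} (h₁ : VSch f₁) (h₂ : VSch f₂) :
    MSch (rankTwo ω f₁ f₂) :=
  (h₂.vecMulVec (vSch_r ω).smb).add (VCls.vecMulVec (vSch_q ω) h₁.smb)

/-- The mean solution of the transport equation which enters `L`. -/
def meanE (ω : Phase N) (f₁ f₂ : ℝ → Vec N) : ℝ → Matrix (Fin N) (Fin N) ℂ :=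
  invTransport (I / 2) (qrT ω) (rankTwo ω f₁ f₂)

theorem meanE_isMeanSol {f₁ f₂ : ℝ → Vec N} (h₁ : VSch f₁) (h₂ : VSch f₂) :
    IsMeanSol (I / 2) (qrT ω) (rankTwo ω f₁ f₂) (meanE ω f₁ f₂) :=
  invTransport_isMeanSol (mSch_qrT ω) (mSch_rankTwo h₁ h₂)

/-- The scalar primitive which enters `L`. -/
def meanS (ω : Phase N) (f₁ f₂ : ℝ → Vec N) : ℝ → ℂ :=
  invD fun y => rOf ω y ⬝ᵥ f₂ y + f₁ y ⬝ᵥ qOf ω y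

theorem sch_meanS_integrand {f₁ f₂ : ℝ → Vec N} (h₁ : VSch f₁) (h₂ : VSch f₂) :
    Sch fun y => rOf ω y ⬝ᵥ f₂ y + f₁ y ⬝ᵥ qOf ω y :=
  ((vSch_r ω).dotProduct h₂.smb).add (h₁.dotProduct (vSch_q ω).smb)

/-- `L₁ S` in terms of a single transport equation: the lower row of `L₁` solves the transposed
equation. -/
theorem opL1_swap {f₁ f₂ : ℝ → Vec N} (h₁ : VSch f₁) (h₂ : VSch f₂) (x : ℝ) :
    opL1 ω (swapF fun y => (f₁ y, f₂ y)) x =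
      ((I / 2) • f₂ x + (1 / 4 : ℂ) • (meanS ω f₁ f₂ x • qOf ω x + meanE ω f₁ f₂ x *ᵥ qOf ω x),
       -((I / 2) • f₁ x) +
        (1 / 4 : ℂ) • (meanS ω f₁ f₂ x • rOf ω x + (meanE ω f₁ f₂ x)ᵀ *ᵥ rOf ω x)) := by
  have hS : meanS ω f₁ f₂ x = invD (fun y => rOf ω y ⬝ᵥ f₂ y) x +
      invD (fun y => qOf ω y ⬝ᵥ f₁ y) x := by
    rw [meanS, invD_add ((vSch_r ω).dotProduct h₂.smb).integrable
      (h₁.dotProduct (vSch_q ω).smb).integrable]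
    simp only [dotProduct_comm (qOf ω _)]
  have hE : meanE ω f₁ f₂ x =
      invTransport (I / 2) (qrT ω) (fun y => vecMulVec (f₂ y) (rOf ω y)) x +
        invTransport (I / 2) (qrT ω) (fun y => vecMulVec (qOf ω y) (f₁ y)) x :=
    invTransport_add (mSch_qrT ω) (h₂.vecMulVec (vSch_r ω).smb)
      (VCls.vecMulVec (vSch_q ω) h₁.smb) x
  have hX : rqT ω = fun x => (qrT ω x)ᵀ := by
    funext x; exact (transpose_vecMulVec _ _).symm
  have hB : invTransport (-(I / 2)) (rqT ω) (fun y => vecMulVec (f₁ y) (qOf ω y)) x =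
      (invTransport (I / 2) (qrT ω) (fun y => vecMulVec (qOf ω y) (f₁ y)) x)ᵀ := by
    rw [← invTransport_transpose (mSch_qrT ω) (VCls.vecMulVec (vSch_q ω) h₁.smb), hX]
    simp only [transpose_vecMulVec]
  have hD : invTransport (-(I / 2)) (rqT ω) (fun y => vecMulVec (rOf ω y) (f₂ y)) x =
      (invTransport (I / 2) (qrT ω) (fun y => vecMulVec (f₂ y) (rOf ω y)) x)ᵀ := by
    rw [← invTransport_transpose (mSch_qrT ω) (h₂.vecMulVec (vSch_r ω).smb), hX]
    simp only [transpose_vecMulVec]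
  rw [hS, hE, Matrix.transpose_add, Matrix.add_mulVec, Matrix.add_mulVec]
  simp only [opL1, swapF, Prod.swap_prod_mk, opA, opB, opC, opD, hB, hD]
  refine Prod.ext ?_ ?_ <;> simp only [] <;> module

theorem isSchwartz_opL1_swap {f₁ f₂ : ℝ → Vec N} (h₁ : VSch f₁) (h₂ : VSch f₂) :
    VSch (fun x => (opL1 ω (swapF fun y => (f₁ y, f₂ y)) x).1) ∧
      VSch (fun x => (opL1 ω (swapF fun y => (f₁ y, f₂ y)) x).2) := by
  have hS : Smb (meanS ω f₁ f₂) := (sch_meanS_integrand h₁ h₂).invD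
  have hE : MSmb (meanE ω f₁ f₂) := (meanE_isMeanSol h₁ h₂).mSmb
  simp only [opL1_swap h₁ h₂]
  exact ⟨(h₂.const_smul _).add ((((vSch_q ω).smul hS).add
      (VCls.mulVec (vSch_q ω) hE)).const_smul _),
    (h₁.const_smul _).neg.add ((((vSch_r ω).smul hS).add
      (VCls.mulVec (vSch_r ω) hE.transpose)).const_smul _)⟩

theorem trace_mul_rankTwo (E : Matrix (Fin N) (Fin N) ℂ) (g₁ g₂ : ℝ → Vec N) (x : ℝ) :
    (E * rankTwo ω g₁ g₂ x).trace = g₁ x ⬝ᵥ (E *ᵥ qOf ω x) + g₂ x ⬝ᵥ (Eᵀ *ᵥ rOf ω x) := by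
  rw [rankTwo, Matrix.mul_add, Matrix.trace_add, Matrix.mul_vecMulVec, Matrix.mul_vecMulVec,
    Matrix.trace_vecMulVec, Matrix.trace_vecMulVec, add_comm, dotProduct_comm (E *ᵥ qOf ω x),
    Matrix.mulVec_transpose, dotProduct_comm (g₂ x), ← Matrix.dotProduct_mulVec,
    dotProduct_comm (E *ᵥ g₂ x)]

/-- `L₁ S` is skew-symmetric. -/
theorem integral_pair_opL1 {f₁ f₂ g₁ g₂ : ℝ → Vec N} (hf₁ : VSch f₁) (hf₂ : VSch f₂)
    (hg₁ : VSch g₁) (hg₂ : VSch g₂) :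
    ∫ x, pair (g₁ x, g₂ x) (opL1 ω (swapF fun y => (f₁ y, f₂ y)) x) =
      -∫ x, pair (f₁ x, f₂ x) (opL1 ω (swapF fun y => (g₁ y, g₂ y)) x) := by
  have key : ∀ {f₁ f₂ g₁ g₂ : ℝ → Vec N}, VSch f₁ → VSch f₂ → VSch g₁ → VSch g₂ →
      ∫ x, pair (g₁ x, g₂ x) (opL1 ω (swapF fun y => (f₁ y, f₂ y)) x) =
        (∫ x, (I / 2) * (g₁ x ⬝ᵥ f₂ x - f₁ x ⬝ᵥ g₂ x)) +
          1 / 4 * ((∫ x, (rOf ω x ⬝ᵥ g₂ x + g₁ x ⬝ᵥ qOf ω x) * meanS ω f₁ f₂ x) +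
            ∫ x, (meanE ω f₁ f₂ x * rankTwo ω g₁ g₂ x).trace) := by
    intro f₁ f₂ g₁ g₂ hf₁ hf₂ hg₁ hg₂
    have i1 : Integrable fun x => (I / 2) * (g₁ x ⬝ᵥ f₂ x - f₁ x ⬝ᵥ g₂ x) :=
      (((hg₁.dotProduct hf₂.smb).sub (hf₁.dotProduct hg₂.smb)).const_mul _).integrable
    have i2 : Integrable fun x => (rOf ω x ⬝ᵥ g₂ x + g₁ x ⬝ᵥ qOf ω x) * meanS ω f₁ f₂ x :=
      ((sch_meanS_integrand hg₁ hg₂).mul (sch_meanS_integrand hf₁ hf₂).invD).integrable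
    have i3 : Integrable fun x => (meanE ω f₁ f₂ x * rankTwo ω g₁ g₂ x).trace :=
      ((meanE_isMeanSol hf₁ hf₂).mSmb.mul' (mSch_rankTwo hg₁ hg₂)).trace.integrable
    have i23 : Integrable fun x => (1 / 4 : ℂ) * ((rOf ω x ⬝ᵥ g₂ x + g₁ x ⬝ᵥ qOf ω x) *
        meanS ω f₁ f₂ x + (meanE ω f₁ f₂ x * rankTwo ω g₁ g₂ x).trace) := (i2.add i3).const_mul _
    rw [← integral_add i2 i3, ← integral_const_mul, ← integral_add i1 i23]
    refine integral_congr_ae (Eventually.of_forall fun x => ?_)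
    simp only [opL1_swap hf₁ hf₂, pair, trace_mul_rankTwo, dotProduct_add, dotProduct_neg,
      dotProduct_smul, smul_eq_mul, dotProduct_comm (rOf ω x) (g₂ x),
      dotProduct_comm (g₂ x) (f₁ x)]
    ring
  rw [key hf₁ hf₂ hg₁ hg₂, key hg₁ hg₂ hf₁ hf₂,
    IsMeanSol.integral_trace_mul (mSch_rankTwo hf₁ hf₂) (mSch_rankTwo hg₁ hg₂)
      (meanE_isMeanSol hf₁ hf₂) (meanE_isMeanSol hg₁ hg₂)]
  rw [show meanS ω f₁ f₂ = invD _ from rfl, integral_mul_invD (sch_meanS_integrand hg₁ hg₂)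
    (sch_meanS_integrand hf₁ hf₂)]
  have : ∫ x, (I / 2) * (g₁ x ⬝ᵥ f₂ x - f₁ x ⬝ᵥ g₂ x) =
      -∫ x, (I / 2) * (f₁ x ⬝ᵥ g₂ x - g₁ x ⬝ᵥ f₂ x) := by
    rw [← integral_neg]
    congr 1
    funext x
    ring
  rw [this]
  simp only [meanS]
  ring

theorem isSchwartz_mk {f₁ f₂ : ℝ → Vec N} :
    IsSchwartz (fun x => (f₁ x, f₂ x)) ↔ VSch f₁ ∧ VSch f₂ := isSchwartz_iff

theorem IsSchwartz.vSch {f : VField N} (h : IsSchwartz f) :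
    VSch (fun x => (f x).1) ∧ VSch fun x => (f x).2 := isSchwartz_iff.1 h

theorem deriv_mk {f₁ f₂ : ℝ → Vec N} {K : Set ℕ} (h₁ : VCls K f₁) (h₂ : VCls K f₂) :
    deriv (fun x => (f₁ x, f₂ x)) = fun x => (deriv f₁ x, deriv f₂ x) :=
  funext fun x => ((h₁.differentiableAt x).hasDerivAt.prodMk
    (h₂.differentiableAt x).hasDerivAt).deriv

theorem opJ_mk {f₁ f₂ : ℝ → Vec N} {K : Set ℕ} (h₁ : VCls K f₁) (h₂ : VCls K f₂) :
    opJ (fun x => (f₁ x, f₂ x)) = fun x => (deriv f₂ x, deriv f₁ x) := by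
  funext x
  rw [opJ, deriv_mk h₁ h₂]

theorem IsSchwartz.deriv {f : VField N} (h : IsSchwartz f) : IsSchwartz (deriv f) := by
  rw [show f = fun x => ((f x).1, (f x).2) from rfl, deriv_mk h.vSch.1 h.vSch.2]
  exact isSchwartz_mk.2 ⟨h.vSch.1.deriv, h.vSch.2.deriv⟩

theorem IsSchwartz.swap {f : VField N} (h : IsSchwartz f) : IsSchwartz (swapF f) :=
  isSchwartz_mk.2 ⟨h.vSch.2, h.vSch.1⟩

theorem IsSchwartz.opJ {f : VField N} (h : IsSchwartz f) : IsSchwartz (opJ f) :=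
  isSchwartz_mk.2 ⟨h.deriv.vSch.2, h.deriv.vSch.1⟩

theorem IsSchwartz.opL1_swap {f : VField N} (h : IsSchwartz f) :
    IsSchwartz (opL1 ω (swapF f)) :=
  isSchwartz_iff.2 (isSchwartz_opL1_swap h.vSch.1 h.vSch.2)

theorem IsSchwartz.opL {f : VField N} (h : IsSchwartz f) : IsSchwartz (opL ω f) :=
  h.deriv.opL1_swap.swap

theorem IsSchwartz.opL_iterate {f : VField N} (h : IsSchwartz f) (k : ℕ) :
    IsSchwartz ((KaupNewell.opL ω)^[k] f) := by
  induction k with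
  | zero => exact h
  | succ k ih => rw [Function.iterate_succ_apply']; exact ih.opL

theorem IsSchwartz.pair {f g : VField N} (hf : IsSchwartz f) (hg : IsSchwartz g) :
    Sch fun x => pair (f x) (g x) :=
  (hf.vSch.1.dotProduct hg.vSch.1.smb).add (hf.vSch.2.dotProduct hg.vSch.2.smb)

theorem pair_swap (a b : Vec N × Vec N) : pair a.swap b.swap = pair a b := add_comm _ _

theorem pair_comm (a b : Vec N × Vec N) : pair a b = pair b a := by
  rw [pair, pair, dotProduct_comm, dotProduct_comm a.2]

theorem integral_pair_deriv {f g : VField N} (hf : IsSchwartz f) (hg : IsSchwartz g) :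
    ∫ x, pair (f x) (deriv g x) = -∫ x, pair (deriv f x) (g x) := by
  have hd : ∀ x, HasDerivAt (fun x => pair (f x) (g x))
      (pair (f x) (deriv g x) + pair (deriv f x) (g x)) x := fun x => by
    have h1 := deriv_mk hf.vSch.1 hf.vSch.2
    have h2 := deriv_mk hg.vSch.1 hg.vSch.2
    have e1 := congrFun h1 x
    have e2 := congrFun h2 x
    simp only [Prod.mk.eta] at e1 e2
    rw [e1, e2]
    have s1 := HasDerivAt.fun_sum (u := Finset.univ) fun j _ =>
      (hf.vSch.1.hasDerivAt x j).mul (hg.vSch.1.hasDerivAt x j)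
    have s2 := HasDerivAt.fun_sum (u := Finset.univ) fun j _ =>
      (hf.vSch.2.hasDerivAt x j).mul (hg.vSch.2.hasDerivAt x j)
    refine (s1.add s2).congr_deriv ?_
    simp only [KaupNewell.pair, dotProduct, Finset.sum_add_distrib]
    ring
  have h := integral_eq_zero_of_hasDerivAt_of_integrable hd
    ((hf.pair hg.deriv).add (hf.deriv.pair hg)).integrable (hf.pair hg).integrable
  rw [integral_add (hf.pair hg.deriv).integrable (hf.deriv.pair hg).integrable] at h
  exact eq_neg_of_add_eq_zero_left h

theorem opJ_eq (f : VField N) : opJ f = swapF (deriv f) := rfl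

theorem integral_pair_opJ {f g : VField N} (hf : IsSchwartz f) (hg : IsSchwartz g) :
    ∫ x, pair (g x) (opJ f x) = -∫ x, pair (f x) (opJ g x) := by
  have h := integral_pair_deriv hg.swap hf
  have e1 : ∀ x, pair (g x) (opJ f x) = pair (swapF g x) (deriv f x) := fun x => by
    rw [← pair_swap]; rfl
  have hd : deriv (swapF g) = swapF (deriv g) := by
    have := deriv_mk hg.vSch.2 hg.vSch.1
    have h2 := deriv_mk hg.vSch.1 hg.vSch.2
    simp only [Prod.mk.eta] at h2
    rw [h2]
    exact this
  simp only [e1, h, hd, pair_comm _ (f _)]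
  rfl

/-- `⟨g, J L f⟩ = ⟨L g, J f⟩`, from the skew-symmetry of `L₁ S` and of `∂`. -/
theorem integral_pair_opJ_opL {f g : VField N} (hf : IsSchwartz f) (hg : IsSchwartz g) :
    ∫ x, pair (g x) (opJ (opL ω f) x) = ∫ x, pair (opL ω g x) (opJ f x) := by
  have hR := hf.deriv.opL1_swap (ω := ω)
  have hJ : opJ (opL ω f) = deriv (opL1 ω (swapF (deriv f))) := by
    have h1 := opJ_mk hR.vSch.2 hR.vSch.1
    have h2 := deriv_mk hR.vSch.1 hR.vSch.2
    simp only [Prod.mk.eta] at h2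
    rw [h2]
    exact h1
  have e2 : ∀ x, pair (opL ω g x) (opJ f x) = pair (deriv f x) (opL1 ω (swapF (deriv g)) x) :=
    fun x => by
      rw [pair_comm, ← pair_swap]; rfl
  simp only [hJ, e2]
  rw [integral_pair_deriv hg hR]
  have := integral_pair_opL1 (ω := ω) hf.deriv.vSch.1 hf.deriv.vSch.2 hg.deriv.vSch.1
    hg.deriv.vSch.2
  simp only [Prod.mk.eta] at this
  rw [this, neg_neg]

theorem integral_pair_opJ_opL_iterate (k : ℕ) : ∀ {f g : VField N}, IsSchwartz f → IsSchwartz g →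
    ∫ x, pair (g x) (opJ ((opL ω)^[k] f) x) = ∫ x, pair ((opL ω)^[k] g x) (opJ f x) := by
  induction k with
  | zero => intros; rfl
  | succ k ih =>
    intro f g hf hg
    rw [Function.iterate_succ_apply', integral_pair_opJ_opL (hf.opL_iterate k) hg, ih hf hg.opL,
      Function.iterate_succ_apply]

theorem integral_pair_opJ_opL_skew (k : ℕ) {f g : VField N} (hf : IsSchwartz f)
    (hg : IsSchwartz g) : ∫ x, pair (g x) (opJ ((opL ω)^[k] f) x) =
      -∫ x, pair (f x) (opJ ((opL ω)^[k] g) x) := by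
  rw [integral_pair_opJ_opL_iterate k hf hg, integral_pair_opJ (hg.opL_iterate k) hf, neg_neg]

theorem skewOn_opL (k : ℕ) (f g : Phase N) : SkewOn (fun h => opJ ((opL ω)^[k] h)) f g :=
  have hf : IsSchwartz f := ⟨f, rfl⟩
  have hg : IsSchwartz g := ⟨g, rfl⟩
  ⟨(hg.pair (hf.opL_iterate k).opJ).integrable, (hf.pair (hg.opL_iterate k).opJ).integrable,
    integral_pair_opJ_opL_skew k hf hg⟩

/-- `L` is the recursion of the positive hierarchy on `(c, b)`. -/
theorem opL_mk_eq_posStep (w : Coeffs N) (hb : VSch w.b) (hc : VSch w.c) :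
    opL ω (fun x => (w.c x, w.b x)) = fun x => ((posStep ω w).c x, (posStep ω w).b x) := by
  funext x
  have hI : (I : ℂ)⁻¹ = -I := Complex.inv_I
  have hII : I * I = -1 := Complex.I_mul_I
  simp only [opL, swapF, deriv_mk hc hb]
  change (opL1 ω (swapF fun y => (deriv w.c y, deriv w.b y)) x).swap = _
  rw [opL1_swap hc.deriv hb.deriv]
  simp only [posStep, Prod.swap_prod_mk, hI]
  have hE : invTransport (I / 2) (qrT ω) (fun y => vecMulVec (deriv w.b y) (rOf ω y) +
    vecMulVec (qOf ω y) (deriv w.c y)) x = meanE ω (deriv w.c) (deriv w.b) x := rfl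
  have hS : invD (fun y => rOf ω y ⬝ᵥ deriv w.b y + deriv w.c y ⬝ᵥ qOf ω y) x =
    meanS ω (deriv w.c) (deriv w.b) x := rfl
  rw [hE, hS]
  refine Prod.ext (funext fun j => ?_) (funext fun j => ?_)
  · simp only [Pi.add_apply, Pi.neg_apply, Pi.smul_apply, Pi.sub_apply, smul_eq_mul,
      Matrix.transpose_smul, Matrix.smul_mulVec]
    linear_combination (1 / 4 * (meanS ω (deriv w.c) (deriv w.b) x * rOf ω x j +
      ((meanE ω (deriv w.c) (deriv w.b) x)ᵀ *ᵥ rOf ω x) j)) * hII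
  · simp only [Pi.add_apply, Pi.neg_apply, Pi.smul_apply, Pi.sub_apply, smul_eq_mul,
      Matrix.smul_mulVec]
    linear_combination (1 / 4 * (meanS ω (deriv w.c) (deriv w.b) x * qOf ω x j +
      (meanE ω (deriv w.c) (deriv w.b) x *ᵥ qOf ω x) j)) * hII

end OpL

/-! ### The operators of the negative hierarchy -/

section OpK

variable {N : ℕ} {ω : Phase N}

/-- The integrand of the diagonal coefficient `a` of the negative hierarchy. -/
def negA' (ω : Phase N) (f₁ f₂ : ℝ → Vec N) (y : ℝ) : ℂ := rOf ω y ⬝ᵥ f₂ y - f₁ y ⬝ᵥ qOf ω y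

/-- The integrand of the diagonal coefficient `d` of the negative hierarchy. -/
def negD' (ω : Phase N) (f₁ f₂ : ℝ → Vec N) (y : ℝ) : Matrix (Fin N) (Fin N) ℂ :=
  of fun j k => qOf ω y j * f₁ y k - f₂ y j * rOf ω y k

/-- The entrywise mean primitive of a matrix function. -/
def invDMat (F : ℝ → Matrix (Fin N) (Fin N) ℂ) (x : ℝ) : Matrix (Fin N) (Fin N) ℂ :=
  of fun j k => invD (fun y => F y j k) x

theorem sch_negA' {f₁ f₂ : ℝ → Vec N} (h₁ : VSmb f₁) (h₂ : VSmb f₂) : Sch (negA' ω f₁ f₂) :=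
  ((vSch_r ω).dotProduct h₂).sub (VCls.dotProduct' h₁ (vSch_q ω))

theorem mSch_negD' {f₁ f₂ : ℝ → Vec N} (h₁ : VSmb f₁) (h₂ : VSmb f₂) : MSch (negD' ω f₁ f₂) :=
  fun j k => ((sch_q ω j).mul (h₁ k)).sub (Cls.mul' (h₂ j) (sch_r ω k))

theorem mSmb_invDMat {F : ℝ → Matrix (Fin N) (Fin N) ℂ} (h : MSch F) : MSmb (invDMat F) :=
  fun j k => (h j k).invD

/-- `L₂ S` in terms of the coefficients `a` and `d` of the recursion. -/
theorem opL2_swap {f₁ f₂ : ℝ → Vec N} (h₁ : VSmb f₁) (h₂ : VSmb f₂) (x : ℝ) :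
    opL2 ω (swapF fun y => (f₁ y, f₂ y)) x =
      (-(2 * I) • f₂ x + (invD (negA' ω f₁ f₂) x • qOf ω x -
          invDMat (negD' ω f₁ f₂) x *ᵥ qOf ω x),
       (2 * I) • f₁ x + ((invDMat (negD' ω f₁ f₂) x)ᵀ *ᵥ rOf ω x -
          invD (negA' ω f₁ f₂) x • rOf ω x)) := by
  have hA : invD (negA' ω f₁ f₂) x =
      invD (fun y => rOf ω y ⬝ᵥ f₂ y) x - invD (fun y => qOf ω y ⬝ᵥ f₁ y) x := by
    rw [show negA' ω f₁ f₂ = fun y => rOf ω y ⬝ᵥ f₂ y - f₁ y ⬝ᵥ qOf ω y from rfl,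
      invD_sub ((vSch_r ω).dotProduct h₂).integrable (VCls.dotProduct' h₁ (vSch_q ω)).integrable]
    simp only [dotProduct_comm (qOf ω _)]
  have hD : ∀ j k, invDMat (negD' ω f₁ f₂) x j k =
      invD (fun y => qOf ω y j * f₁ y k) x - invD (fun y => rOf ω y k * f₂ y j) x := fun j k => by
    have := invD_sub (x := x) ((sch_q ω j).mul (h₁ k)).integrable
      (Cls.mul' (h₂ j) (sch_r ω k)).integrable
    simp only [mul_comm (rOf ω _ k)]
    exact this
  refine Prod.ext (funext fun j => ?_) (funext fun j => ?_)
  · simp only [opL2, swapF, Prod.swap_prod_mk, Pi.add_apply, Pi.sub_apply, Pi.smul_apply,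
      smul_eq_mul, Matrix.mulVec, dotProduct, hA, hD, sub_mul, Finset.sum_sub_distrib]
    simp only [mul_comm (qOf ω x _)]
    ring
  · simp only [opL2, swapF, Prod.swap_prod_mk, Pi.add_apply, Pi.sub_apply, Pi.smul_apply,
      smul_eq_mul, Matrix.mulVec, dotProduct, Matrix.transpose_apply, hA, hD, sub_mul,
      Finset.sum_sub_distrib]
    simp only [mul_comm (rOf ω x _)]
    ring

/-- `K` is the recursion of the negative hierarchy on `(c, b)`. -/
theorem opK_mk_eq_negStep (w : Coeffs N) (hb : VSmb w.b) (hc : VSmb w.c) :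
    opK ω (fun x => (w.c x, w.b x)) = fun x => ((negStep ω w).c x, (negStep ω w).b x) := by
  have h : swapF (opL2 ω (swapF fun x => (w.c x, w.b x))) = fun x => _ :=
    funext fun x => congrArg Prod.swap (opL2_swap (ω := ω) hc hb x)
  rw [opK, h]
  rfl

theorem IsSchwartz.opL2_swap {f : VField N} (h : IsSchwartz f) :
    IsSchwartz (opL2 ω (swapF f)) := by
  have e := funext fun x => KaupNewell.opL2_swap (ω := ω) h.vSch.1.smb h.vSch.2.smb x
  simp only [Prod.mk.eta] at e
  rw [e]
  have hA : Smb (invD (negA' ω (fun x => (f x).1) fun x => (f x).2)) :=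
    (sch_negA' h.vSch.1.smb h.vSch.2.smb).invD
  have hD : MSmb (invDMat (negD' ω (fun x => (f x).1) fun x => (f x).2)) :=
    mSmb_invDMat (mSch_negD' h.vSch.1.smb h.vSch.2.smb)
  exact isSchwartz_mk.2 ⟨(h.vSch.2.const_smul _).add (((vSch_q ω).smul hA).sub
    (VCls.mulVec (vSch_q ω) hD)), (h.vSch.1.const_smul _).add
      ((VCls.mulVec (vSch_r ω) hD.transpose).sub ((vSch_r ω).smul hA))⟩

/-- `L₂ S` is skew-symmetric. -/
theorem integral_pair_opL2 {f₁ f₂ g₁ g₂ : ℝ → Vec N} (hf₁ : VSch f₁) (hf₂ : VSch f₂)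
    (hg₁ : VSch g₁) (hg₂ : VSch g₂) :
    ∫ x, pair (g₁ x, g₂ x) (opL2 ω (swapF fun y => (f₁ y, f₂ y)) x) =
      -∫ x, pair (f₁ x, f₂ x) (opL2 ω (swapF fun y => (g₁ y, g₂ y)) x) := by
  have key : ∀ {f₁ f₂ g₁ g₂ : ℝ → Vec N}, VSch f₁ → VSch f₂ → VSch g₁ → VSch g₂ →
      ∫ x, pair (g₁ x, g₂ x) (opL2 ω (swapF fun y => (f₁ y, f₂ y)) x) =
        (∫ x, (2 * I) * (f₁ x ⬝ᵥ g₂ x - g₁ x ⬝ᵥ f₂ x)) -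
          ((∫ x, negA' ω g₁ g₂ x * invD (negA' ω f₁ f₂) x) +
            ∑ j, ∑ k, ∫ x, negD' ω g₁ g₂ x k j * invD (fun y => negD' ω f₁ f₂ y j k) x) := by
    intro f₁ f₂ g₁ g₂ hf₁ hf₂ hg₁ hg₂
    have i1 : Integrable fun x => (2 * I) * (f₁ x ⬝ᵥ g₂ x - g₁ x ⬝ᵥ f₂ x) :=
      (((hf₁.dotProduct hg₂.smb).sub (hg₁.dotProduct hf₂.smb)).const_mul _).integrable
    have i2 : Integrable fun x => negA' ω g₁ g₂ x * invD (negA' ω f₁ f₂) x :=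
      ((sch_negA' hg₁.smb hg₂.smb).mul (sch_negA' hf₁.smb hf₂.smb).invD).integrable
    have i3 : ∀ j k, Integrable fun x =>
        negD' ω g₁ g₂ x k j * invD (fun y => negD' ω f₁ f₂ y j k) x := fun j k =>
      ((mSch_negD' hg₁.smb hg₂.smb k j).mul (mSch_negD' hf₁.smb hf₂.smb j k).invD).integrable
    have i4 : ∀ j, Integrable fun x =>
        ∑ k, negD' ω g₁ g₂ x k j * invD (fun y => negD' ω f₁ f₂ y j k) x := fun j =>
      integrable_finsetSum _ fun k _ => i3 j k
    have i5 : Integrable fun x =>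
        ∑ j, ∑ k, negD' ω g₁ g₂ x k j * invD (fun y => negD' ω f₁ f₂ y j k) x :=
      integrable_finsetSum _ fun j _ => i4 j
    have i6 : Integrable fun x => negA' ω g₁ g₂ x * invD (negA' ω f₁ f₂) x +
      ∑ j, ∑ k, negD' ω g₁ g₂ x k j * invD (fun y => negD' ω f₁ f₂ y j k) x := i2.add i5
    have e1 : ∑ j, ∑ k, ∫ x, negD' ω g₁ g₂ x k j * invD (fun y => negD' ω f₁ f₂ y j k) x =
        ∫ x, ∑ j, ∑ k, negD' ω g₁ g₂ x k j * invD (fun y => negD' ω f₁ f₂ y j k) x := by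
      rw [integral_finsetSum _ fun j _ => i4 j]
      exact Finset.sum_congr rfl fun j _ => (integral_finsetSum _ fun k _ => i3 j k).symm
    rw [e1, ← integral_add i2 i5, ← integral_sub i1 i6]
    refine integral_congr_ae (Eventually.of_forall fun x => ?_)
    have e2 : ∑ j, ∑ k, negD' ω g₁ g₂ x k j * invD (fun y => negD' ω f₁ f₂ y j k) x =
        g₁ x ⬝ᵥ (invDMat (negD' ω f₁ f₂) x *ᵥ qOf ω x) -
          g₂ x ⬝ᵥ ((invDMat (negD' ω f₁ f₂) x)ᵀ *ᵥ rOf ω x) := by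
      have e3 : g₂ x ⬝ᵥ ((invDMat (negD' ω f₁ f₂) x)ᵀ *ᵥ rOf ω x) =
          ∑ j, ∑ k, g₂ x k * rOf ω x j * invD (fun y => negD' ω f₁ f₂ y j k) x := by
        rw [Finset.sum_comm]
        simp only [dotProduct, Matrix.mulVec, Matrix.transpose_apply, Finset.mul_sum]
        refine Finset.sum_congr rfl fun k _ => Finset.sum_congr rfl fun j _ => ?_
        change g₂ x k * (invD (fun y => negD' ω f₁ f₂ y j k) x * rOf ω x j) = _
        ring
      rw [e3]
      simp only [dotProduct, Matrix.mulVec, Finset.mul_sum]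
      rw [← Finset.sum_sub_distrib]
      refine Finset.sum_congr rfl fun j _ => ?_
      rw [← Finset.sum_sub_distrib]
      refine Finset.sum_congr rfl fun k _ => ?_
      change (qOf ω x k * g₁ x j - g₂ x k * rOf ω x j) * _ =
        g₁ x j * (invD (fun y => negD' ω f₁ f₂ y j k) x * qOf ω x k) - _
      ring
    simp only [e2, KaupNewell.opL2_swap hf₁.smb hf₂.smb, pair, dotProduct_add, dotProduct_sub,
      dotProduct_smul, smul_eq_mul, negA', dotProduct_comm (rOf ω x) (g₂ x),
      dotProduct_comm (g₂ x) (f₁ x)]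
    ring
  rw [key hf₁ hf₂ hg₁ hg₂, key hg₁ hg₂ hf₁ hf₂]
  have h1 : ∫ x, (2 * I) * (f₁ x ⬝ᵥ g₂ x - g₁ x ⬝ᵥ f₂ x) =
      -∫ x, (2 * I) * (g₁ x ⬝ᵥ f₂ x - f₁ x ⬝ᵥ g₂ x) := by
    rw [← integral_neg]
    congr 1
    funext x
    ring
  have h2 : ∑ j, ∑ k, ∫ x, negD' ω g₁ g₂ x k j * invD (fun y => negD' ω f₁ f₂ y j k) x =
      -∑ j, ∑ k, ∫ x, negD' ω f₁ f₂ x k j * invD (fun y => negD' ω g₁ g₂ y j k) x := by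
    rw [Finset.sum_comm, ← Finset.sum_neg_distrib]
    refine Finset.sum_congr rfl fun j _ => ?_
    rw [← Finset.sum_neg_distrib]
    refine Finset.sum_congr rfl fun k _ => ?_
    exact integral_mul_invD (mSch_negD' hg₁.smb hg₂.smb j k) (mSch_negD' hf₁.smb hf₂.smb k j)
  rw [h1, h2, integral_mul_invD (sch_negA' hg₁.smb hg₂.smb) (sch_negA' hf₁.smb hf₂.smb)]
  ring

theorem IsSchwartz.integral_pair_opL2 {f g : VField N} (hf : IsSchwartz f) (hg : IsSchwartz g) :
    ∫ x, KaupNewell.pair (g x) (opL2 ω (swapF f) x) =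
      -∫ x, KaupNewell.pair (f x) (opL2 ω (swapF g) x) :=
  KaupNewell.integral_pair_opL2 hf.vSch.1 hf.vSch.2 hg.vSch.1 hg.vSch.2

/-- `J K = L₂ S` on rapidly decreasing fields. -/
theorem IsSchwartz.opJ_opK {f : VField N} (hf : IsSchwartz f) :
    KaupNewell.opJ (opK ω f) = opL2 ω (swapF f) := by
  have hR := hf.opL2_swap (ω := ω)
  funext x
  have h : HasDerivAt (opK ω f) (swapF (opL2 ω (swapF f)) x) x :=
    (hasDerivAt_pi.2 fun j => invD_hasDerivAt (hR.vSch.2 j).integrable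
      (hR.vSch.2 j).continuous x).prodMk (hasDerivAt_pi.2 fun j =>
        invD_hasDerivAt (hR.vSch.1 j).integrable (hR.vSch.1 j).continuous x)
  rw [opJ_eq, swapF, h.deriv, swapF, Prod.swap_swap]

theorem integral_pair_opJ_opK_skew (k : ℕ) : ∀ {f g : VField N}, IsSchwartz f → IsSchwartz g →
    (∀ j < k, IsSchwartz ((opK ω)^[j] f) ∧ IsSchwartz ((opK ω)^[j] g)) →
    ∫ x, pair (g x) (opJ ((opK ω)^[k] f) x) = -∫ x, pair (f x) (opJ ((opK ω)^[k] g) x) := by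
  induction k with
  | zero => exact fun hf hg _ => integral_pair_opJ hf hg
  | succ k ih =>
    intro f g hf hg h
    have hfk := (h k k.lt_succ_self).1
    rw [Function.iterate_succ_apply', hfk.opJ_opK, hfk.integral_pair_opL2 hg]
    cases k with
    | zero => simp only [Function.iterate_zero, id, zero_add, Function.iterate_one, hg.opJ_opK]
    | succ k =>
      -- `-⟨K^k f, J K g⟩ = ⟨K g, J K^k f⟩`, which reduces the power of `K` by one
      have hKg := (h 1 (by omega)).2
      rw [Function.iterate_one] at hKg
      rw [← hg.opJ_opK, ← integral_pair_opJ hfk hKg, ih hf hKg fun j hj =>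
        ⟨(h j (by omega)).1, by
          rw [← Function.iterate_succ_apply]; exact (h (j + 1) (by omega)).2⟩,
        ← Function.iterate_succ_apply]

theorem skewOn_opK (k : ℕ) (f g : Phase N)
    (h : ∀ j < k, IsSchwartz ((opK ω)^[j] f) ∧ IsSchwartz ((opK ω)^[j] g)) :
    SkewOn (fun h => opJ ((opK ω)^[k] h)) f g := by
  have hf : IsSchwartz f := ⟨f, rfl⟩
  have hg : IsSchwartz g := ⟨g, rfl⟩
  have hJ : ∀ {f : VField N}, (∀ j < k, IsSchwartz ((opK ω)^[j] f)) → IsSchwartz f →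
      IsSchwartz (opJ ((opK ω)^[k] f)) := fun {f} h hf => by
    cases k with
    | zero => exact hf.opJ
    | succ k =>
      rw [Function.iterate_succ_apply', (h k k.lt_succ_self).opJ_opK]
      exact (h k k.lt_succ_self).opL2_swap
  exact ⟨(hg.pair (hJ (fun j hj => (h j hj).1) hf)).integrable,
    (hf.pair (hJ (fun j hj => (h j hj).2) hg)).integrable, integral_pair_opJ_opK_skew k hf hg h⟩

end OpK

/-! ### Block matrices and the stationary equation -/

section Blocks

variable {N : ℕ} {ω : Phase N}

/-- The block diagonal matrix with blocks `a`, `d`. -/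
def bDiag (a : ℂ) (d : Matrix (Fin N) (Fin N) ℂ) : BMat N := fromBlocks (of fun _ _ => a) 0 0 d

/-- The block off-diagonal matrix with upper right block `cᵀ` and lower left block `b`. -/
def bOff (c b : Vec N) : BMat N := fromBlocks 0 (of fun _ k => c k) (of fun k _ => b k) 0

theorem matQ_eq (ω : Phase N) (x : ℝ) : matQ ω x = bOff (rOf ω x) (qOf ω x) := rfl

theorem coeffMat_even (w : ℕ → Coeffs N) (j : ℕ) (x : ℝ) :
    coeffMat w (2 * j) x = bDiag ((w j).a x) ((w j).d x) := by
  have h : 2 * j / 2 = j := by omega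
  simp [coeffMat, bDiag, h]

theorem coeffMat_odd (w : ℕ → Coeffs N) (j : ℕ) (x : ℝ) :
    coeffMat w (2 * j + 1) x = bOff ((w j).c x) ((w j).b x) := by
  have h : (2 * j + 1) / 2 = j := by omega
  have h' : (2 * j + 1) % 2 = 1 := by omega
  simp [coeffMat, bOff, h, h']

theorem add_comm_left (A B C : BMat N) : comm (A + B) C = comm A C + comm B C := by
  simp only [comm, Matrix.mul_add, Matrix.add_mul]; abel

theorem comm_smul (z : ℂ) (A B : BMat N) : comm A (z • B) = z • comm A B := by
  simp only [comm, Matrix.mul_smul, Matrix.smul_mul, smul_sub]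

theorem smul_comm_left (z : ℂ) (A B : BMat N) : comm (z • A) B = z • comm A B := by
  simp only [comm, Matrix.mul_smul, Matrix.smul_mul, smul_sub]

theorem comm_zero (A : BMat N) : comm A 0 = 0 := by simp [comm]

theorem comm_sigma_bDiag (a : ℂ) (d : Matrix (Fin N) (Fin N) ℂ) :
    comm (I • sigma3) (bDiag a d) = 0 := by
  rw [smul_comm_left]
  simp [comm, sigma3, bDiag, fromBlocks_multiply]

theorem comm_sigma_bOff (c b : Vec N) :
    comm (I • sigma3) (bOff c b) = bOff ((2 * I) • c) (-(2 * I) • b) := by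
  rw [smul_comm_left]
  have : comm sigma3 (bOff c b) = bOff ((2 : ℂ) • c) ((-2 : ℂ) • b) := by
    simp only [comm, sigma3, bOff, fromBlocks_multiply]
    ext i j
    rcases i with i | i <;> rcases j with j | j <;> simp <;> ring
  rw [this]
  ext i j
  rcases i with i | i <;> rcases j with j | j <;> simp [bOff] <;> ring

theorem comm_bOff_bDiag (r q : Vec N) (a : ℂ) (d : Matrix (Fin N) (Fin N) ℂ) :
    comm (bOff r q) (bDiag a d) = bOff (dᵀ *ᵥ r - a • r) (a • q - d *ᵥ q) := by
  simp only [comm, bOff, bDiag, fromBlocks_multiply]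
  ext i j
  rcases i with i | i <;> rcases j with j | j <;>
    simp [Matrix.mul_apply, Matrix.mulVec, dotProduct, mul_comm]

theorem comm_bOff_bOff (r q c b : Vec N) :
    comm (bOff r q) (bOff c b) =
      bDiag (r ⬝ᵥ b - c ⬝ᵥ q) (vecMulVec q c - vecMulVec b r) := by
  simp only [comm, bOff, bDiag, fromBlocks_multiply]
  ext i j
  rcases i with i | i <;> rcases j with j | j <;>
    simp [Matrix.mul_apply, dotProduct, vecMulVec_apply]

theorem bOff_add (c b c' b' : Vec N) : bOff c b + bOff c' b' = bOff (c + c') (b + b') := by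
  ext i j
  rcases i with i | i <;> rcases j with j | j <;> simp [bOff]

theorem bOff_zero : bOff (0 : Vec N) 0 = 0 := by
  ext i j
  rcases i with i | i <;> rcases j with j | j <;> simp [bOff]

theorem bDiag_zero : bDiag 0 (0 : Matrix (Fin N) (Fin N) ℂ) = 0 := by
  ext i j
  rcases i with i | i <;> rcases j with j | j <;> simp [bDiag]

theorem mDeriv_bDiag {a a' : ℝ → ℂ} {d d' : ℝ → Matrix (Fin N) (Fin N) ℂ}
    (ha : ∀ x, HasDerivAt a (a' x) x) (hd : MDeriv d d') :
    MDeriv (fun x => bDiag (a x) (d x)) fun x => bDiag (a' x) (d' x) := by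
  intro x i j
  rcases i with i | i <;> rcases j with j | j
  · exact ha x
  · exact hasDerivAt_const x _
  · exact hasDerivAt_const x _
  · exact hd x i j

theorem mDeriv_bOff {c c' b b' : ℝ → Vec N} (hc : ∀ x j, HasDerivAt (fun y => c y j) (c' x j) x)
    (hb : ∀ x j, HasDerivAt (fun y => b y j) (b' x j) x) :
    MDeriv (fun x => bOff (c x) (b x)) fun x => bOff (c' x) (b' x) := by
  intro x i j
  rcases i with i | i <;> rcases j with j | j
  · exact hasDerivAt_const x _
  · exact hc x j
  · exact hb x i
  · exact hasDerivAt_const x _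

theorem mCls_bDiag {K : Set ℕ} {a : ℝ → ℂ} {d : ℝ → Matrix (Fin N) (Fin N) ℂ} :
    MCls K (fun x => bDiag (a x) (d x)) ↔ Cls K a ∧ MCls K d := by
  refine ⟨fun h => ⟨h (Sum.inl ()) (Sum.inl ()), fun i j => h (Sum.inr i) (Sum.inr j)⟩, ?_⟩
  rintro ⟨ha, hd⟩ i j
  rcases i with i | i <;> rcases j with j | j
  · exact ha
  · exact Cls.zero
  · exact Cls.zero
  · exact hd i j

theorem mCls_bOff {K : Set ℕ} {c b : ℝ → Vec N} :
    MCls K (fun x => bOff (c x) (b x)) ↔ VCls K c ∧ VCls K b := by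
  refine ⟨fun h => ⟨fun j => h (Sum.inl ()) (Sum.inr j), fun i => h (Sum.inr i) (Sum.inl ())⟩, ?_⟩
  rintro ⟨hc, hb⟩ i j
  rcases i with i | i <;> rcases j with j | j
  · exact Cls.zero
  · exact hc j
  · exact hb i
  · exact Cls.zero

theorem mSch_matQ (ω : Phase N) : MSch (matQ ω) := mCls_bOff.2 ⟨vSch_r ω, vSch_q ω⟩

end Blocks

section PosRegularity

variable {N : ℕ} {α : ℂ} {ω : Phase N}

theorem vSch_posCoeffs (n : ℕ) : VSch (posCoeffs α ω n).c ∧ VSch (posCoeffs α ω n).b := by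
  induction n with
  | zero => exact ⟨(vSch_r ω).const_smul α, (vSch_q ω).const_smul α⟩
  | succ n ih =>
    have := (isSchwartz_mk.2 ih).opL (ω := ω)
    rw [opL_mk_eq_posStep _ ih.2 ih.1] at this
    exact isSchwartz_mk.1 this

theorem smb_posCoeffs_a (n : ℕ) : Smb (posCoeffs α ω n).a := by
  cases n with
  | zero => exact Cls.const _
  | succ n =>
    exact (sch_meanS_integrand (vSch_posCoeffs n).1.deriv (vSch_posCoeffs n).2.deriv).invD.const_mul
      _

theorem mSmb_posCoeffs_d (n : ℕ) : MSmb (posCoeffs α ω n).d := by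
  cases n with
  | zero => exact MCls.const _
  | succ n =>
    exact (meanE_isMeanSol (vSch_posCoeffs n).1.deriv (vSch_posCoeffs n).2.deriv).mSmb.smul _

/-- The odd rows of the stationary equation are the definition of `b` and `c`. -/
theorem posStep_b_deriv (w : Coeffs N) (x : ℝ) :
    deriv w.b x = -(2 * I) • (posStep ω w).b x +
      ((posStep ω w).a x • qOf ω x - (posStep ω w).d x *ᵥ qOf ω x) := by
  have h : (posStep ω w).b x = I⁻¹ • (-((1 / 2 : ℂ) • deriv w.b x) + (1 / 2 : ℂ) •
    ((posStep ω w).a x • qOf ω x - (posStep ω w).d x *ᵥ qOf ω x)) := rfl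
  rw [h, Complex.inv_I]
  funext j
  simp only [Pi.add_apply, Pi.neg_apply, Pi.smul_apply, Pi.sub_apply, smul_eq_mul]
  linear_combination (deriv w.b x j - ((posStep ω w).a x * qOf ω x j -
    ((posStep ω w).d x *ᵥ qOf ω x) j)) * Complex.I_mul_I

theorem posStep_c_deriv (w : Coeffs N) (x : ℝ) :
    deriv w.c x = (2 * I) • (posStep ω w).c x +
      (((posStep ω w).d x)ᵀ *ᵥ rOf ω x - (posStep ω w).a x • rOf ω x) := by
  have h : (posStep ω w).c x = I⁻¹ • ((1 / 2 : ℂ) • deriv w.c x - (1 / 2 : ℂ) •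
    (((posStep ω w).d x)ᵀ *ᵥ rOf ω x - (posStep ω w).a x • rOf ω x)) := rfl
  rw [h, Complex.inv_I]
  funext j
  simp only [Pi.add_apply, Pi.smul_apply, Pi.sub_apply, smul_eq_mul]
  linear_combination (deriv w.c x j - ((((posStep ω w).d x)ᵀ *ᵥ rOf ω x) j -
    (posStep ω w).a x * rOf ω x j)) * Complex.I_mul_I

theorem posStep_a_hasDerivAt (w : Coeffs N) (hc : VSch w.c) (hb : VSch w.b) (x : ℝ) :
    HasDerivAt (posStep ω w).a
      (rOf ω x ⬝ᵥ (posStep ω w).b x - (posStep ω w).c x ⬝ᵥ qOf ω x) x := by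
  have hs := sch_meanS_integrand (ω := ω) hc.deriv hb.deriv
  refine ((invD_hasDerivAt hs.integrable hs.continuous x).const_mul (I / 2)).congr_deriv ?_
  rw [posStep_b_deriv (ω := ω) w x, posStep_c_deriv (ω := ω) w x]
  simp only [dotProduct_add, add_dotProduct, dotProduct_smul, smul_dotProduct, dotProduct_sub,
    sub_dotProduct, smul_eq_mul]
  have e : ((posStep ω w).d x)ᵀ *ᵥ rOf ω x ⬝ᵥ qOf ω x =
      rOf ω x ⬝ᵥ (posStep ω w).d x *ᵥ qOf ω x := by
    rw [Matrix.mulVec_transpose, ← Matrix.dotProduct_mulVec]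
  rw [e]
  linear_combination (-(rOf ω x ⬝ᵥ (posStep ω w).b x) + (posStep ω w).c x ⬝ᵥ qOf ω x) *
    Complex.I_mul_I

theorem posStep_d_mDeriv (w : Coeffs N) (hc : VSch w.c) (hb : VSch w.b) :
    MDeriv (posStep ω w).d fun x =>
      vecMulVec (qOf ω x) ((posStep ω w).c x) - vecMulVec ((posStep ω w).b x) (rOf ω x) := by
  refine ((meanE_isMeanSol hc.deriv hb.deriv).mDeriv.smul (-(I / 2))).congr fun x => ?_
  have hd : (posStep ω w).d x = (-(I / 2)) • meanE ω (deriv w.c) (deriv w.b) x := rfl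
  have hI : meanE ω (deriv w.c) (deriv w.b) x = (2 * I) • (posStep ω w).d x := by
    rw [hd, smul_smul, show 2 * I * -(I / 2) = -(I * I) by ring, Complex.I_mul_I, neg_neg, one_smul]
  rw [hI, rankTwo, posStep_b_deriv (ω := ω) w x, posStep_c_deriv (ω := ω) w x, qrT]
  ext i j
  simp only [Matrix.smul_apply, Matrix.add_apply, Matrix.sub_apply, vecMulVec_apply, Pi.add_apply,
    Pi.smul_apply, Pi.sub_apply, smul_eq_mul, Matrix.mul_smul, Matrix.smul_mulVec,
    Matrix.mul_vecMulVec, Matrix.vecMulVec_mul, Matrix.mulVec_transpose]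
  linear_combination ((posStep ω w).b x i * rOf ω x j - qOf ω x i * (posStep ω w).c x j -
    (I / 2) * (qOf ω x i * (rOf ω x ᵥ* (posStep ω w).d x) j -
      ((posStep ω w).d x *ᵥ qOf ω x) i * rOf ω x j)) * Complex.I_mul_I

/-- The stationary equation for the coefficients of the positive hierarchy. -/
theorem posW_mDeriv (m : ℕ) : MDeriv (coeffMat (posCoeffs α ω) m) fun x =>
    comm (I • sigma3) (coeffMat (posCoeffs α ω) (m + 2) x) +
      comm (matQ ω x) (coeffMat (posCoeffs α ω) (m + 1) x) := by
  obtain ⟨j, rfl | rfl⟩ := Nat.even_or_odd' m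
  · have h2 : 2 * j + 2 = 2 * (j + 1) := by ring
    have e : coeffMat (posCoeffs α ω) (2 * j) = fun x =>
      bDiag ((posCoeffs α ω j).a x) ((posCoeffs α ω j).d x) := funext (coeffMat_even _ _)
    simp only [e, h2, coeffMat_even, coeffMat_odd, comm_sigma_bDiag, matQ_eq, comm_bOff_bOff,
      zero_add]
    cases j with
    | zero =>
      refine mDeriv_bDiag (fun x => ?_) ?_
      · refine (hasDerivAt_const x (I * α)).congr_deriv ?_
        simp [posCoeffs, dotProduct_comm]
      · refine (MDeriv.const _).congr fun x => ?_
        simp [posCoeffs, Matrix.smul_vecMulVec, Matrix.vecMulVec_smul]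
    | succ j =>
      exact mDeriv_bDiag (posStep_a_hasDerivAt _ (vSch_posCoeffs j).1 (vSch_posCoeffs j).2)
        (posStep_d_mDeriv _ (vSch_posCoeffs j).1 (vSch_posCoeffs j).2)
  · have h2 : 2 * j + 1 + 2 = 2 * (j + 1) + 1 := by ring
    have h3 : 2 * j + 1 + 1 = 2 * (j + 1) := by ring
    have e : coeffMat (posCoeffs α ω) (2 * j + 1) = fun x =>
      bOff ((posCoeffs α ω j).c x) ((posCoeffs α ω j).b x) := funext (coeffMat_odd _ _)
    simp only [e, h2, h3, coeffMat_even, coeffMat_odd, comm_sigma_bOff, matQ_eq, comm_bOff_bDiag,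
      bOff_add]
    refine (mDeriv_bOff (fun x j' => (vSch_posCoeffs j).1.hasDerivAt x j')
      (fun x j' => (vSch_posCoeffs j).2.hasDerivAt x j')).congr fun x => ?_
    rw [posStep_b_deriv (ω := ω), posStep_c_deriv (ω := ω)]
    rfl

theorem posW_initial (x : ℝ) : comm (I • sigma3) (coeffMat (posCoeffs α ω) 1 x) +
    comm (matQ ω x) (coeffMat (posCoeffs α ω) 0 x) = 0 := by
  have h0 := coeffMat_even (posCoeffs α ω) 0 x
  have h1 := coeffMat_odd (posCoeffs α ω) 0 x
  rw [mul_zero] at h0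
  rw [mul_zero, zero_add] at h1
  rw [h0, h1, matQ_eq, comm_sigma_bOff, comm_bOff_bDiag, bOff_add, ← bOff_zero]
  congr 1
  · funext j
    simp [posCoeffs, Matrix.neg_mulVec, Matrix.smul_mulVec, Matrix.transpose_smul,
      Matrix.transpose_neg]
    ring
  · funext j
    simp [posCoeffs, Matrix.neg_mulVec, Matrix.smul_mulVec]
    ring

theorem comm_sigma_posW_even (j : ℕ) (x : ℝ) :
    comm (I • sigma3) (coeffMat (posCoeffs α ω) (2 * j) x) = 0 := by
  rw [coeffMat_even, comm_sigma_bDiag]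

theorem posSeries_natCast (m : ℕ) : posSeries α ω (m : ℤ) = coeffMat (posCoeffs α ω) m := by
  simp [posSeries]

theorem posSeries_of_neg {k : ℤ} (hk : k < 0) : posSeries α ω k = 0 := by
  rw [posSeries, if_neg (not_le.2 hk)]

theorem stationaryAt_pos (k : ℤ) : StationaryAt ω (posSeries α ω) k := by
  rcases le_or_gt 0 k with hk | hk
  · obtain ⟨m, rfl⟩ := Int.eq_ofNat_of_zero_le hk
    have e1 : (m : ℤ) + 2 = ((m + 2 : ℕ) : ℤ) := by push_cast; ring
    have e2 : (m : ℤ) + 1 = ((m + 1 : ℕ) : ℤ) := by push_cast; ring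
    intro x i j
    rw [e1, e2, posSeries_natCast, posSeries_natCast, posSeries_natCast]
    exact posW_mDeriv m x i j
  · have h0 : ∀ x, comm (I • sigma3) (posSeries α ω (k + 2) x) +
        comm (matQ ω x) (posSeries α ω (k + 1) x) = 0 := fun x => by
      rcases lt_or_ge k (-2) with h | h
      · rw [posSeries_of_neg (by omega), posSeries_of_neg (by omega)]
        simp [comm]
      · have : k = -2 ∨ k = -1 := by omega
        rcases this with rfl | rfl
        · have e : (-2 : ℤ) + 2 = ((0 : ℕ) : ℤ) := rfl
          rw [e, posSeries_natCast, posSeries_of_neg (by omega)]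
          have := comm_sigma_posW_even (α := α) (ω := ω) 0 x
          rw [mul_zero] at this
          rw [this]
          simp [comm]
        · have e1 : (-1 : ℤ) + 2 = ((1 : ℕ) : ℤ) := rfl
          have e2 : (-1 : ℤ) + 1 = ((0 : ℕ) : ℤ) := rfl
          rw [e1, e2, posSeries_natCast, posSeries_natCast, posW_initial]
    intro x i j
    rw [h0 x, posSeries_of_neg hk]
    exact hasDerivAt_const x _

end PosRegularity

/-! ### The coefficients of the negative hierarchy -/

section NegRegularity

variable {N : ℕ} {α : ℂ} {ω : Phase N} {n : ℕ}

theorem negStep_a_hasDerivAt (w : Coeffs N) (hc : VSmb w.c) (hb : VSmb w.b) (x : ℝ) :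
    HasDerivAt (negStep ω w).a (rOf ω x ⬝ᵥ w.b x - w.c x ⬝ᵥ qOf ω x) x :=
  have hs := sch_negA' (ω := ω) hc hb
  invD_hasDerivAt hs.integrable hs.continuous x

theorem negStep_d_mDeriv (w : Coeffs N) (hc : VSmb w.c) (hb : VSmb w.b) :
    MDeriv (negStep ω w).d fun x =>
      vecMulVec (qOf ω x) (w.c x) - vecMulVec (w.b x) (rOf ω x) := fun x i j =>
  have hs := mSch_negD' (ω := ω) hc hb i j
  invD_hasDerivAt hs.integrable hs.continuous x

theorem smb_negStep_a (w : Coeffs N) (hc : VSmb w.c) (hb : VSmb w.b) : Smb (negStep ω w).a :=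
  (sch_negA' hc hb).invD

theorem mSmb_negStep_d (w : Coeffs N) (hc : VSmb w.c) (hb : VSmb w.b) : MSmb (negStep ω w).d :=
  mSmb_invDMat (mSch_negD' hc hb)

/-- The integrand of `b`. -/
def negB' (ω : Phase N) (w : Coeffs N) (y : ℝ) : Vec N :=
  -(2 * I) • w.b y + ((negStep ω w).a y • qOf ω y - (negStep ω w).d y *ᵥ qOf ω y)

/-- The integrand of `c`. -/
def negC' (ω : Phase N) (w : Coeffs N) (y : ℝ) : Vec N :=
  (2 * I) • w.c y + (((negStep ω w).d y)ᵀ *ᵥ rOf ω y - (negStep ω w).a y • rOf ω y)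

theorem vSch_negB' (w : Coeffs N) (hc : VSch w.c) (hb : VSch w.b) : VSch (negB' ω w) :=
  (hb.const_smul _).add (((vSch_q ω).smul (smb_negStep_a w hc.smb hb.smb)).sub
    (VCls.mulVec (vSch_q ω) (mSmb_negStep_d w hc.smb hb.smb)))

theorem vSch_negC' (w : Coeffs N) (hc : VSch w.c) (hb : VSch w.b) : VSch (negC' ω w) :=
  (hc.const_smul _).add ((VCls.mulVec (vSch_r ω) (mSmb_negStep_d w hc.smb hb.smb).transpose).sub
    ((vSch_r ω).smul (smb_negStep_a w hc.smb hb.smb)))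

theorem negStep_b_hasDerivAt (w : Coeffs N) (hc : VSch w.c) (hb : VSch w.b) (x : ℝ) (j : Fin N) :
    HasDerivAt (fun y => (negStep ω w).b y j) (negB' ω w x j) x :=
  have hs := vSch_negB' (ω := ω) w hc hb j
  invD_hasDerivAt hs.integrable hs.continuous x

theorem negStep_c_hasDerivAt (w : Coeffs N) (hc : VSch w.c) (hb : VSch w.b) (x : ℝ) (j : Fin N) :
    HasDerivAt (fun y => (negStep ω w).c y j) (negC' ω w x j) x :=
  have hs := vSch_negC' (ω := ω) w hc hb j
  invD_hasDerivAt hs.integrable hs.continuous x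

theorem vSch_negCoeffs (h : ω ∈ negDomain α n) {j : ℕ} (hj : j < n) :
    VSch (negCoeffs α ω j).c ∧ VSch (negCoeffs α ω j).b := (h j hj).vSch

theorem vSmb_negCoeffs (h : ω ∈ negDomain α n) {j : ℕ} (hj : j ≤ n) :
    VSmb (negCoeffs α ω j).c ∧ VSmb (negCoeffs α ω j).b := by
  cases j with
  | zero => exact ⟨fun k => ((sch_r ω k).invD.const_mul α).neg, fun k => (sch_q ω k).invD.const_mul α⟩
  | succ j =>
    obtain ⟨hc, hb⟩ := vSch_negCoeffs h hj
    exact ⟨fun k => (vSch_negC' _ hc hb k).invD, fun k => (vSch_negB' _ hc hb k).invD⟩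

theorem smb_negCoeffs_a (h : ω ∈ negDomain α n) {j : ℕ} (hj : j ≤ n + 1) :
    Smb (negCoeffs α ω j).a := by
  cases j with
  | zero => exact Cls.const _
  | succ j =>
    obtain ⟨hc, hb⟩ := vSmb_negCoeffs h (Nat.le_of_succ_le_succ hj)
    exact smb_negStep_a _ hc hb

theorem mSmb_negCoeffs_d (h : ω ∈ negDomain α n) {j : ℕ} (hj : j ≤ n + 1) :
    MSmb (negCoeffs α ω j).d := by
  cases j with
  | zero => exact MCls.const _
  | succ j =>
    obtain ⟨hc, hb⟩ := vSmb_negCoeffs h (Nat.le_of_succ_le_succ hj)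
    exact mSmb_negStep_d _ hc hb

/-- The `x`-derivative of the `m`-th coefficient matrix of the negative hierarchy. -/
def negDer (α : ℂ) (ω : Phase N) : ℕ → ℝ → BMat N
  | 0, _ => 0
  | 1, x => comm (matQ ω x) (coeffMat (negCoeffs α ω) 0 x)
  | m + 2, x => comm (I • sigma3) (coeffMat (negCoeffs α ω) m x) +
      comm (matQ ω x) (coeffMat (negCoeffs α ω) (m + 1) x)

theorem coeffMat_zero (w : ℕ → Coeffs N) (x : ℝ) : coeffMat w 0 x = bDiag ((w 0).a x) ((w 0).d x) :=
  coeffMat_even w 0 x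

theorem coeffMat_one (w : ℕ → Coeffs N) (x : ℝ) : coeffMat w 1 x = bOff ((w 0).c x) ((w 0).b x) :=
  coeffMat_odd w 0 x

theorem negDer_one (x : ℝ) :
    negDer α ω 1 x = bOff (fun j => -(α * rOf ω x j)) fun j => α * qOf ω x j := by
  rw [negDer, coeffMat_zero, matQ_eq, comm_bOff_bDiag]
  congr 1 <;> funext j <;>
    simp [negCoeffs, Matrix.neg_mulVec, Matrix.smul_mulVec, Matrix.transpose_smul,
      Matrix.transpose_neg] <;> ring

theorem negDer_even (j : ℕ) (x : ℝ) : negDer α ω (2 * (j + 1)) x =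
    bDiag (negA' ω (negCoeffs α ω j).c (negCoeffs α ω j).b x)
      (negD' ω (negCoeffs α ω j).c (negCoeffs α ω j).b x) := by
  rw [show 2 * (j + 1) = 2 * j + 2 by ring, negDer, coeffMat_even, coeffMat_odd, comm_sigma_bDiag,
    matQ_eq, comm_bOff_bOff, zero_add]
  rfl

theorem negDer_odd (j : ℕ) (x : ℝ) : negDer α ω (2 * (j + 1) + 1) x =
    bOff (negC' ω (negCoeffs α ω j) x) (negB' ω (negCoeffs α ω j) x) := by
  rw [show 2 * (j + 1) + 1 = 2 * j + 1 + 2 by ring, negDer,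
    show 2 * j + 1 + 1 = 2 * (j + 1) by ring, coeffMat_even, coeffMat_odd, comm_sigma_bOff,
    matQ_eq, comm_bOff_bDiag, bOff_add]
  rfl

/-- The stationary equation for the coefficients of the negative hierarchy. -/
theorem negW_mDeriv (h : ω ∈ negDomain α n) {m : ℕ} (hm : m ≤ 2 * n + 2) :
    MDeriv (coeffMat (negCoeffs α ω) m) (negDer α ω m) := by
  obtain ⟨j, rfl | rfl⟩ := Nat.even_or_odd' m
  · rcases j with _ | j
    · exact MDeriv.const (bDiag (α / 2) (-((α / 2) • 1)))
    · obtain ⟨hc, hb⟩ := vSmb_negCoeffs h (j := j) (by omega)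
      rw [funext (coeffMat_even _ (j + 1)), funext (negDer_even j)]
      exact mDeriv_bDiag (negStep_a_hasDerivAt _ hc hb) (negStep_d_mDeriv _ hc hb)
  · rcases j with _ | j
    · rw [mul_zero, zero_add, funext (coeffMat_one _), funext negDer_one]
      exact mDeriv_bOff (fun x j => (((invD_hasDerivAt (sch_r ω j).integrable
        (sch_r ω j).continuous x).const_mul α).neg)) fun x j => ((invD_hasDerivAt
        (sch_q ω j).integrable (sch_q ω j).continuous x).const_mul α)
    · obtain ⟨hc, hb⟩ := vSch_negCoeffs h (j := j) (by omega)
      rw [funext (coeffMat_odd _ (j + 1)), funext (negDer_odd j)]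
      exact mDeriv_bOff (negStep_c_hasDerivAt _ hc hb) (negStep_b_hasDerivAt _ hc hb)

theorem negSeries_neg_natCast (m : ℕ) :
    negSeries α ω (-(m : ℤ)) = coeffMat (negCoeffs α ω) m := by
  simp [negSeries]

theorem negSeries_of_pos {k : ℤ} (hk : 0 < k) : negSeries α ω k = 0 := by
  rw [negSeries, if_neg (not_le.2 hk)]

theorem stationaryAt_neg (h : ω ∈ negDomain α n) (k : ℤ) (hk : -(2 * (n : ℤ) + 2) ≤ k) :
    StationaryAt ω (negSeries α ω) k := by
  have h0 : negSeries α ω 0 = coeffMat (negCoeffs α ω) 0 := negSeries_neg_natCast 0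
  rcases lt_or_ge 0 k with hk0 | hk0
  · intro x i j
    rw [negSeries_of_pos hk0, negSeries_of_pos (by omega), negSeries_of_pos (by omega)]
    exact (hasDerivAt_const x (0 : ℂ)).congr_deriv (by simp [comm])
  · obtain ⟨m, hm⟩ := Int.eq_ofNat_of_zero_le (neg_nonneg.2 hk0)
    obtain rfl : k = -(m : ℤ) := by omega
    have hd := negW_mDeriv h (m := m) (by omega)
    intro x i j
    rw [negSeries_neg_natCast]
    refine (hd x i j).congr_deriv (congrArg (fun A : BMat N => A i j) ?_)
    match m with
    | 0 =>
      rw [negSeries_of_pos (k := -((0 : ℕ) : ℤ) + 2) (by simp),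
        negSeries_of_pos (k := -((0 : ℕ) : ℤ) + 1) (by simp), negDer]
      simp [comm]
    | 1 =>
      rw [negSeries_of_pos (k := -((1 : ℕ) : ℤ) + 2) (by simp),
        show -((1 : ℕ) : ℤ) + 1 = 0 by simp, h0, negDer]
      simp [comm]
    | m + 2 =>
      rw [show -((m + 2 : ℕ) : ℤ) + 2 = -(m : ℤ) by push_cast; ring,
        show -((m + 2 : ℕ) : ℤ) + 1 = -((m + 1 : ℕ) : ℤ) by push_cast; ring,
        negSeries_neg_natCast, negSeries_neg_natCast, negDer]

theorem opK_negGrad (h : ω ∈ negDomain α n) {j : ℕ} (hj : j ≤ n) :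
    opK ω (negGrad α j ω) = negGrad α (j + 1) ω :=
  opK_mk_eq_negStep _ (vSmb_negCoeffs h hj).2 (vSmb_negCoeffs h hj).1

theorem negGrad_eq_iterate (h : ω ∈ negDomain α n) (k : ℕ) : ∀ j, j + k ≤ n →
    negGrad α (j + k) ω = (opK ω)^[k] (negGrad α j ω) := by
  induction k with
  | zero => exact fun j _ => rfl
  | succ k ih =>
    intro j hj
    rw [Function.iterate_succ_apply', ← ih j (by omega), opK_negGrad h (by omega), add_assoc]

theorem opL_posGrad (j : ℕ) : opL ω (posGrad α j ω) = posGrad α (j + 1) ω :=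
  opL_mk_eq_posStep _ (vSch_posCoeffs j).2 (vSch_posCoeffs j).1

theorem posGrad_eq_iterate (k j : ℕ) :
    posGrad α (j + k) ω = (opL ω)^[k] (posGrad α j ω) := by
  induction k with
  | zero => rfl
  | succ k ih => rw [Function.iterate_succ_apply', ← ih, opL_posGrad, add_assoc]

end NegRegularity

/-! ### Zero curvature -/

section ZeroCurvature

variable {N : ℕ} {α : ℂ}

/-- If `V_x - [U, V]` is `z⁻¹` times the off-diagonal matrix of the field `F`, then zero curvature
is the evolution equation of `F`. -/
theorem zeroCurvature_iff {ω : ℝ → Phase N} {V : Phase N → ℂ → ℝ → BMat N} {F : Phase N → VField N}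
    (h : ∀ t z, z ≠ 0 → ∃ Vx, MDeriv (V (ω t) z) Vx ∧ ∀ x,
      Vx x - comm (matU (ω t) z x) (V (ω t) z x) =
        z⁻¹ • bOff (F (ω t) x).2 (F (ω t) x).1) :
    ZeroCurvature ω V ↔ IsFlow ω F := by
  constructor
  · intro hz t x
    obtain ⟨Ut, Vx', hU, hV, hc⟩ := hz 1 one_ne_zero t x
    obtain ⟨Vx, hVx, hF⟩ := h t 1 one_ne_zero
    have e : Vx' = Vx x := by ext i j; exact (hV i j).unique (hVx x i j)
    have hUt : Ut = bOff (F (ω t) x).2 (F (ω t) x).1 := by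
      have := hF x
      rw [inv_one, one_smul] at this
      rw [← this, ← e, ← sub_eq_zero, ← hc]
      abel
    subst hUt
    refine HasDerivAt.prodMk (f₁ := fun s => (ω s x).1) (f₂ := fun s => (ω s x).2)
      (hasDerivAt_pi.2 fun j => ?_) (hasDerivAt_pi.2 fun j => ?_)
    · simpa [matU, matQ, sigma3, bOff, qOf] using hU (Sum.inr j) (Sum.inl ())
    · simpa [matU, matQ, sigma3, bOff, rOf] using hU (Sum.inl ()) (Sum.inr j)
  · intro hf z hz t x
    obtain ⟨Vx, hVx, hF⟩ := h t z hz
    have hq : ∀ t j, HasDerivAt (fun s => qOf (ω s) x j) ((F (ω t) x).1 j) t := fun t j =>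
      (((ContinuousLinearMap.proj (R := ℝ) j).comp (ContinuousLinearMap.fst ℝ (Vec N)
        (Vec N))).hasFDerivAt.comp_hasDerivAt t (hf t x))
    have hr : ∀ t j, HasDerivAt (fun s => rOf (ω s) x j) ((F (ω t) x).2 j) t := fun t j =>
      (((ContinuousLinearMap.proj (R := ℝ) j).comp (ContinuousLinearMap.snd ℝ (Vec N)
        (Vec N))).hasFDerivAt.comp_hasDerivAt t (hf t x))
    have hU := (MDeriv.const ((I * (z ^ 2)⁻¹) • sigma3 : BMat N)).add ((mDeriv_bOff hr hq).smul z⁻¹)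
    refine ⟨z⁻¹ • bOff (F (ω t) x).2 (F (ω t) x).1, Vx x, fun i j => ?_, hVx x, ?_⟩
    · have := hU t i j
      simp only [zero_add] at this
      exact this
    · rw [← hF x]
      abel

theorem comm_matU (ω : Phase N) (z : ℂ) (x : ℝ) (A : BMat N) :
    comm (matU ω z x) A = z⁻¹ ^ 2 • comm (I • sigma3) A + z⁻¹ • comm (matQ ω x) A := by
  rw [matU, add_comm_left, smul_comm_left, smul_comm_left, smul_comm_left, smul_smul, inv_pow,
    mul_comm]

theorem comm_sum (A : BMat N) (s : Finset ℕ) (f : ℕ → BMat N) :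
    comm A (∑ m ∈ s, f m) = ∑ m ∈ s, comm A (f m) := by
  simp only [comm, Finset.mul_sum, Finset.sum_mul, Finset.sum_sub_distrib]

theorem posV_eq (n : ℕ) (ω : Phase N) {z : ℂ} (hz : z ≠ 0) (x : ℝ) :
    posV α n ω z x =
      z⁻¹ ^ (2 * n + 2) • ∑ m ∈ Finset.range (2 * n + 2), z ^ m • coeffMat (posCoeffs α ω) m x := by
  rw [posV, Finset.smul_sum]
  refine Finset.sum_nbij' (fun k => (k + (2 * (n : ℤ) + 2)).toNat)
    (fun m => (m : ℤ) - (2 * (n : ℤ) + 2)) (fun k hk => ?_) (fun m hm => ?_) (fun k hk => ?_)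
    (fun m hm => ?_) fun k hk => ?_
  · rw [Finset.mem_Icc] at hk; rw [Finset.mem_range]; omega
  · rw [Finset.mem_range] at hm; rw [Finset.mem_Icc]; omega
  · rw [Finset.mem_Icc] at hk; omega
  · simp
  · rw [Finset.mem_Icc] at hk
    obtain ⟨m, hm⟩ := Int.eq_ofNat_of_zero_le (show 0 ≤ k + (2 * (n : ℤ) + 2) by omega)
    have e : k = (m : ℤ) - ((2 * n + 2 : ℕ) : ℤ) := by push_cast; omega
    rw [hm, posSeries_natCast, Int.toNat_natCast, smul_smul, e, zpow_sub₀ hz, zpow_natCast,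
      zpow_natCast, inv_pow, div_eq_inv_mul]

theorem negV_eq (n : ℕ) (ω : Phase N) {z : ℂ} (hz : z ≠ 0) (x : ℝ) :
    negV α n ω z x =
      z ^ (2 * n) • ∑ m ∈ Finset.range (2 * n + 1), z⁻¹ ^ m • coeffMat (negCoeffs α ω) m x := by
  rw [negV, Finset.smul_sum]
  refine Finset.sum_nbij' (fun k => (2 * (n : ℤ) - k).toNat)
    (fun m => 2 * (n : ℤ) - (m : ℤ)) (fun k hk => ?_) (fun m hm => ?_) (fun k hk => ?_)
    (fun m hm => ?_) fun k hk => ?_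
  · rw [Finset.mem_Icc] at hk; rw [Finset.mem_range]; omega
  · rw [Finset.mem_range] at hm; rw [Finset.mem_Icc]; omega
  · rw [Finset.mem_Icc] at hk; omega
  · simp
  · rw [Finset.mem_Icc] at hk
    obtain ⟨m, hm⟩ := Int.eq_ofNat_of_zero_le (show 0 ≤ 2 * (n : ℤ) - k by omega)
    have e : k = ((2 * n : ℕ) : ℤ) - (m : ℤ) := by push_cast; omega
    rw [hm, show k - 2 * (n : ℤ) = -(m : ℤ) by omega, negSeries_neg_natCast, Int.toNat_natCast,
      smul_smul, e, zpow_sub₀ hz, zpow_natCast, zpow_natCast, inv_pow, div_eq_mul_inv]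

/-- Truncations of the positive series satisfy the stationary equation up to the top terms. -/
theorem comm_matU_posSum (ω : Phase N) {z : ℂ} (hz : z ≠ 0) (x : ℝ) (M : ℕ) :
    ∑ m ∈ Finset.range M, (comm (matU ω z x) (z ^ m • coeffMat (posCoeffs α ω) m x) -
      z ^ m • (comm (I • sigma3) (coeffMat (posCoeffs α ω) (m + 2) x) +
        comm (matQ ω x) (coeffMat (posCoeffs α ω) (m + 1) x))) =
    -((z⁻¹ ^ 2 * z ^ M) • comm (I • sigma3) (coeffMat (posCoeffs α ω) M x) +
      (z⁻¹ * z ^ M) • (comm (I • sigma3) (coeffMat (posCoeffs α ω) (M + 1) x) +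
        comm (matQ ω x) (coeffMat (posCoeffs α ω) M x))) := by
  induction M with
  | zero =>
    rw [Finset.range_zero, Finset.sum_empty, posW_initial, coeffMat_zero, comm_sigma_bDiag]
    simp
  | succ M ih =>
    rw [Finset.sum_range_succ, ih, comm_smul, comm_matU]
    have e1 : z⁻¹ ^ 2 * z ^ (M + 1) = z⁻¹ * z ^ M := by rw [pow_succ z]; field_simp
    have e2 : z⁻¹ * z ^ (M + 1) = z ^ M := by rw [pow_succ z]; field_simp
    rw [e1, e2]
    module

theorem posW_mDeriv_sum (ω : Phase N) (z : ℂ) (M : ℕ) :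
    MDeriv (fun x => ∑ m ∈ Finset.range M, z ^ m • coeffMat (posCoeffs α ω) m x) fun x =>
      ∑ m ∈ Finset.range M, z ^ m • (comm (I • sigma3) (coeffMat (posCoeffs α ω) (m + 2) x) +
        comm (matQ ω x) (coeffMat (posCoeffs α ω) (m + 1) x)) :=
  MDeriv.sum _ fun m _ => (posW_mDeriv m).smul _

theorem opJ_posGrad (n : ℕ) (ω : Phase N) (x : ℝ) :
    bOff (opJ (posGrad α n ω) x).2 (opJ (posGrad α n ω) x).1 =
      comm (I • sigma3) (coeffMat (posCoeffs α ω) (2 * n + 3) x) +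
        comm (matQ ω x) (coeffMat (posCoeffs α ω) (2 * n + 2) x) := by
  have h := vSch_posCoeffs (α := α) (ω := ω) n
  have hd := posW_mDeriv (α := α) (ω := ω) (2 * n + 1)
  rw [funext (coeffMat_odd _ n)] at hd
  rw [show opJ (posGrad α n ω) = _ from opJ_mk h.1 h.2]
  exact (mDeriv_bOff h.1.hasDerivAt h.2.hasDerivAt).unique hd x

theorem zeroCurvature_pos_iff (n : ℕ) (ω : ℝ → Phase N) :
    ZeroCurvature ω (posV α n) ↔ IsFlow ω fun η => opJ (posGrad α n η) := by
  refine zeroCurvature_iff fun t z hz => ?_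
  have hV := (posW_mDeriv_sum (α := α) (ω t) z (2 * n + 2)).smul (z⁻¹ ^ (2 * n + 2))
  rw [← funext (posV_eq n (ω t) hz)] at hV
  refine ⟨_, hV, fun x => ?_⟩
  · have h := comm_matU_posSum (α := α) (ω t) hz x (2 * n + 2)
    rw [Finset.sum_sub_distrib, ← comm_sum] at h
    have hA : comm (I • sigma3) (coeffMat (posCoeffs α (ω t)) (2 * n + 2) x) = 0 :=
      comm_sigma_posW_even (n + 1) x
    have e : z⁻¹ ^ (2 * n + 2) * (z⁻¹ * z ^ (2 * n + 2)) = z⁻¹ := by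
      rw [mul_left_comm, ← mul_pow, inv_mul_cancel₀ hz, one_pow, mul_one]
    rw [hA, smul_zero, zero_add] at h
    rw [posV_eq n (ω t) hz, comm_smul, ← smul_sub, ← neg_sub, h, neg_neg, smul_smul, e,
      opJ_posGrad]

/-- Truncations of the negative series satisfy the stationary equation up to the last terms. -/
theorem comm_matU_negSum (ω : Phase N) (z : ℂ) (x : ℝ) (M : ℕ) :
    ∑ m ∈ Finset.range (M + 1), (comm (matU ω z x) (z⁻¹ ^ m • coeffMat (negCoeffs α ω) m x) -
      z⁻¹ ^ m • negDer α ω m x) =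
    z⁻¹ ^ (M + 1) • negDer α ω (M + 1) x +
      z⁻¹ ^ (M + 2) • comm (I • sigma3) (coeffMat (negCoeffs α ω) M x) := by
  induction M with
  | zero =>
    rw [Finset.sum_range_one, comm_smul, comm_matU, negDer, negDer]
    module
  | succ M ih =>
    rw [Finset.sum_range_succ, ih, comm_smul, comm_matU, negDer]
    module

theorem opJ_negGrad {n : ℕ} {ω : Phase N} (hω : ω ∈ negDomain α n) (x : ℝ) :
    bOff (opJ (negGrad α n ω) x).2 (opJ (negGrad α n ω) x).1 = negDer α ω (2 * n + 1) x := by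
  have h := vSmb_negCoeffs hω le_rfl
  have hd := negW_mDeriv hω (m := 2 * n + 1) (by omega)
  rw [funext (coeffMat_odd _ n)] at hd
  rw [show opJ (negGrad α n ω) = _ from opJ_mk h.1 h.2]
  exact (mDeriv_bOff h.1.hasDerivAt h.2.hasDerivAt).unique hd x

theorem zeroCurvature_neg_iff (n : ℕ) (ω : ℝ → Phase N) (hω : ∀ t, ω t ∈ negDomain α n) :
    ZeroCurvature ω (negV α n) ↔ IsFlow ω fun η => -opJ (negGrad α n η) := by
  refine zeroCurvature_iff fun t z hz => ?_
  have hV := (MDeriv.sum (Finset.range (2 * n + 1)) fun m hm => (negW_mDeriv (hω t) (m := m)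
    (by rw [Finset.mem_range] at hm; omega)).smul (z⁻¹ ^ m)).smul (z ^ (2 * n))
  rw [← funext (negV_eq n (ω t) hz)] at hV
  refine ⟨_, hV, fun x => ?_⟩
  · have h := comm_matU_negSum (α := α) (ω t) z x (2 * n)
    rw [Finset.sum_sub_distrib, ← comm_sum] at h
    have hA : comm (I • sigma3) (coeffMat (negCoeffs α (ω t)) (2 * n) x) = 0 := by
      rw [coeffMat_even, comm_sigma_bDiag]
    have e : z ^ (2 * n) * z⁻¹ ^ (2 * n + 1) = z⁻¹ := by
      rw [pow_succ z⁻¹, ← mul_assoc, ← mul_pow, mul_inv_cancel₀ hz, one_pow, one_mul]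
    have hneg : bOff (-(opJ (negGrad α n (ω t)) x).2) (-(opJ (negGrad α n (ω t)) x).1) =
        -bOff (opJ (negGrad α n (ω t)) x).2 (opJ (negGrad α n (ω t)) x).1 := by
      rw [← sub_eq_zero, sub_neg_eq_add, bOff_add, neg_add_cancel, neg_add_cancel, bOff_zero]
    rw [hA, smul_zero, add_zero] at h
    simp only [Pi.neg_apply, Prod.snd_neg, Prod.fst_neg]
    rw [negV_eq n (ω t) hz, comm_smul, ← smul_sub, ← neg_sub, h, hneg, opJ_negGrad (hω t),
      smul_neg, smul_neg, smul_smul, e]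

end ZeroCurvature

/-! ### Formal power series with coefficients in a noncommutative ring -/

section Series

open PowerSeries Finset

variable {R : Type*} [Ring R]

/-- The coefficients of the product of two formal series. -/
def conv (f g : ℕ → R) (m : ℕ) : R := ∑ p ∈ antidiagonal m, f p.1 * g p.2

theorem coeff_mk_mul_mk (f g : ℕ → R) (m : ℕ) :
    coeff m (PowerSeries.mk f * PowerSeries.mk g) = conv f g m := by
  simp only [coeff_mul, coeff_mk, conv]

theorem conv_zero (f g : ℕ → R) : conv f g 0 = f 0 * g 0 := by simp [conv]

/-- The part of the `(k + 1)`-st coefficient of the square of a series which involves neither the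
constant coefficient nor the `(k + 1)`-st one. -/
def convInner (f : ℕ → R) (k : ℕ) : R := ∑ i ∈ range k, f (i + 1) * f (k - i)

theorem conv_succ (f : ℕ → R) (k : ℕ) :
    conv f f (k + 1) = f 0 * f (k + 1) + f (k + 1) * f 0 + convInner f k := by
  rw [conv, Finset.Nat.sum_antidiagonal_eq_sum_range_succ_mk, sum_range_succ, sum_range_succ',
    Nat.sub_self, Nat.sub_zero, convInner]
  simp only [Nat.add_sub_add_right]
  abel

/-- `A + Q X`. -/
def affineSeries (A Q : R) : R⟦X⟧ := C A + C Q * X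

/-- `Q X + A X²`. -/
def quadraticSeries (A Q : R) : R⟦X⟧ := C Q * X + C A * X ^ 2

theorem coeff_zero_affine_mul (A Q : R) (φ : R⟦X⟧) :
    coeff 0 (affineSeries A Q * φ) = A * coeff 0 φ := by
  rw [affineSeries, add_mul, mul_assoc, map_add, coeff_C_mul, coeff_C_mul, coeff_zero_X_mul]
  simp

theorem coeff_zero_mul_affine (A Q : R) (φ : R⟦X⟧) :
    coeff 0 (φ * affineSeries A Q) = coeff 0 φ * A := by
  rw [affineSeries, mul_add, ← mul_assoc, map_add, coeff_mul_C, coeff_zero_mul_X]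
  simp

theorem coeff_succ_affine_mul (A Q : R) (φ : R⟦X⟧) (m : ℕ) :
    coeff (m + 1) (affineSeries A Q * φ) = A * coeff (m + 1) φ + Q * coeff m φ := by
  rw [affineSeries, add_mul, mul_assoc, map_add, coeff_C_mul, coeff_C_mul, coeff_succ_X_mul]

theorem coeff_succ_mul_affine (A Q : R) (φ : R⟦X⟧) (m : ℕ) :
    coeff (m + 1) (φ * affineSeries A Q) = coeff (m + 1) φ * A + coeff m φ * Q := by
  rw [affineSeries, mul_add, ← mul_assoc, map_add, coeff_mul_C, coeff_succ_mul_X, coeff_mul_C]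

theorem quadraticSeries_eq (A Q : R) : quadraticSeries A Q = affineSeries Q A * X := by
  rw [quadraticSeries, affineSeries, add_mul, mul_assoc, sq]

theorem coeff_zero_quadratic_mul (A Q : R) (φ : R⟦X⟧) :
    coeff 0 (quadraticSeries A Q * φ) = 0 := by
  rw [quadraticSeries_eq, mul_assoc, X_mul, ← mul_assoc, coeff_zero_mul_X]

theorem coeff_zero_mul_quadratic (A Q : R) (φ : R⟦X⟧) :
    coeff 0 (φ * quadraticSeries A Q) = 0 := by
  rw [quadraticSeries_eq, ← mul_assoc, coeff_zero_mul_X]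

theorem coeff_one_quadratic_mul (A Q : R) (φ : R⟦X⟧) :
    coeff 1 (quadraticSeries A Q * φ) = Q * coeff 0 φ := by
  rw [quadraticSeries_eq, mul_assoc, X_mul, ← mul_assoc, coeff_succ_mul_X 0, coeff_zero_affine_mul]

theorem coeff_one_mul_quadratic (A Q : R) (φ : R⟦X⟧) :
    coeff 1 (φ * quadraticSeries A Q) = coeff 0 φ * Q := by
  rw [quadraticSeries_eq, ← mul_assoc, coeff_succ_mul_X 0, coeff_zero_mul_affine]

theorem coeff_quadratic_mul (A Q : R) (φ : R⟦X⟧) (m : ℕ) :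
    coeff (m + 2) (quadraticSeries A Q * φ) = A * coeff m φ + Q * coeff (m + 1) φ := by
  rw [quadraticSeries_eq, mul_assoc, X_mul, ← mul_assoc, coeff_succ_mul_X (m + 1),
    coeff_succ_affine_mul, add_comm]

theorem coeff_mul_quadratic (A Q : R) (φ : R⟦X⟧) (m : ℕ) :
    coeff (m + 2) (φ * quadraticSeries A Q) = coeff m φ * A + coeff (m + 1) φ * Q := by
  rw [quadraticSeries_eq, ← mul_assoc, coeff_succ_mul_X (m + 1), coeff_succ_mul_affine, add_comm]

/-- `X² W' = [A + Q X, W]`. -/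
theorem affine_stationary {A Q : R} {w w' : ℕ → R} (h0 : A * w 0 - w 0 * A = 0)
    (h1 : (A * w 1 - w 1 * A) + (Q * w 0 - w 0 * Q) = 0)
    (h : ∀ m, w' m = (A * w (m + 2) - w (m + 2) * A) + (Q * w (m + 1) - w (m + 1) * Q)) :
    X ^ 2 * PowerSeries.mk w' =
      affineSeries A Q * PowerSeries.mk w - PowerSeries.mk w * affineSeries A Q := by
  ext m
  rw [map_sub]
  match m with
  | 0 => rw [coeff_zero_affine_mul, coeff_zero_mul_affine, coeff_X_pow_mul']; simpa using h0.symm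
  | 1 =>
    rw [coeff_succ_affine_mul, coeff_succ_mul_affine, coeff_X_pow_mul', if_neg (by simp)]
    simp only [coeff_mk, zero_add]
    rw [← h1]
    abel
  | m + 2 =>
    rw [coeff_X_pow_mul, coeff_succ_affine_mul, coeff_succ_mul_affine]
    simp only [coeff_mk]
    rw [h]
    abel

/-- `W' = [Q X + A X², W]`. -/
theorem quadratic_stationary {A Q : R} {w w' : ℕ → R} (h0 : w' 0 = 0)
    (h1 : w' 1 = Q * w 0 - w 0 * Q)
    (h : ∀ m, w' (m + 2) = (A * w m - w m * A) + (Q * w (m + 1) - w (m + 1) * Q)) :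
    PowerSeries.mk w' =
      quadraticSeries A Q * PowerSeries.mk w - PowerSeries.mk w * quadraticSeries A Q := by
  ext m
  rw [map_sub]
  match m with
  | 0 => rw [coeff_zero_quadratic_mul, coeff_zero_mul_quadratic, coeff_mk, h0, sub_zero]
  | 1 => rw [coeff_one_quadratic_mul, coeff_one_mul_quadratic, coeff_mk, coeff_mk, h1]
  | m + 2 =>
    rw [coeff_quadratic_mul, coeff_mul_quadratic]
    simp only [coeff_mk]
    rw [h]
    abel

/-- The square of a solution of the stationary equation is again a solution. -/
theorem conv_affine_stationary {A Q : R} {w w' : ℕ → R} (h0 : A * w 0 - w 0 * A = 0)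
    (h1 : (A * w 1 - w 1 * A) + (Q * w 0 - w 0 * Q) = 0)
    (h : ∀ m, w' m = (A * w (m + 2) - w (m + 2) * A) + (Q * w (m + 1) - w (m + 1) * Q)) (m : ℕ) :
    conv w' w m + conv w w' m =
      (A * conv w w (m + 2) - conv w w (m + 2) * A) +
        (Q * conv w w (m + 1) - conv w w (m + 1) * Q) := by
  have hs := affine_stationary h0 h1 h
  have hm : X ^ 2 * (PowerSeries.mk w' * PowerSeries.mk w + PowerSeries.mk w * PowerSeries.mk w') =
      affineSeries A Q * (PowerSeries.mk w * PowerSeries.mk w) -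
        (PowerSeries.mk w * PowerSeries.mk w) * affineSeries A Q := by
    rw [mul_add, ← mul_assoc, ← mul_assoc, X_pow_mul (φ := PowerSeries.mk w), mul_assoc _ (X ^ 2),
      hs]
    noncomm_ring
  have := congrArg (coeff (m + 2)) hm
  rw [coeff_X_pow_mul, map_add, map_sub, coeff_succ_affine_mul, coeff_succ_mul_affine] at this
  simp only [coeff_mk_mul_mk] at this
  rw [this]
  abel

theorem conv_quadratic_stationary {A Q : R} {w w' : ℕ → R} (h0 : w' 0 = 0)
    (h1 : w' 1 = Q * w 0 - w 0 * Q)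
    (h : ∀ m, w' (m + 2) = (A * w m - w m * A) + (Q * w (m + 1) - w (m + 1) * Q)) :
    conv w' w 1 + conv w w' 1 = Q * conv w w 0 - conv w w 0 * Q ∧
    ∀ m, conv w' w (m + 2) + conv w w' (m + 2) =
      (A * conv w w m - conv w w m * A) +
        (Q * conv w w (m + 1) - conv w w (m + 1) * Q) := by
  have hs := quadratic_stationary h0 h1 h
  have hm : PowerSeries.mk w' * PowerSeries.mk w + PowerSeries.mk w * PowerSeries.mk w' =
      quadraticSeries A Q * (PowerSeries.mk w * PowerSeries.mk w) -
        (PowerSeries.mk w * PowerSeries.mk w) * quadraticSeries A Q := by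
    rw [hs]
    noncomm_ring
  constructor
  · have := congrArg (coeff 1) hm
    rw [map_add, map_sub, coeff_one_quadratic_mul, coeff_one_mul_quadratic] at this
    simpa only [coeff_mk_mul_mk] using this
  · intro m
    have := congrArg (coeff (m + 2)) hm
    rw [map_add, map_sub, coeff_quadratic_mul, coeff_mul_quadratic] at this
    simp only [coeff_mk_mul_mk] at this
    rw [this]
    abel

end Series

/-! ### Mean solutions in block form -/

section MeanBlocks

theorem IsMeanSol.smul {n : Type*} [Fintype n] {s : ℂ} {X F E : ℝ → Matrix n n ℂ}
    (h : IsMeanSol s X F E) (c : ℂ) : IsMeanSol s X (fun x => c • F x) fun x => c • E x := by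
  obtain ⟨D₁, D₂, h1, h2, hE⟩ := h
  have key : ∀ {D : ℝ → Matrix n n ℂ}, MDeriv D (fun x => F x + s • (X x * D x - D x * X x)) →
      MDeriv (fun x => c • D x)
        fun x => c • F x + s • (X x * (c • D x) - (c • D x) * X x) := fun hD =>
    (hD.smul c).congr fun x => by
      simp only [Matrix.mul_smul, Matrix.smul_mul]
      module
  have h0 : ∀ {D : ℝ → Matrix n n ℂ} {l : Filter ℝ}, Tendsto D l (𝓝 0) →
      Tendsto (fun x => c • D x) l (𝓝 0) := fun hD => by
    have := hD.const_smul c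
    rwa [smul_zero] at this
  refine ⟨_, _, ⟨key h1.1, h0 h1.2.1, h1.2.2.smul c⟩, ⟨key h2.1, h0 h2.2.1, h2.2.2.smul c⟩,
    fun x => ?_⟩
  simp only [hE]
  module

/-- The mean primitive is the mean of the primitives vanishing at the ends. -/
theorem invD_mean {f : ℝ → ℂ} (hf : Sch f) :
    (∀ c x, HasDerivAt (fun y => invD f y + c) (f x) x) ∧
      Tendsto (fun x => invD f x + (1 / 2) * ∫ y, f y) atBot (𝓝 0) ∧
      Tendsto (fun x => invD f x + -((1 / 2) * ∫ y, f y)) atTop (𝓝 0) := by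
  refine ⟨fun c x => (invD_hasDerivAt hf.integrable hf.continuous x).add_const c, ?_, ?_⟩
  · simpa using (invD_tendsto_atBot hf.integrable).add_const ((1 / 2) * ∫ y, f y)
  · simpa using (invD_tendsto_atTop hf.integrable).add_const (-((1 / 2) * ∫ y, f y))

variable {N : ℕ}

theorem isMeanSol_invDMat {F : ℝ → Matrix (Fin N) (Fin N) ℂ} (hF : MSch F) :
    IsMeanSol 0 (fun _ => 0) F (invDMat F) := by
  refine ⟨fun x => of fun i j => invD (fun y => F y i j) x + (1 / 2) * ∫ y, F y i j,
    fun x => of fun i j => invD (fun y => F y i j) x + -((1 / 2) * ∫ y, F y i j),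
    ⟨MDeriv.congr (D' := F) (fun x i j => (invD_mean (hF i j)).1 _ x) fun x => by simp,
      tendsto_matrix_zero.2 fun i j => (invD_mean (hF i j)).2.1,
      fun i j => (hF i j).invD.add (Cls.const _)⟩,
    ⟨MDeriv.congr (D' := F) (fun x i j => (invD_mean (hF i j)).1 _ x) fun x => by simp,
      tendsto_matrix_zero.2 fun i j => (invD_mean (hF i j)).2.2,
      fun i j => (hF i j).invD.add (Cls.const _)⟩, fun x => ?_⟩
  ext i j
  simp only [invDMat, of_apply, Matrix.smul_apply, Matrix.add_apply, smul_eq_mul]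
  ring

theorem bDiag_mul (a a' : ℂ) (d d' : Matrix (Fin N) (Fin N) ℂ) :
    bDiag a d * bDiag a' d' = bDiag (a * a') (d * d') := by
  simp only [bDiag, fromBlocks_multiply]
  ext i j
  rcases i with i | i <;> rcases j with j | j <;> simp [Matrix.mul_apply]

theorem bDiag_add (a a' : ℂ) (d d' : Matrix (Fin N) (Fin N) ℂ) :
    bDiag a d + bDiag a' d' = bDiag (a + a') (d + d') := by
  ext i j
  rcases i with i | i <;> rcases j with j | j <;> simp [bDiag]

theorem bDiag_sub (a a' : ℂ) (d d' : Matrix (Fin N) (Fin N) ℂ) :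
    bDiag a d - bDiag a' d' = bDiag (a - a') (d - d') := by
  ext i j
  rcases i with i | i <;> rcases j with j | j <;> simp [bDiag]

theorem smul_bDiag (c a : ℂ) (d : Matrix (Fin N) (Fin N) ℂ) :
    c • bDiag a d = bDiag (c * a) (c • d) := by
  ext i j
  rcases i with i | i <;> rcases j with j | j <;> simp [bDiag]

/-- A scalar mean primitive and a mean solution together form a mean solution for block diagonal
matrices: the scalar block of a commutator vanishes. -/
theorem isMeanSol_bDiag {s : ℂ} {X F d : ℝ → Matrix (Fin N) (Fin N) ℂ} {f : ℝ → ℂ} (y : ℝ → ℂ)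
    (hf : Sch f) (hd : IsMeanSol s X F d) :
    IsMeanSol s (fun x => bDiag (y x) (X x)) (fun x => bDiag (f x) (F x))
      fun x => bDiag (invD f x) (d x) := by
  obtain ⟨D₁, D₂, h1, h2, hE⟩ := hd
  have key : ∀ (c : ℂ) {D : ℝ → Matrix (Fin N) (Fin N) ℂ},
      MDeriv D (fun x => F x + s • (X x * D x - D x * X x)) →
      MDeriv (fun x => bDiag (invD f x + c) (D x)) fun x => bDiag (f x) (F x) +
        s • (bDiag (y x) (X x) * bDiag (invD f x + c) (D x) -
          bDiag (invD f x + c) (D x) * bDiag (y x) (X x)) := fun c D hD =>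
    (mDeriv_bDiag ((invD_mean hf).1 c) hD).congr fun x => by
      rw [bDiag_mul, bDiag_mul, bDiag_sub, smul_bDiag, bDiag_add]
      congr 1
      ring
  have h0 : ∀ {l : Filter ℝ} {a : ℝ → ℂ} {D : ℝ → Matrix (Fin N) (Fin N) ℂ},
      Tendsto a l (𝓝 0) → Tendsto D l (𝓝 0) →
      Tendsto (fun x => bDiag (a x) (D x)) l (𝓝 0) := fun {l a D} ha hD => by
    refine tendsto_matrix_zero.2 fun i j => ?_
    rcases i with i | i <;> rcases j with j | j
    · exact ha
    · exact tendsto_const_nhds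
    · exact tendsto_const_nhds
    · exact tendsto_matrix_zero.1 hD i j
  refine ⟨_, _, ⟨key _ h1.1, h0 (invD_mean hf).2.1 h1.2.1,
      mCls_bDiag.2 ⟨hf.invD.add (Cls.const _), h1.2.2⟩⟩,
    ⟨key _ h2.1, h0 (invD_mean hf).2.2 h2.2.1,
      mCls_bDiag.2 ⟨hf.invD.add (Cls.const _), h2.2.2⟩⟩, fun x => ?_⟩
  rw [bDiag_add, smul_bDiag, ← hE]
  change bDiag _ _ = bDiag _ _
  congr 1
  ring

end MeanBlocks

/-! ### The square of the series `W` -/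

section Square

variable {N : ℕ} {α : ℂ} {ω : Phase N} {n : ℕ}

theorem mDeriv_conv {w w' v v' : ℕ → ℝ → BMat N} (m : ℕ) (h : ∀ k ≤ m, MDeriv (w k) (w' k))
    (h' : ∀ k ≤ m, MDeriv (v k) (v' k)) :
    MDeriv (fun x => conv (fun k => w k x) (fun k => v k x) m) fun x =>
      conv (fun k => w' k x) (fun k => v k x) m + conv (fun k => w k x) (fun k => v' k x) m := by
  refine (MDeriv.sum _ fun p hp => (h p.1 ?_).mul (h' p.2 ?_)).congr fun x => ?_
  · have := Finset.HasAntidiagonal.mem_antidiagonal.1 hp; omega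
  · have := Finset.HasAntidiagonal.mem_antidiagonal.1 hp; omega
  · exact Finset.sum_add_distrib

theorem mSch_convInner {w : ℕ → ℝ → BMat N} (k : ℕ) (h : ∀ i, 1 ≤ i → i ≤ k → MSch (w i)) :
    MSch fun x => convInner (fun i => w i x) k := by
  refine MCls.sum _ fun i hi => ?_
  rw [Finset.mem_range] at hi
  exact (h _ (by omega) (by omega)).mul (h _ (by omega) (by omega)).smb

theorem sigma3_mul_self : (sigma3 : BMat N) * sigma3 = 1 := by
  simp [sigma3, fromBlocks_multiply]

theorem sigma3_mul_bDiag (a : ℂ) (d : Matrix (Fin N) (Fin N) ℂ) :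
    sigma3 * bDiag a d = bDiag a d * sigma3 := by
  simp [sigma3, bDiag, fromBlocks_multiply]

theorem sigma3_mul_bOff (c b : Vec N) : sigma3 * bOff c b = -(bOff c b * sigma3) := by
  simp [sigma3, bOff, fromBlocks_multiply, fromBlocks_neg]

theorem sigma3_mul_matQ (ω : Phase N) (x : ℝ) : sigma3 * matQ ω x = -(matQ ω x * sigma3) :=
  sigma3_mul_bOff _ _

theorem sigma3_mul_coeffMat (w : ℕ → Coeffs N) (m : ℕ) (x : ℝ) :
    sigma3 * coeffMat w m x = (-1 : ℂ) ^ m • (coeffMat w m x * sigma3) := by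
  obtain ⟨j, rfl | rfl⟩ := Nat.even_or_odd' m
  · rw [coeffMat_even, sigma3_mul_bDiag, pow_mul, neg_one_sq, one_pow, one_smul]
  · rw [coeffMat_odd, sigma3_mul_bOff, pow_succ, pow_mul, neg_one_sq, one_pow, one_mul,
      neg_one_smul]

theorem sigma3_mul_conv (w : ℕ → Coeffs N) (m : ℕ) (x : ℝ) :
    sigma3 * conv (fun k => coeffMat w k x) (fun k => coeffMat w k x) m =
      (-1 : ℂ) ^ m • (conv (fun k => coeffMat w k x) (fun k => coeffMat w k x) m * sigma3) := by
  rw [conv, Finset.mul_sum, Finset.sum_mul, Finset.smul_sum]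
  refine Finset.sum_congr rfl fun p hp => ?_
  rw [← Finset.HasAntidiagonal.mem_antidiagonal.1 hp, ← mul_assoc, sigma3_mul_coeffMat, Matrix.smul_mul, mul_assoc,
    sigma3_mul_coeffMat, Matrix.mul_smul, smul_smul, ← pow_add, mul_assoc]

theorem neg_one_pow_even (j : ℕ) : (-1 : ℂ) ^ (2 * j) = 1 := by
  rw [pow_mul, neg_one_sq, one_pow]

theorem neg_one_pow_odd (j : ℕ) : (-1 : ℂ) ^ (2 * j + 1) = -1 := by
  rw [pow_succ, neg_one_pow_even, one_mul]

/-- On matrices which anticommute with `σ₃` the commutator with `i σ₃` is injective. -/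
theorem comm_sigma_of_anti {A : BMat N} (h : sigma3 * A = -(A * sigma3)) :
    comm (I • sigma3) A = (2 * I) • (sigma3 * A) := by
  rw [smul_comm_left, comm, ← neg_eq_iff_eq_neg.2 h, sub_neg_eq_add]
  module

theorem comm_sigma_of_commute {A : BMat N} (h : sigma3 * A = A * sigma3) :
    comm (I • sigma3) A = 0 := by
  rw [smul_comm_left, comm, h, sub_self, smul_zero]

/-- Elimination of the off-diagonal coefficient `M` between two consecutive stationary equations
gives the transport equation with `Y = -σ₃ Q²` for the block diagonal coefficient `e`. -/
theorem comm_matQ_of_eliminate {S Q e M : BMat N} (hS : S * S = 1) (hQ : S * Q = -(Q * S))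
    (he : S * e = e * S) (hM : (2 * I) • (S * M) + comm Q e = 0) :
    comm Q M = (I / 2) • (-(S * (Q * Q)) * e - e * -(S * (Q * Q))) := by
  have h1 : M = (I / 2) • (S * comm Q e) := by
    have h2 : comm Q e = -(2 * I) • (S * M) := by
      rw [neg_smul]
      exact eq_neg_of_add_eq_zero_right hM
    rw [h2, Matrix.mul_smul, ← mul_assoc, hS, one_mul, smul_smul,
      show I / 2 * -(2 * I) = -(I * I) by ring, Complex.I_mul_I, neg_neg, one_smul]
  have h3 : Q * (S * comm Q e) = -(S * (Q * comm Q e)) := by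
    rw [← mul_assoc, ← mul_assoc S, hQ, neg_mul, neg_neg]
  rw [h1, comm, Matrix.mul_smul, Matrix.smul_mul, ← smul_sub, h3]
  congr 1
  have h4 : e * (S * (Q * Q)) = S * (e * (Q * Q)) := by rw [← mul_assoc, ← he, mul_assoc]
  rw [mul_neg, h4, comm]
  noncomm_ring

theorem neg_sigma3_mul_matQ_sq (ω : Phase N) (x : ℝ) :
    -(sigma3 * (matQ ω x * matQ ω x)) = bDiag (-(rOf ω x ⬝ᵥ qOf ω x)) (qrT ω x) := by
  rw [matQ_eq]
  simp only [bOff, sigma3, bDiag, fromBlocks_multiply, fromBlocks_neg, qrT]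
  ext i j
  rcases i with i | i <;> rcases j with j | j <;>
    simp [Matrix.mul_apply, dotProduct, vecMulVec_apply]

theorem posW_zero (x : ℝ) : coeffMat (posCoeffs α ω) 0 x = (I * α) • sigma3 := by
  rw [coeffMat_zero, sigma3, fromBlocks_smul]
  ext i j
  rcases i with i | i <;> rcases j with j | j <;>
    simp [bDiag, posCoeffs, Matrix.one_apply]

theorem negW_zero (x : ℝ) : coeffMat (negCoeffs α ω) 0 x = (α / 2) • sigma3 := by
  rw [coeffMat_zero, sigma3, fromBlocks_smul]
  ext i j
  rcases i with i | i <;> rcases j with j | j <;>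
    simp [bDiag, negCoeffs, Matrix.one_apply]

/-- Even coefficients of the square when the constant coefficient is `κ σ₃`. -/
theorem conv_even {w : ℕ → Coeffs N} {κ : ℂ} {x : ℝ} (h0 : coeffMat w 0 x = κ • sigma3) (j : ℕ) :
    conv (fun k => coeffMat w k x) (fun k => coeffMat w k x) (2 * (j + 1)) =
      ((2 * κ) • sigma3) * coeffMat w (2 * (j + 1)) x +
        convInner (fun k => coeffMat w k x) (2 * j + 1) := by
  have h := sigma3_mul_coeffMat w (2 * (j + 1)) x
  rw [neg_one_pow_even, one_smul] at h
  have h2 := conv_succ (fun k => coeffMat w k x) (2 * j + 1)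
  rw [show 2 * j + 1 + 1 = 2 * (j + 1) by ring] at h2
  simp only [h0] at h2
  rw [h2, Matrix.mul_smul, ← h, ← Matrix.smul_mul, ← add_mul]
  congr 2
  module

/-- Odd coefficients of the square when the constant coefficient is `κ σ₃`. -/
theorem conv_odd {w : ℕ → Coeffs N} {κ : ℂ} {x : ℝ} (h0 : coeffMat w 0 x = κ • sigma3) (j : ℕ) :
    conv (fun k => coeffMat w k x) (fun k => coeffMat w k x) (2 * j + 1) =
      convInner (fun k => coeffMat w k x) (2 * j) := by
  have h := sigma3_mul_coeffMat w (2 * j + 1) x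
  rw [neg_one_pow_odd, neg_one_smul] at h
  have h2 := conv_succ (fun k => coeffMat w k x) (2 * j)
  simp only [h0] at h2
  rw [h2, Matrix.mul_smul, Matrix.smul_mul, h, smul_neg, neg_add_cancel, zero_add]

/-- Where an even coefficient of the square vanishes, the corresponding coefficient of `W` is
determined algebraically by the lower ones. -/
theorem coeffMat_even_of_conv {w : ℕ → Coeffs N} {κ : ℂ} {x : ℝ} (hκ : κ ≠ 0)
    (h0 : coeffMat w 0 x = κ • sigma3) (j : ℕ)
    (h : conv (fun k => coeffMat w k x) (fun k => coeffMat w k x) (2 * (j + 1)) = 0) :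
    coeffMat w (2 * (j + 1)) x =
      (-(2 * κ)⁻¹ • sigma3) * convInner (fun k => coeffMat w k x) (2 * j + 1) := by
  rw [conv_even h0, add_comm] at h
  rw [eq_neg_of_add_eq_zero_left h, mul_neg, neg_smul, Matrix.neg_mul, neg_neg, ← mul_assoc,
    Matrix.smul_mul, Matrix.mul_smul, smul_smul, sigma3_mul_self,
    inv_mul_cancel₀ (mul_ne_zero two_ne_zero hκ), one_smul, one_mul]

theorem mSch_coeffMat_even {w : ℕ → Coeffs N} {κ : ℂ} (hκ : κ ≠ 0)
    (h0 : ∀ x, coeffMat w 0 x = κ • sigma3) (j : ℕ)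
    (h : ∀ x, conv (fun k => coeffMat w k x) (fun k => coeffMat w k x) (2 * (j + 1)) = 0)
    (hs : ∀ i, 1 ≤ i → i ≤ 2 * j + 1 → MSch (coeffMat w i)) :
    MSch (coeffMat w (2 * (j + 1))) := by
  rw [funext fun x => coeffMat_even_of_conv hκ (h0 x) j (h x)]
  exact MCls.mul' (MCls.const _) (mSch_convInner _ hs)

/-- The even coefficients of the square vanish once they are known to solve the homogeneous transport
equation: up to rapidly decreasing terms they are `2 κ σ₃` times a mean solution. -/
theorem conv_even_eq_zero {w : ℕ → Coeffs N} {κ s : ℂ} {X F : ℝ → BMat N}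
    (h0 : ∀ x, coeffMat w 0 x = κ • sigma3) (j : ℕ)
    (hs : ∀ i, 1 ≤ i → i ≤ 2 * j + 1 → MSch (coeffMat w i)) (hX : MSch X)
    (hS : ∀ x, sigma3 * X x = X x * sigma3)
    (hw : IsMeanSol s X F (coeffMat w (2 * (j + 1))))
    (he : MDeriv (fun x => conv (fun k => coeffMat w k x) (fun k => coeffMat w k x) (2 * (j + 1)))
      fun x => s • (X x * conv (fun k => coeffMat w k x) (fun k => coeffMat w k x) (2 * (j + 1)) -
        conv (fun k => coeffMat w k x) (fun k => coeffMat w k x) (2 * (j + 1)) * X x)) (x : ℝ) :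
    conv (fun k => coeffMat w k x) (fun k => coeffMat w k x) (2 * (j + 1)) = 0 := by
  have e : ∀ x, conv (fun k => coeffMat w k x) (fun k => coeffMat w k x) (2 * (j + 1)) -
      ((2 * κ) • sigma3) * coeffMat w (2 * (j + 1)) x =
        convInner (fun k => coeffMat w k x) (2 * j + 1) := fun x => by
    rw [conv_even (h0 x), add_sub_cancel_left]
  have hi := mSch_convInner (w := coeffMat w) _ hs
  refine hw.eq_zero (S := (2 * κ) • sigma3)
    (e := fun x => conv (fun k => coeffMat w k x) (fun k => coeffMat w k x) (2 * (j + 1))) hX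
    (fun x => ?_) he ?_ ?_ x
  · rw [Matrix.smul_mul, hS, Matrix.mul_smul]
  · rw [funext e]
    exact hi.tendsto_zero (Or.inl rfl)
  · rw [funext e]
    exact hi.tendsto_zero (Or.inr rfl)

/-- The mean solutions `a` and `d` of the recursion in one block diagonal equation. -/
theorem posW_isMeanSol (j : ℕ) : ∃ F, IsMeanSol (I / 2)
    (fun x => -(sigma3 * (matQ ω x * matQ ω x))) F (coeffMat (posCoeffs α ω) (2 * (j + 1))) := by
  obtain ⟨hc, hb⟩ := vSch_posCoeffs (α := α) (ω := ω) j
  have hf := (sch_meanS_integrand (ω := ω) hc.deriv hb.deriv).const_mul (I / 2)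
  have h := isMeanSol_bDiag (fun x => -(rOf ω x ⬝ᵥ qOf ω x)) hf
    ((meanE_isMeanSol (ω := ω) hc.deriv hb.deriv).smul (-(I / 2)))
  rw [funext (neg_sigma3_mul_matQ_sq ω), funext (coeffMat_even _ (j + 1))]
  simp only [invD_const_mul] at h
  exact ⟨_, h⟩

theorem comm_sigma_posW_zero (x : ℝ) :
    comm (I • sigma3) (coeffMat (posCoeffs α ω) 0 x) = 0 := by
  rw [coeffMat_zero, comm_sigma_bDiag]

theorem mDeriv_conv_pos (m : ℕ) :
    MDeriv (fun x => conv (fun k => coeffMat (posCoeffs α ω) k x)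
      (fun k => coeffMat (posCoeffs α ω) k x) m) fun x =>
      comm (I • sigma3) (conv (fun k => coeffMat (posCoeffs α ω) k x)
        (fun k => coeffMat (posCoeffs α ω) k x) (m + 2)) +
      comm (matQ ω x) (conv (fun k => coeffMat (posCoeffs α ω) k x)
        (fun k => coeffMat (posCoeffs α ω) k x) (m + 1)) := by
  refine (mDeriv_conv m (fun k _ => posW_mDeriv k) fun k _ => posW_mDeriv k).congr fun x => ?_
  exact conv_affine_stationary (A := I • sigma3) (Q := matQ ω x)
    (w := fun k => coeffMat (posCoeffs α ω) k x)
    (w' := fun k => comm (I • sigma3) (coeffMat (posCoeffs α ω) (k + 2) x) +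
      comm (matQ ω x) (coeffMat (posCoeffs α ω) (k + 1) x))
    (comm_sigma_posW_zero x) (posW_initial x) (fun k => rfl) m

theorem mSch_posW_odd (j : ℕ) : MSch (coeffMat (posCoeffs α ω) (2 * j + 1)) := by
  rw [funext (coeffMat_odd _ j)]
  exact mCls_bOff.2 (vSch_posCoeffs j)

/-- `W² = -α²` for the positive hierarchy, and all coefficients of `W` but the constant one are
rapidly decreasing. -/
theorem posW_square (hα : α ≠ 0) (j : ℕ) : ∀ m, 1 ≤ m → m ≤ 2 * j + 1 →
    (∀ x, conv (fun k => coeffMat (posCoeffs α ω) k x)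
      (fun k => coeffMat (posCoeffs α ω) k x) m = 0) ∧
    MSch (coeffMat (posCoeffs α ω) m) := by
  induction j with
  | zero =>
    intro m h1 h2
    obtain rfl : m = 2 * 0 + 1 := by omega
    refine ⟨fun x => ?_, mSch_posW_odd 0⟩
    rw [conv_odd (posW_zero x), convInner, mul_zero, Finset.sum_range_zero]
  | succ j ih =>
    have hIα : I * α ≠ 0 := mul_ne_zero I_ne_zero hα
    -- the odd row above the last coefficient known to vanish
    have hrel : ∀ x, (2 * I) • (sigma3 * conv (fun k => coeffMat (posCoeffs α ω) k x)
        (fun k => coeffMat (posCoeffs α ω) k x) (2 * (j + 1) + 1)) +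
        comm (matQ ω x) (conv (fun k => coeffMat (posCoeffs α ω) k x)
          (fun k => coeffMat (posCoeffs α ω) k x) (2 * (j + 1))) = 0 := fun x => by
      have h := mDeriv_conv_pos (α := α) (ω := ω) (2 * j + 1)
      rw [funext (ih (2 * j + 1) (by omega) le_rfl).1] at h
      have h' := h.unique (MDeriv.const 0) x
      have ho := sigma3_mul_conv (posCoeffs α ω) (2 * (j + 1) + 1) x
      rw [neg_one_pow_odd, neg_one_smul] at ho
      rw [← comm_sigma_of_anti ho]
      exact h'
    have hX : MSch fun x => -(sigma3 * (matQ ω x * matQ ω x)) :=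
      (MCls.mul' (MCls.const _) ((mSch_matQ ω).mul (mSch_matQ ω).smb)).neg
    obtain ⟨F, hF⟩ := posW_isMeanSol (α := α) (ω := ω) j
    have he : ∀ x, conv (fun k => coeffMat (posCoeffs α ω) k x)
        (fun k => coeffMat (posCoeffs α ω) k x) (2 * (j + 1)) = 0 := by
      refine conv_even_eq_zero posW_zero j (fun i h1 h2 => (ih i h1 h2).2) hX (fun x => ?_) hF
        ((mDeriv_conv_pos (2 * (j + 1))).congr fun x => ?_)
      · rw [neg_sigma3_mul_matQ_sq, sigma3_mul_bDiag]
      · have h2 := sigma3_mul_conv (posCoeffs α ω) (2 * (j + 1)) x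
        have h4 := sigma3_mul_conv (posCoeffs α ω) (2 * (j + 2)) x
        rw [neg_one_pow_even, one_smul] at h2 h4
        have e4 : 2 * (j + 1) + 2 = 2 * (j + 2) := by ring
        rw [e4, comm_sigma_of_commute h4, zero_add]
        exact comm_matQ_of_eliminate sigma3_mul_self (sigma3_mul_matQ ω x) h2 (hrel x)
    have ho : ∀ x, conv (fun k => coeffMat (posCoeffs α ω) k x)
        (fun k => coeffMat (posCoeffs α ω) k x) (2 * (j + 1) + 1) = 0 := fun x => by
      have h := hrel x
      rw [he x, comm_zero, add_zero, smul_eq_zero_iff_right (by simp)] at h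
      rw [← one_mul (conv _ _ _), ← sigma3_mul_self, mul_assoc, h, mul_zero]
    intro m h1 h2
    have hm : m ≤ 2 * j + 1 ∨ m = 2 * (j + 1) ∨ m = 2 * (j + 1) + 1 := by omega
    rcases hm with hm | rfl | rfl
    · exact ih m h1 hm
    · exact ⟨he, mSch_coeffMat_even hIα posW_zero j he fun i h1 h2 => (ih i h1 h2).2⟩
    · exact ⟨ho, mSch_posW_odd (j + 1)⟩

theorem negW_isMeanSol (h : ω ∈ negDomain α n) {j : ℕ} (hj : j ≤ n) : ∃ F, IsMeanSol 0
    (fun _ => 0) F (coeffMat (negCoeffs α ω) (2 * (j + 1))) := by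
  obtain ⟨hc, hb⟩ := vSmb_negCoeffs h hj
  have h := isMeanSol_bDiag (fun _ => 0) (sch_negA' (ω := ω) hc hb)
    (isMeanSol_invDMat (mSch_negD' (ω := ω) hc hb))
  rw [funext (coeffMat_even _ (j + 1))]
  simp only [bDiag_zero] at h
  exact ⟨_, h⟩

theorem mSch_negW_odd (h : ω ∈ negDomain α n) {j : ℕ} (hj : j < n) :
    MSch (coeffMat (negCoeffs α ω) (2 * j + 1)) := by
  rw [funext (coeffMat_odd _ j)]
  exact mCls_bOff.2 (vSch_negCoeffs h hj)

/-- If the coefficients of the square below the `m`-th vanish (but for the constant one), then the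
`m`-th one does not depend on `x`. -/
theorem mDeriv_conv_neg (h : ω ∈ negDomain α n) {m : ℕ} (hm : m ≤ 2 * n + 2)
    (h0 : ∀ k, 1 ≤ k → k < m → ∀ x, conv (fun k => coeffMat (negCoeffs α ω) k x)
      (fun k => coeffMat (negCoeffs α ω) k x) k = 0) :
    MDeriv (fun x => conv (fun k => coeffMat (negCoeffs α ω) k x)
      (fun k => coeffMat (negCoeffs α ω) k x) m) fun _ => 0 := by
  have hcomm : ∀ (A : BMat N) x, comm A (conv (fun k => coeffMat (negCoeffs α ω) k x)
      (fun k => coeffMat (negCoeffs α ω) k x) 0) = 0 := fun A x => by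
    rw [conv_zero, negW_zero, Matrix.smul_mul, Matrix.mul_smul, sigma3_mul_self, smul_smul,
      comm_smul]
    simp [comm]
  refine (mDeriv_conv m (fun k hk => negW_mDeriv h (hk.trans hm)) fun k hk =>
    negW_mDeriv h (hk.trans hm)).congr fun x => ?_
  have hs := conv_quadratic_stationary (A := I • sigma3) (Q := matQ ω x)
    (w := fun k => coeffMat (negCoeffs α ω) k x) (w' := fun k => negDer α ω k x) rfl rfl
    fun k => rfl
  match m with
  | 0 => simp [conv, negDer]
  | 1 => exact hs.1.trans (hcomm _ x)
  | m + 2 =>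
    refine (hs.2 m).trans ?_
    rw [h0 (m + 1) (by omega) (by omega) x]
    rcases Nat.eq_zero_or_pos m with rfl | hm0
    · change comm _ _ + _ = 0
      rw [hcomm]
      simp
    · rw [h0 m hm0 (by omega) x]
      simp

/-- `W² = α² / 4` for the negative hierarchy, as far as its coefficients are defined. -/
theorem negW_square (hα : α ≠ 0) (h : ω ∈ negDomain α n) (m : ℕ) : 1 ≤ m → m ≤ 2 * n + 1 →
    (∀ x, conv (fun k => coeffMat (negCoeffs α ω) k x)
      (fun k => coeffMat (negCoeffs α ω) k x) m = 0) ∧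
    (m ≤ 2 * n → MSch (coeffMat (negCoeffs α ω) m)) := by
  have hκ : α / 2 ≠ 0 := div_ne_zero hα two_ne_zero
  induction m using Nat.strong_induction_on with
  | _ m ih =>
  intro h1 h2
  have hd := mDeriv_conv_neg h (m := m) (by omega) fun k hk1 hk2 => (ih k hk2 hk1 (by omega)).1
  obtain ⟨j, rfl | rfl⟩ := Nat.even_or_odd' m
  · obtain ⟨j, rfl⟩ : ∃ i, j = i + 1 := ⟨j - 1, by omega⟩
    have hs : ∀ i, 1 ≤ i → i ≤ 2 * j + 1 → MSch (coeffMat (negCoeffs α ω) i) :=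
      fun i h1 h2 => (ih i (by omega) h1 (by omega)).2 (by omega)
    obtain ⟨F, hF⟩ := negW_isMeanSol h (j := j) (by omega)
    have he := conv_even_eq_zero negW_zero j hs MCls.zero (fun x => by simp) hF
      (hd.congr fun x => by simp)
    exact ⟨he, fun _ => mSch_coeffMat_even hκ negW_zero j he hs⟩
  · refine ⟨fun x => ?_, fun hm => mSch_negW_odd h (by omega)⟩
    have hi : MSch fun x => conv (fun k => coeffMat (negCoeffs α ω) k x)
        (fun k => coeffMat (negCoeffs α ω) k x) (2 * j + 1) := by
      rw [funext fun x => conv_odd (negW_zero x) j]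
      exact mSch_convInner _ fun i h1 h2 => (ih i (by omega) h1 (by omega)).2 (by omega)
    refine tendsto_nhds_unique (tendsto_const_nhds.congr fun y => ?_)
      (hi.tendsto_zero (Or.inr rfl))
    exact hd.eq_const x y

end Square

/-! ### The trace identity -/

section TraceIdentity

open PowerSeries

/-- Euler's derivation `X d/dX` on sequences of coefficients. -/
def euler {n : Type*} (w : ℕ → Matrix n n ℂ) (k : ℕ) : Matrix n n ℂ := (k : ℂ) • w k

theorem euler_apply {n : Type*} (w : ℕ → Matrix n n ℂ) (k : ℕ) : euler w k = (k : ℂ) • w k := rfl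

variable {n : Type*} [Fintype n] [DecidableEq n]

/-- The trace of the `M`-th coefficient. -/
def coeffTrace (M : ℕ) (φ : (Matrix n n ℂ)⟦X⟧) : ℂ := (coeff M φ).trace

theorem coeffTrace_add (M : ℕ) (φ ψ : (Matrix n n ℂ)⟦X⟧) :
    coeffTrace M (φ + ψ) = coeffTrace M φ + coeffTrace M ψ := by
  simp [coeffTrace]

theorem coeffTrace_sub (M : ℕ) (φ ψ : (Matrix n n ℂ)⟦X⟧) :
    coeffTrace M (φ - ψ) = coeffTrace M φ - coeffTrace M ψ := by
  simp [coeffTrace]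

theorem coeffTrace_smul (M : ℕ) (c : ℂ) (φ : (Matrix n n ℂ)⟦X⟧) :
    coeffTrace M (c • φ) = c * coeffTrace M φ := by
  simp [coeffTrace, Matrix.trace_smul]

theorem coeffTrace_mul_comm (M : ℕ) (φ ψ : (Matrix n n ℂ)⟦X⟧) :
    coeffTrace M (φ * ψ) = coeffTrace M (ψ * φ) := by
  simp only [coeffTrace, coeff_mul, Matrix.trace_sum]
  rw [← Finset.Nat.sum_antidiagonal_swap]
  exact Finset.sum_congr rfl fun p _ => Matrix.trace_mul_comm _ _

theorem coeffTrace_eq_zero {M k : ℕ} (hM : M < k) {φ : (Matrix n n ℂ)⟦X⟧} (h : X ^ k ∣ φ) :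
    coeffTrace M φ = 0 := by
  rw [coeffTrace, X_pow_dvd_iff.1 h M hM, Matrix.trace_zero]

theorem X_pow_dvd_mul {R : Type*} [Ring R] {a b : ℕ} {φ ψ : R⟦X⟧} (hφ : X ^ a ∣ φ)
    (hψ : X ^ b ∣ ψ) : X ^ (a + b) ∣ φ * ψ := by
  obtain ⟨φ, rfl⟩ := hφ
  obtain ⟨ψ, rfl⟩ := hψ
  refine ⟨φ * ψ, ?_⟩
  rw [pow_add, mul_assoc, ← mul_assoc φ, ← X_pow_mul (φ := φ)]
  simp only [mul_assoc]

theorem X_pow_dvd_mul_left {R : Type*} [Ring R] {a : ℕ} {φ ψ : R⟦X⟧} (hψ : X ^ a ∣ ψ) :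
    X ^ a ∣ φ * ψ := by
  have := X_pow_dvd_mul (a := 0) (φ := φ) (by rw [pow_zero]; exact one_dvd _) hψ
  rwa [zero_add] at this

/-- The trace identity behind the Hamiltonian structure. The series `P` solves the stationary
equation with potential `U`; `T` is its derivative with respect to the spectral parameter, `V` its
variation, `Y` and `δ` being the derivative and the variation of `U`. Moreover `P² = c`, so that
`P` anticommutes with `T` and `V`. The last three relations are needed modulo `X ^ K` only. -/
theorem trace_identity {K y M : ℕ} (hM : M < K + y) {U P T V Y δ P' T' V' : (Matrix n n ℂ)⟦X⟧}
    {c : ℂ} (hY : X ^ y ∣ Y) (hδ : X ^ y ∣ δ) (hP' : P' = U * P - P * U)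
    (hT' : T' = (Y * P - P * Y) + (U * T - T * U)) (hV' : V' = (δ * P - P * δ) + (U * V - V * U))
    (hPP : X ^ K ∣ P * P - c • 1) (hPV : X ^ K ∣ P * V + V * P) (hPT : X ^ K ∣ P * T + T * P) :
    coeffTrace M (P' * T * V + P * T' * V + P * T * V') =
      2 * c * (coeffTrace M (T * δ) - coeffTrace M (Y * V)) := by
  -- substituting the three equations leaves a commutator with `U` and the terms with `Y` and `δ`;
  -- there the factors `P` are moved together by cyclicity, anticommutation and `P² = c`
  have e0 : P' * T * V + P * T' * V + P * T * V' =
      (U * (P * T * V) - (P * T * V) * U) + (P * (Y * (P * V)) - P * P * Y * V) +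
        (P * T * δ * P - P * T * P * δ) := by
    rw [hP', hT', hV']
    noncomm_ring
  have z1 : coeffTrace M (Y * ((P * V + V * P) * P)) = 0 :=
    coeffTrace_eq_zero (by omega) (X_pow_dvd_mul hY (hPV.mul_right P))
  have z2 : coeffTrace M (Y * (V * (P * P - c • 1))) = 0 :=
    coeffTrace_eq_zero (by omega) (X_pow_dvd_mul hY (X_pow_dvd_mul_left hPP))
  have z3 : coeffTrace M ((P * P - c • 1) * (Y * V)) = 0 :=
    coeffTrace_eq_zero hM (X_pow_dvd_mul hPP (hY.mul_right V))
  have z4 : coeffTrace M ((P * P - c • 1) * (T * δ)) = 0 :=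
    coeffTrace_eq_zero hM (X_pow_dvd_mul hPP (X_pow_dvd_mul_left hδ))
  have z5 : coeffTrace M ((T * (P * P - c • 1)) * δ) = 0 :=
    coeffTrace_eq_zero hM (X_pow_dvd_mul (X_pow_dvd_mul_left hPP) hδ)
  have z6 : coeffTrace M (((P * T + T * P) * P) * δ) = 0 :=
    coeffTrace_eq_zero hM (X_pow_dvd_mul (hPT.mul_right P) hδ)
  have s1 : coeffTrace M (P * (Y * (P * V))) = coeffTrace M (Y * (P * V * P)) := by
    rw [coeffTrace_mul_comm, mul_assoc]
  have s2 : coeffTrace M (P * T * δ * P) = coeffTrace M (P * P * (T * δ)) := by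
    rw [coeffTrace_mul_comm]
    simp only [mul_assoc]
  have f1 : Y * (P * V * P) = Y * ((P * V + V * P) * P) - Y * (V * (P * P - c • 1)) -
      c • (Y * V) := by
    simp only [mul_sub, mul_smul_comm, mul_one]
    noncomm_ring
  have f3 : P * P * Y * V = (P * P - c • 1) * (Y * V) + c • (Y * V) := by
    simp only [sub_mul, smul_mul_assoc, one_mul]
    noncomm_ring
  have f4 : P * P * (T * δ) = (P * P - c • 1) * (T * δ) + c • (T * δ) := by
    simp only [sub_mul, smul_mul_assoc, one_mul, sub_add_cancel]
  have f5 : P * T * P * δ = ((P * T + T * P) * P) * δ - (T * (P * P - c • 1)) * δ -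
      c • (T * δ) := by
    simp only [mul_sub, sub_mul, mul_smul_comm, smul_mul_assoc, mul_one]
    noncomm_ring
  rw [e0, coeffTrace_add, coeffTrace_add, coeffTrace_sub, coeffTrace_sub, coeffTrace_sub,
    coeffTrace_mul_comm M U, sub_self, s1, s2, f1, f3, f4, f5]
  simp only [coeffTrace_add, coeffTrace_sub, coeffTrace_smul, z1, z2, z3, z4, z5, z6]
  ring

theorem conv_euler (w : ℕ → Matrix n n ℂ) (m : ℕ) :
    conv w (euler w) m + conv (euler w) w m = (m : ℂ) • conv w w m := by
  simp only [conv]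
  rw [← Finset.sum_add_distrib, Finset.smul_sum]
  refine Finset.sum_congr rfl fun p hp => ?_
  rw [← Finset.HasAntidiagonal.mem_antidiagonal.1 hp, euler, euler, Matrix.mul_smul,
    Matrix.smul_mul]
  push_cast
  module

theorem coeff_mk_mul_mk_mul_mk (f g h : ℕ → Matrix n n ℂ) (m : ℕ) :
    coeff m (PowerSeries.mk f * PowerSeries.mk g * PowerSeries.mk h) = conv (conv f g) h m := by
  rw [coeff_mul, conv]
  simp only [coeff_mk_mul_mk, coeff_mk]

theorem X_pow_dvd_square {w : ℕ → Matrix n n ℂ} {c : ℂ} {K : ℕ} (h0 : conv w w 0 = c • 1)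
    (h : ∀ m, 1 ≤ m → m < K → conv w w m = 0) :
    X ^ K ∣ PowerSeries.mk w * PowerSeries.mk w - c • 1 := by
  refine X_pow_dvd_iff.2 fun m hm => ?_
  rw [map_sub, coeff_mk_mul_mk, coeff_smul, coeff_one]
  rcases Nat.eq_zero_or_pos m with rfl | hm0
  · rw [h0, if_pos rfl, sub_self]
  · rw [h m hm0 hm, if_neg hm0.ne', smul_zero, sub_zero]

theorem X_pow_dvd_euler {w : ℕ → Matrix n n ℂ} {K : ℕ}
    (h : ∀ m, 1 ≤ m → m < K → conv w w m = 0) :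
    X ^ K ∣ PowerSeries.mk w * PowerSeries.mk (euler w) +
      PowerSeries.mk (euler w) * PowerSeries.mk w := by
  refine X_pow_dvd_iff.2 fun m hm => ?_
  rw [map_add, coeff_mk_mul_mk, coeff_mk_mul_mk, conv_euler]
  rcases Nat.eq_zero_or_pos m with rfl | hm0
  · rw [Nat.cast_zero, zero_smul]
  · rw [h m hm0 hm, smul_zero]

theorem X_pow_dvd_anticomm {w v : ℕ → Matrix n n ℂ} {K : ℕ}
    (h : ∀ m < K, conv v w m + conv w v m = 0) :
    X ^ K ∣ PowerSeries.mk w * PowerSeries.mk v + PowerSeries.mk v * PowerSeries.mk w := by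
  refine X_pow_dvd_iff.2 fun m hm => ?_
  rw [map_add, coeff_mk_mul_mk, coeff_mk_mul_mk, add_comm, h m hm]

/-- The trace identity for coefficients of the positive hierarchy, `δQ` being the variation of `Q`
and `v` that of `w`. -/
theorem trace_identity_affine {A Q δQ : Matrix n n ℂ} {w w' v v' : ℕ → Matrix n n ℂ} {c : ℂ}
    (h0 : A * w 0 - w 0 * A = 0) (h1 : (A * w 1 - w 1 * A) + (Q * w 0 - w 0 * Q) = 0)
    (h : ∀ m, w' m = (A * w (m + 2) - w (m + 2) * A) + (Q * w (m + 1) - w (m + 1) * Q))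
    (v0 : A * v 0 - v 0 * A = 0)
    (v1 : (A * v 1 - v 1 * A) + (Q * v 0 - v 0 * Q) + (δQ * w 0 - w 0 * δQ) = 0)
    (hv : ∀ m, v' m = (A * v (m + 2) - v (m + 2) * A) + (Q * v (m + 1) - v (m + 1) * Q) +
      (δQ * w (m + 1) - w (m + 1) * δQ))
    (hs0 : conv w w 0 = c • 1) (hs : ∀ m, 1 ≤ m → conv w w m = 0)
    (hwv : ∀ m, conv v w m + conv w v m = 0) (m : ℕ) :
    (conv (conv w' (euler w) + conv w (euler w')) v m + conv (conv w (euler w)) v' m).trace =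
      2 * c * ((m + 1) * (w (m + 1) * δQ).trace + 2 * (A * v (m + 2)).trace +
        (Q * v (m + 1)).trace) := by
  have hP := affine_stationary h0 h1 h
  have hT : X ^ 2 * PowerSeries.mk (euler w') =
      (affineSeries (-2 • A) (-Q) * PowerSeries.mk w -
        PowerSeries.mk w * affineSeries (-2 • A) (-Q)) +
      (affineSeries A Q * PowerSeries.mk (euler w) -
        PowerSeries.mk (euler w) * affineSeries A Q) := by
    ext1 k
    rw [map_add, map_sub, map_sub]
    match k with
    | 0 =>
      simp only [coeff_zero_affine_mul, coeff_zero_mul_affine, coeff_X_pow_mul', coeff_mk, euler]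
      simp only [Nat.cast_zero, zero_smul, Matrix.mul_zero, Matrix.zero_mul, sub_self, add_zero]
      rw [if_neg (by simp)]
      rw [sub_eq_zero] at h0
      simp only [smul_mul_assoc, mul_smul_comm, h0, sub_self]
    | 1 =>
      rw [coeff_X_pow_mul', if_neg (by simp)]
      simp only [coeff_succ_affine_mul, coeff_succ_mul_affine, coeff_mk, euler]
      have : (A * w 1 - w 1 * A) = -(Q * w 0 - w 0 * Q) := eq_neg_of_add_eq_zero_left h1
      have e : (-2 • A * w (0 + 1) + -Q * w 0 - (w (0 + 1) * -2 • A + w 0 * -Q)) =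
          -2 • (A * w 1 - w 1 * A) - (Q * w 0 - w 0 * Q) := by
        simp only [zero_add]
        noncomm_ring
      rw [e, this]
      simp only [zero_add, Nat.cast_one, one_smul, Nat.cast_zero, zero_smul, Matrix.mul_zero,
        Matrix.zero_mul, add_zero, this]
      module
    | k + 2 =>
      rw [coeff_X_pow_mul]
      simp only [coeff_succ_affine_mul, coeff_succ_mul_affine, coeff_mk, euler, h,
        Matrix.smul_mul, Matrix.mul_smul, neg_mul, mul_neg]
      push_cast
      module
  have hV : X ^ 2 * PowerSeries.mk v' =
      (affineSeries 0 δQ * PowerSeries.mk w - PowerSeries.mk w * affineSeries 0 δQ) +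
      (affineSeries A Q * PowerSeries.mk v - PowerSeries.mk v * affineSeries A Q) := by
    ext1 k
    rw [map_add, map_sub, map_sub]
    match k with
    | 0 =>
      simp only [coeff_zero_affine_mul, coeff_zero_mul_affine, coeff_X_pow_mul', coeff_mk]
      rw [if_neg (by simp), v0]
      simp
    | 1 =>
      rw [coeff_X_pow_mul', if_neg (by simp)]
      simp only [coeff_succ_affine_mul, coeff_succ_mul_affine, coeff_mk]
      refine v1.symm.trans ?_
      simp only [zero_add, Matrix.zero_mul, Matrix.mul_zero]
      abel
    | k + 2 =>
      rw [coeff_X_pow_mul]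
      simp only [coeff_succ_affine_mul, coeff_succ_mul_affine, coeff_mk, hv, Matrix.zero_mul,
        Matrix.mul_zero, zero_add]
      abel
  have key := trace_identity (K := m + 3) (y := 0) (M := m + 2) (by omega)
    (by rw [pow_zero]; exact one_dvd _) (by rw [pow_zero]; exact one_dvd _) hP hT hV
    (X_pow_dvd_square hs0 fun k hk _ => hs k hk) (X_pow_dvd_anticomm fun k _ => hwv k)
    (X_pow_dvd_euler fun k hk _ => hs k hk)
  have e1 : ∀ f g h : (Matrix n n ℂ)⟦X⟧, f * (X ^ 2 * g) * h = X ^ 2 * (f * g * h) :=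
    fun f g h => by rw [← mul_assoc, ← X_pow_mul, mul_assoc, mul_assoc, mul_assoc]
  have e2 : X ^ 2 * PowerSeries.mk w' * PowerSeries.mk (euler w) * PowerSeries.mk v +
      PowerSeries.mk w * (X ^ 2 * PowerSeries.mk (euler w')) * PowerSeries.mk v +
      PowerSeries.mk w * PowerSeries.mk (euler w) * (X ^ 2 * PowerSeries.mk v') =
      X ^ 2 * (PowerSeries.mk w' * PowerSeries.mk (euler w) * PowerSeries.mk v +
        PowerSeries.mk w * PowerSeries.mk (euler w') * PowerSeries.mk v +
        PowerSeries.mk w * PowerSeries.mk (euler w) * PowerSeries.mk v') := by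
    rw [e1, mul_add, mul_add, ← mul_assoc _ (X ^ 2), ← X_pow_mul]
    simp only [mul_assoc]
  rw [e2] at key
  simp only [coeffTrace, coeff_X_pow_mul, map_add, coeff_mk_mul_mk_mul_mk,
    coeff_succ_mul_affine, coeff_succ_affine_mul, coeff_mk, euler_apply, Matrix.mul_zero, zero_add,
    Matrix.smul_mul, neg_mul, Matrix.trace_add, Matrix.trace_neg, Matrix.trace_smul,
    smul_eq_mul] at key
  have e3 : conv (conv w' (euler w) + conv w (euler w')) v m =
      conv (conv w' (euler w)) v m + conv (conv w (euler w')) v m := by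
    simp only [conv, Pi.add_apply, add_mul, Finset.sum_add_distrib]
  rw [e3, Matrix.trace_add, Matrix.trace_add, key]
  push_cast
  simp only [zsmul_eq_mul]
  push_cast
  ring

/-- The trace identity for coefficients of the negative hierarchy; the coefficients of the square
are only known to vanish up to the index `m + 1`. -/
theorem trace_identity_quadratic {A Q δQ : Matrix n n ℂ} {w w' v v' : ℕ → Matrix n n ℂ} {c : ℂ}
    (h0 : w' 0 = 0) (h1 : w' 1 = Q * w 0 - w 0 * Q)
    (h : ∀ m, w' (m + 2) = (A * w m - w m * A) + (Q * w (m + 1) - w (m + 1) * Q))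
    (v0 : v' 0 = 0) (v1 : v' 1 = (Q * v 0 - v 0 * Q) + (δQ * w 0 - w 0 * δQ))
    (hv : ∀ m, v' (m + 2) = (A * v m - v m * A) + (Q * v (m + 1) - v (m + 1) * Q) +
      (δQ * w (m + 1) - w (m + 1) * δQ)) (m : ℕ)
    (hs0 : conv w w 0 = c • 1) (hs : ∀ k, 1 ≤ k → k < m + 2 → conv w w k = 0)
    (hwv : ∀ k < m + 2, conv v w k + conv w v k = 0) :
    (conv (conv w' (euler w) + conv w (euler w')) v (m + 2) +
        conv (conv w (euler w)) v' (m + 2)).trace =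
      2 * c * ((m + 1) * (w (m + 1) * δQ).trace - 2 * (A * v m).trace -
        (Q * v (m + 1)).trace) := by
  have hP := quadratic_stationary h0 h1 h
  have hT : PowerSeries.mk (euler w') =
      (quadraticSeries (2 • A) Q * PowerSeries.mk w -
        PowerSeries.mk w * quadraticSeries (2 • A) Q) +
      (quadraticSeries A Q * PowerSeries.mk (euler w) -
        PowerSeries.mk (euler w) * quadraticSeries A Q) := by
    ext1 k
    rw [map_add, map_sub, map_sub]
    match k with
    | 0 =>
      simp only [coeff_zero_quadratic_mul, coeff_zero_mul_quadratic, coeff_mk, euler]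
      simp
    | 1 =>
      simp only [coeff_one_quadratic_mul, coeff_one_mul_quadratic, coeff_mk, euler, h1]
      simp
    | k + 2 =>
      simp only [coeff_quadratic_mul, coeff_mul_quadratic, coeff_mk, euler, h,
        Matrix.smul_mul, Matrix.mul_smul]
      push_cast
      module
  have hV : PowerSeries.mk v' =
      (quadraticSeries 0 δQ * PowerSeries.mk w - PowerSeries.mk w * quadraticSeries 0 δQ) +
      (quadraticSeries A Q * PowerSeries.mk v - PowerSeries.mk v * quadraticSeries A Q) := by
    ext1 k
    rw [map_add, map_sub, map_sub]
    match k with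
    | 0 => simp only [coeff_zero_quadratic_mul, coeff_zero_mul_quadratic, coeff_mk, v0]; simp
    | 1 =>
      simp only [coeff_one_quadratic_mul, coeff_one_mul_quadratic, coeff_mk, v1]
      abel
    | k + 2 =>
      simp only [coeff_quadratic_mul, coeff_mul_quadratic, coeff_mk, hv, Matrix.zero_mul,
        Matrix.mul_zero, zero_add]
      abel
  have hX : ∀ A Q : Matrix n n ℂ, X ^ 1 ∣ quadraticSeries A Q := fun A Q => by
    rw [quadraticSeries_eq, pow_one, ← X_mul]
    exact dvd_mul_right _ _
  have key := trace_identity (K := m + 2) (y := 1) (M := m + 2) (by omega) (hX _ _) (hX _ _) hP hT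
    hV (X_pow_dvd_square hs0 hs) (X_pow_dvd_anticomm hwv) (X_pow_dvd_euler hs)
  simp only [coeffTrace, map_add, coeff_mk_mul_mk_mul_mk,
    coeff_mul_quadratic, coeff_quadratic_mul, coeff_mk, euler_apply, Matrix.mul_zero, zero_add,
    Matrix.smul_mul, Matrix.trace_add, Matrix.trace_smul, smul_eq_mul] at key
  have e3 : conv (conv w' (euler w) + conv w (euler w')) v (m + 2) =
      conv (conv w' (euler w)) v (m + 2) + conv (conv w (euler w')) v (m + 2) := by
    simp only [conv, Pi.add_apply, add_mul, Finset.sum_add_distrib]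
  rw [e3, Matrix.trace_add, Matrix.trace_add, key]
  simp only [nsmul_eq_mul]
  push_cast
  ring

end TraceIdentity

/-! ### Variations of matrix functions -/

section MVarDer

variable {n : Type*} {K : Set ℕ} {F G : ℝ → ℝ → Matrix n n ℂ} {Φ Ψ : ℝ → Matrix n n ℂ}

/-- Entrywise differentiability at `0` of a curve of matrix functions. -/
def MVarDer (K : Set ℕ) (F : ℝ → ℝ → Matrix n n ℂ) (Φ : ℝ → Matrix n n ℂ) : Prop :=
  ∀ i j, VarDer K (fun ε x => F ε x i j) fun x => Φ x i j

namespace MVarDer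

theorem cls (hF : MVarDer K F Φ) : MCls K Φ := fun i j => (hF i j).cls

theorem bounded (hF : MVarDer Set.univ F Φ) : MVarDer {0} F Φ := fun i j => (hF i j).bounded

theorem congr_fun (hF : MVarDer K F Φ) (h : ∀ ε x, F ε x = G ε x) : MVarDer K G Φ :=
  fun i j => (hF i j).congr_fun fun ε x => by rw [h]

theorem congr_der (hF : MVarDer K F Φ) (h : ∀ x, Φ x = Ψ x) : MVarDer K F Ψ :=
  fun i j => (hF i j).congr_der fun x => by rw [h]

theorem const {C : ℝ → Matrix n n ℂ} (hC : MSmb C) : MVarDer K (fun _ => C) fun _ => 0 :=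
  fun i j => VarDer.const (hC i j)

theorem add (hF : MVarDer K F Φ) (hG : MVarDer K G Ψ) :
    MVarDer K (fun ε x => F ε x + G ε x) fun x => Φ x + Ψ x :=
  fun i j => (hF i j).add (hG i j)

theorem sub (hF : MVarDer K F Φ) (hG : MVarDer K G Ψ) :
    MVarDer K (fun ε x => F ε x - G ε x) fun x => Φ x - Ψ x :=
  fun i j => (hF i j).sub (hG i j)

theorem smul (c : ℂ) (hF : MVarDer K F Φ) :
    MVarDer K (fun ε x => c • F ε x) fun x => c • Φ x :=
  fun i j => (hF i j).const_mul c

theorem sum {κ : Type*} (s : Finset κ) {F : κ → ℝ → ℝ → Matrix n n ℂ} {Φ : κ → ℝ → Matrix n n ℂ}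
    (h : ∀ k ∈ s, MVarDer K (F k) (Φ k)) :
    MVarDer K (fun ε x => ∑ k ∈ s, F k ε x) fun x => ∑ k ∈ s, Φ k x := fun i j => by
  simp only [Matrix.sum_apply]
  exact VarDer.sum s fun k hk => h k hk i j

theorem unique (hF : MVarDer {0} F Φ) (hG : MVarDer {0} F Ψ) (x : ℝ) : Φ x = Ψ x := by
  ext i j
  exact _root_.congr_fun ((hF i j).unique (hG i j)) x

/-- The variation commutes with the `x`-derivative. -/
theorem mDeriv {F' : ℝ → ℝ → Matrix n n ℂ} (hF : MVarDer {0} F Φ)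
    (hd : ∀ ε, MDeriv (F ε) (F' ε)) (hF' : MVarDer {0} F' Ψ) : MDeriv Φ Ψ := by
  have h : MVarDer {0} F' fun x => of fun i j => deriv (fun y => Φ y i j) x := fun i j =>
    (hF i j).deriv.congr_fun fun ε x => (hd ε x i j).deriv
  exact hF.cls.mDeriv.congr (h.unique hF')

variable [Fintype n]

theorem mul (h0 : 0 ∈ K) (hF : MVarDer K F Φ) (hG : MVarDer K G Ψ) :
    MVarDer K (fun ε x => F ε x * G ε x) fun x => Φ x * G 0 x + F 0 x * Ψ x := fun i j => by
  simp only [Matrix.mul_apply, Matrix.add_apply, ← Finset.sum_add_distrib]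
  exact VarDer.sum _ fun k _ => (hF i k).mul h0 (hG k j)

theorem mul_bounded (hF : MVarDer K F Φ) (h0 : MCls K (F 0)) (hG : MVarDer {0} G Ψ) :
    MVarDer K (fun ε x => F ε x * G ε x) fun x => Φ x * G 0 x + F 0 x * Ψ x := fun i j => by
  simp only [Matrix.mul_apply, Matrix.add_apply, ← Finset.sum_add_distrib]
  exact VarDer.sum _ fun k _ => (hF i k).mul_bounded (h0 i k) (hG k j)

theorem const_mul (h0 : 0 ∈ K) (A : Matrix n n ℂ) (hF : MVarDer K F Φ) :
    MVarDer K (fun ε x => A * F ε x) fun x => A * Φ x :=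
  (mul h0 (const (MCls.const A)) hF).congr_der fun x => by rw [Matrix.zero_mul, zero_add]

theorem trace (hF : MVarDer K F Φ) :
    VarDer K (fun ε x => (F ε x).trace) fun x => (Φ x).trace :=
  VarDer.sum _ fun k _ => hF k k

end MVarDer

end MVarDer

section MVarDerBlocks

variable {N : ℕ} {K : Set ℕ} {F G : ℝ → ℝ → BMat N} {Φ Ψ : ℝ → BMat N}

theorem MVarDer.const_comm (h0 : 0 ∈ K) (A : BMat N) (hF : MVarDer K F Φ) :
    MVarDer K (fun ε x => comm A (F ε x)) fun x => comm A (Φ x) :=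
  (hF.const_mul h0 A).sub ((MVarDer.mul h0 hF (MVarDer.const (MCls.const A))).congr_der
    fun x => by rw [Matrix.mul_zero, add_zero])

theorem MVarDer.comm (h0 : 0 ∈ K) (hF : MVarDer K F Φ) (hG : MVarDer K G Ψ) :
    MVarDer K (fun ε x => comm (F ε x) (G ε x))
      fun x => KaupNewell.comm (F 0 x) (Ψ x) + KaupNewell.comm (Φ x) (G 0 x) :=
  ((hF.mul h0 hG).sub (hG.mul h0 hF)).congr_der fun x => by
    simp only [KaupNewell.comm]
    abel

theorem MVarDer.conv {w : ℕ → ℝ → ℝ → BMat N} {v : ℕ → ℝ → BMat N} (h0 : 0 ∈ K) (m : ℕ)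
    (h : ∀ k ≤ m, MVarDer K (w k) (v k)) :
    MVarDer K (fun ε x => conv (fun k => w k ε x) (fun k => w k ε x) m)
      fun x => KaupNewell.conv (fun k => v k x) (fun k => w k 0 x) m +
        KaupNewell.conv (fun k => w k 0 x) (fun k => v k x) m := by
  refine (MVarDer.sum _ fun p hp => (h p.1 ?_).mul h0 (h p.2 ?_)).congr_der fun x => ?_
  · have := Finset.HasAntidiagonal.mem_antidiagonal.1 hp; omega
  · have := Finset.HasAntidiagonal.mem_antidiagonal.1 hp; omega
  · exact Finset.sum_add_distrib

theorem mVarDer_matQ {γ : ℝ → Phase N} {φ : Phase N}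
    (hγ : Tendsto (fun ε : ℝ => ε⁻¹ • (γ ε - γ 0)) (𝓝[≠] 0) (𝓝 φ)) :
    MVarDer Set.univ (fun ε => matQ (γ ε)) (matQ φ) := by
  intro i j
  rcases i with i | i <;> rcases j with j | j
  · exact VarDer.const Cls.zero
  · exact varDer_of_tendsto hγ (rCoord j)
  · exact varDer_of_tendsto hγ (qCoord i)
  · exact VarDer.const Cls.zero

theorem trace_sigma_mul_bDiag (a : ℂ) (d : Matrix (Fin N) (Fin N) ℂ) :
    ((I • sigma3) * bDiag a d).trace = I * (a - d.trace) := by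
  rw [Matrix.smul_mul, Matrix.trace_smul, smul_eq_mul]
  congr 1
  simp [sigma3, bDiag, fromBlocks_multiply, Matrix.trace, sub_eq_add_neg]

theorem trace_bOff_mul_bOff (r q c b : Vec N) :
    (bOff r q * bOff c b).trace = c ⬝ᵥ q + r ⬝ᵥ b := by
  simp [bOff, fromBlocks_multiply, Matrix.trace, Matrix.mul_apply, dotProduct, mul_comm, add_comm]

theorem trace_bOff_mul_matQ (c b : Vec N) (φ : Phase N) (x : ℝ) :
    (bOff c b * matQ φ x).trace = pair (c, b) (φ x) := by
  rw [matQ_eq, trace_bOff_mul_bOff, pair, add_comm, dotProduct_comm (rOf φ x)]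
  rfl

end MVarDerBlocks

/-! ### Variations of the positive hierarchy -/

section PosVariation

variable {N : ℕ} {α : ℂ} {ω : Phase N} {γ : ℝ → Phase N} {φ : Phase N}

theorem mSmb_posW (m : ℕ) : MSmb (coeffMat (posCoeffs α ω) m) := by
  obtain ⟨j, rfl | rfl⟩ := Nat.even_or_odd' m
  · rw [funext (coeffMat_even _ j)]
    exact mCls_bDiag.2 ⟨smb_posCoeffs_a j, mSmb_posCoeffs_d j⟩
  · exact (mSch_posW_odd j).smb

theorem mSch_posW (hα : α ≠ 0) {m : ℕ} (hm : 1 ≤ m) : MSch (coeffMat (posCoeffs α ω) m) :=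
  (posW_square hα m m hm (by omega)).2

theorem posW_conv (hα : α ≠ 0) {m : ℕ} (hm : 1 ≤ m) (x : ℝ) :
    conv (fun k => coeffMat (posCoeffs α ω) k x) (fun k => coeffMat (posCoeffs α ω) k x) m = 0 :=
  (posW_square hα m m hm (by omega)).1 x

theorem posW_one (x : ℝ) : coeffMat (posCoeffs α ω) 1 x = α • matQ ω x := by
  rw [coeffMat_one]
  ext i j
  rcases i with i | i <;> rcases j with j | j <;> simp [bOff, posCoeffs, matQ]

/-- The odd coefficients are differential expressions in the lower ones. -/
theorem posW_odd_eq (j : ℕ) {D : ℝ → BMat N} (hD : MDeriv (coeffMat (posCoeffs α ω) (2 * j + 1)) D)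
    (x : ℝ) : coeffMat (posCoeffs α ω) (2 * (j + 1) + 1) x =
      ((2 * I)⁻¹ • sigma3) * (D x - comm (matQ ω x) (coeffMat (posCoeffs α ω) (2 * (j + 1)) x)) := by
  have h := hD.unique (posW_mDeriv (α := α) (ω := ω) (2 * j + 1)) x
  have ho := sigma3_mul_coeffMat (posCoeffs α ω) (2 * (j + 1) + 1) x
  rw [neg_one_pow_odd, neg_one_smul] at ho
  rw [show 2 * j + 1 + 2 = 2 * (j + 1) + 1 by ring, show 2 * j + 1 + 1 = 2 * (j + 1) by ring,
    comm_sigma_of_anti ho] at h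
  rw [h, add_sub_cancel_right, Matrix.smul_mul, Matrix.mul_smul, smul_smul,
    ← mul_assoc (sigma3 : BMat N), sigma3_mul_self, one_mul, inv_mul_cancel₀ (by simp), one_smul]

/-- All coefficients of the positive hierarchy vary differentiably in the topology of rapidly
decreasing functions: they are local expressions in `q` and `r`. -/
theorem exists_varDer_posW (hα : α ≠ 0)
    (hγ : Tendsto (fun ε : ℝ => ε⁻¹ • (γ ε - γ 0)) (𝓝[≠] 0) (𝓝 φ)) (m : ℕ) :
    ∃ V, MVarDer Set.univ (fun ε => coeffMat (posCoeffs α (γ ε)) m) V := by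
  induction m using Nat.strong_induction_on with
  | _ m ih =>
  have hu : 0 ∈ (Set.univ : Set ℕ) := trivial
  obtain ⟨j, rfl | rfl⟩ := Nat.even_or_odd' m
  · rcases j with _ | j
    · exact ⟨_, (MVarDer.const (MCls.const ((I * α) • sigma3))).congr_fun fun ε x =>
        (posW_zero x).symm⟩
    · choose! V hV using ih
      refine ⟨_, MVarDer.congr_fun (MVarDer.const_mul hu (-(2 * (I * α))⁻¹ • sigma3)
        (MVarDer.sum (Finset.range (2 * j + 1)) fun i hi => ((hV (i + 1) ?_).mul hu
          (hV (2 * j + 1 - i) ?_)))) fun ε x => (coeffMat_even_of_conv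
            (mul_ne_zero I_ne_zero hα) (posW_zero x) j (posW_conv hα (by omega) x)).symm⟩
      · rw [Finset.mem_range] at hi; omega
      · omega
  · rcases j with _ | j
    · exact ⟨_, ((mVarDer_matQ hγ).smul α).congr_fun fun ε x => (posW_one x).symm⟩
    · obtain ⟨V1, hV1⟩ := ih (2 * j + 1) (by omega)
      obtain ⟨V2, hV2⟩ := ih (2 * (j + 1)) (by omega)
      have hD : MVarDer Set.univ (fun ε x => of fun i k =>
          deriv (fun y => coeffMat (posCoeffs α (γ ε)) (2 * j + 1) y i k) x)
          fun x => of fun i k => deriv (fun y => V1 y i k) x := fun i k => (hV1 i k).deriv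
      exact ⟨_, ((hD.sub ((mVarDer_matQ hγ).comm hu hV2)).const_mul hu ((2 * I)⁻¹ • sigma3)).congr_fun
        fun ε x => (posW_odd_eq j (mSmb_posW _).mDeriv x).symm⟩

/-- The density is built from the coefficients of `tr (U̇ W)`, with `U̇` the derivative of `U` in the
spectral parameter. -/
theorem trace_posDensity {n : ℕ} (hn : n ≠ 0) (x : ℝ) :
    posDensity α n ω x = -(1 / (2 * (n : ℂ))) *
      (2 * ((I • sigma3) * coeffMat (posCoeffs α ω) (2 * n + 2) x).trace +
        (matQ ω x * coeffMat (posCoeffs α ω) (2 * n + 1) x).trace) := by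
  rw [posDensity, if_neg hn, show 2 * n + 2 = 2 * (n + 1) by ring, coeffMat_even, coeffMat_odd,
    trace_sigma_mul_bDiag, matQ_eq, trace_bOff_mul_bOff]
  ring

/-- The densities of the positive hierarchy vary by the gradient up to a total derivative. -/
theorem hasVarDeriv_pos_of_ne_zero (hα : α ≠ 0) {n : ℕ} (hn : n ≠ 0) :
    Integrable (posDensity α n ω) ∧ HasVarDeriv Set.univ (posH α n) ω (posGrad α n ω) := by
  have hu : 0 ∈ (Set.univ : Set ℕ) := trivial
  have hdens : ∀ ω : Phase N, Sch (posDensity α n ω) := fun ω => by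
    rw [funext (trace_posDensity hn)]
    exact ((((MCls.mul' (MCls.const _) (mSch_posW hα (by omega))).trace).const_mul 2).add
      (((mSch_matQ ω).mul (mSmb_posW _)).trace)).const_mul _
  refine ⟨(hdens ω).integrable, ?_⟩
  rintro γ φ - rfl hγ
  have hpair : Sch fun x => pair (posGrad α n (γ 0) x) (φ x) :=
    IsSchwartz.pair (isSchwartz_mk.2 (vSch_posCoeffs n)) ⟨φ, rfl⟩
  refine ⟨hpair.integrable, ?_⟩
  choose V hV using exists_varDer_posW (α := α) hα hγ
  have hQ := mVarDer_matQ hγ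
  -- the linearisation of the stationary equation and of `W² = -α²`
  have hVd : ∀ m, MDeriv (V m) fun x => comm (I • sigma3) (V (m + 2) x) +
      (comm (matQ (γ 0) x) (V (m + 1) x) +
        comm (matQ φ x) (coeffMat (posCoeffs α (γ 0)) (m + 1) x)) := fun m =>
    (hV m).bounded.mDeriv (fun ε => posW_mDeriv m)
      (((hV (m + 2)).const_comm hu (I • sigma3)).add (hQ.comm hu (hV (m + 1)))).bounded
  have hV0 : ∀ x, V 0 x = 0 := (hV 0).bounded.unique
    ((MVarDer.const (MCls.const ((I * α) • sigma3))).congr_fun fun ε x => (posW_zero x).symm)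
  have hV1 : ∀ x, comm (I • sigma3) (V 1 x) + (comm (matQ (γ 0) x) (V 0 x) +
      comm (matQ φ x) (coeffMat (posCoeffs α (γ 0)) 0 x)) = 0 :=
    (((hV 1).const_comm hu (I • sigma3)).add (hQ.comm hu (hV 0))).bounded.unique
      ((MVarDer.const MCls.zero).congr_fun fun ε x => (posW_initial x).symm)
  have hanti : ∀ m x, conv (fun k => V k x) (fun k => coeffMat (posCoeffs α (γ 0)) k x) m +
      conv (fun k => coeffMat (posCoeffs α (γ 0)) k x) (fun k => V k x) m = 0 := fun m => by
    refine (MVarDer.conv hu m fun k _ => hV k).bounded.unique ?_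
    rcases Nat.eq_zero_or_pos m with rfl | hm
    · refine (MVarDer.const (MCls.const (((I * α) • sigma3) * ((I * α) • sigma3)))).congr_fun
        fun ε x => ?_
      rw [conv_zero, posW_zero]
    · exact (MVarDer.const MCls.zero).congr_fun fun ε x => (posW_conv hα hm x).symm
  -- the coefficient of `tr (W Ẇ δW)` whose derivative is the error term
  set Z : ℝ → ℂ := fun x => (conv (conv (fun k => coeffMat (posCoeffs α (γ 0)) k x)
    (euler fun k => coeffMat (posCoeffs α (γ 0)) k x)) (fun k => V k x) (2 * n)).trace with hZ
  have hZs : Sch Z := by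
    refine MCls.trace (MCls.sum _ fun p _ => MCls.mul' (MCls.sum _ fun p' _ => ?_) (hV _).cls)
    exact (mSmb_posW _).mul ((mSmb_posW _).smul _)
  have hZd : ∀ x, HasDerivAt Z (2 * (-α ^ 2) * ((((2 * n : ℕ) : ℂ) + 1) *
      (coeffMat (posCoeffs α (γ 0)) (2 * n + 1) x * matQ φ x).trace +
        2 * ((I • sigma3) * V (2 * n + 2) x).trace +
        (matQ (γ 0) x * V (2 * n + 1) x).trace)) x := fun x => by
    have hw : ∀ k, MDeriv (coeffMat (posCoeffs α (γ 0)) k) _ := posW_mDeriv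
    have h1 := (mDeriv_conv (2 * n) (fun k _ => mDeriv_conv k (fun k _ => hw k)
      fun k _ => (hw k).smul (k : ℂ)) fun k _ => hVd k).trace x
    have h2 := trace_identity_affine (A := I • sigma3) (Q := matQ (γ 0) x) (δQ := matQ φ x)
      (w := fun k => coeffMat (posCoeffs α (γ 0)) k x) (v := fun k => V k x) (c := -α ^ 2)
      (w' := fun k => comm (I • sigma3) (coeffMat (posCoeffs α (γ 0)) (k + 2) x) +
        comm (matQ (γ 0) x) (coeffMat (posCoeffs α (γ 0)) (k + 1) x))
      (v' := fun m => comm (I • sigma3) (V (m + 2) x) +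
        (comm (matQ (γ 0) x) (V (m + 1) x) +
          comm (matQ φ x) (coeffMat (posCoeffs α (γ 0)) (m + 1) x)))
      (comm_sigma_posW_zero x) (posW_initial x) (fun k => rfl)
      (by simp only [hV0]; simp) ((add_assoc _ _ _).trans (hV1 x))
      (fun k => (add_assoc _ _ _).symm)
      (by
        rw [conv_zero, posW_zero, Matrix.smul_mul, Matrix.mul_smul, sigma3_mul_self, smul_smul,
          show I * α * (I * α) = I * I * α ^ 2 by ring, Complex.I_mul_I, neg_one_mul])
      (fun m hm => posW_conv hα hm x) (fun m => hanti m x) (2 * n)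
    exact h1.congr_deriv h2
  have hd : VarDer Set.univ (fun ε => posDensity α n (γ ε)) fun x => -(1 / (2 * (n : ℂ))) *
      (2 * ((I • sigma3) * V (2 * n + 2) x).trace +
        (matQ φ x * coeffMat (posCoeffs α (γ 0)) (2 * n + 1) x +
          matQ (γ 0) x * V (2 * n + 1) x).trace) :=
    ((((((hV (2 * n + 2)).const_mul hu (I • sigma3)).trace).const_mul 2).add
      ((hQ.mul hu (hV (2 * n + 1))).trace)).const_mul _).congr_fun
        fun ε x => (trace_posDensity hn x).symm
  refine (hd.integral fun ε => hdens _).congr_deriv ?_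
  have hn' : (n : ℂ) ≠ 0 := Nat.cast_ne_zero.2 hn
  have e : ∀ x, -(1 / (2 * (n : ℂ))) * (2 * ((I • sigma3) * V (2 * n + 2) x).trace +
      (matQ φ x * coeffMat (posCoeffs α (γ 0)) (2 * n + 1) x +
        matQ (γ 0) x * V (2 * n + 1) x).trace) =
      pair (posGrad α n (γ 0) x) (φ x) + (4 * (n : ℂ) * α ^ 2)⁻¹ * deriv Z x := fun x => by
    have hp : pair (posGrad α n (γ 0) x) (φ x) =
        (coeffMat (posCoeffs α (γ 0)) (2 * n + 1) x * matQ φ x).trace := by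
      rw [coeffMat_odd, trace_bOff_mul_matQ]
      rfl
    rw [(hZd x).deriv, hp, Matrix.trace_add, Matrix.trace_mul_comm (matQ φ x)]
    push_cast
    field_simp
    ring
  rw [funext e, integral_add hpair.integrable (hZs.deriv.const_mul _).integrable,
    integral_const_mul, hZs.integral_deriv_eq_zero, mul_zero, add_zero]

theorem hasVarDeriv_pos_zero :
    Integrable (posDensity α 0 ω) ∧ HasVarDeriv Set.univ (posH α 0) ω (posGrad α 0 ω) := by
  have hdens : ∀ ω : Phase N, posDensity α 0 ω = fun x => α * (qOf ω x ⬝ᵥ rOf ω x) := fun ω => by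
    funext x
    rw [posDensity, if_pos rfl]
  have hs : ∀ ω : Phase N, Sch (posDensity α 0 ω) := fun ω => by
    rw [hdens]
    exact ((vSch_q ω).dotProduct (vSch_r ω).smb).const_mul α
  refine ⟨(hs ω).integrable, ?_⟩
  rintro γ φ - rfl hγ
  refine ⟨(IsSchwartz.pair (isSchwartz_mk.2 (vSch_posCoeffs 0)) ⟨φ, rfl⟩).integrable, ?_⟩
  have hu : 0 ∈ (Set.univ : Set ℕ) := trivial
  have hd : VarDer Set.univ (fun ε => posDensity α 0 (γ ε))
      fun x => pair (posGrad α 0 (γ 0) x) (φ x) := by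
    refine (((VarDer.sum Finset.univ fun j _ => (varDer_of_tendsto hγ (qCoord j)).mul hu
      (varDer_of_tendsto hγ (rCoord j))).const_mul α).congr_fun fun ε x => ?_).congr_der fun x => ?_
    · rw [hdens]
      rfl
    · have e : pair (posGrad α 0 (γ 0) x) (φ x) =
          ∑ j, α * rOf (γ 0) x j * (φ x).1 j + ∑ j, α * qOf (γ 0) x j * (φ x).2 j := rfl
      rw [e, ← Finset.sum_add_distrib, Finset.mul_sum]
      refine Finset.sum_congr rfl fun j _ => ?_
      change α * ((φ x).1 j * rOf (γ 0) x j + qOf (γ 0) x j * (φ x).2 j) = _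
      ring
  exact hd.integral fun ε => hs _

theorem vanishingSol_zero {l : Filter ℝ} (hl : l = atBot ∨ l = atTop) {s : ℂ}
    {X : ℝ → Matrix (Fin N) (Fin N) ℂ} (hX : MSch X) :
    vanishingSol l s X (fun _ => 0) = fun _ => 0 :=
  vanishingSol_eq hl hX MCls.zero ((MDeriv.const 0).congr fun x => by simp) tendsto_const_nhds

theorem posCoeffs_alpha_zero (n : ℕ) : posCoeffs 0 ω n = ⟨fun _ => 0, fun _ => 0, fun _ => 0,
    fun _ => 0⟩ := by
  induction n with
  | zero => simp [posCoeffs]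
  | succ n ih =>
    rw [posCoeffs, ih, posStep]
    have hz : invTransport (I / 2) (qrT ω) (fun _ => (0 : Matrix (Fin N) (Fin N) ℂ)) =
        fun _ => 0 := by
      funext x
      rw [invTransport, vanishingSol_zero (Or.inl rfl) (mSch_qrT ω),
        vanishingSol_zero (Or.inr rfl) (mSch_qrT ω)]
      simp
    simp [hz, invD_zero]

/-- For `α = 0` all coefficients vanish, and the argument through `W² = -α²` is not available. -/
theorem hasVarDeriv_pos (n : ℕ) :
    Integrable (posDensity α n ω) ∧ HasVarDeriv Set.univ (posH α n) ω (posGrad α n ω) := by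
  rcases eq_or_ne n 0 with rfl | hn
  · exact hasVarDeriv_pos_zero
  rcases eq_or_ne α 0 with rfl | hα
  · have hd : ∀ ω : Phase N, posDensity 0 n ω = fun _ => 0 := fun ω => by
      funext x
      rw [posDensity, if_neg hn, posCoeffs_alpha_zero, posCoeffs_alpha_zero]
      simp
    have hG : ∀ (φ : Phase N) (x : ℝ), pair (posGrad 0 n ω x) (φ x) = 0 := fun φ x => by
      simp [posGrad, posCoeffs_alpha_zero, pair]
    have hH : posH 0 n = fun _ : Phase N => 0 := by
      funext ω
      rw [posH, hd]
      simp
    refine ⟨by rw [hd]; exact integrable_zero _ _ _, fun γ φ _ _ _ => ?_⟩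
    rw [funext (hG φ), hH]
    refine ⟨integrable_zero _ _ _, ?_⟩
    rw [integral_zero]
    exact hasDerivAt_const _ _
  · exact hasVarDeriv_pos_of_ne_zero hα hn

end PosVariation

/-! ### Variations of the negative hierarchy -/

section NegVariation

variable {N : ℕ} {α : ℂ} {ω : Phase N} {n : ℕ} {γ : ℝ → Phase N} {φ : Phase N}

theorem mSmb_negW (h : ω ∈ negDomain α n) {m : ℕ} (hm : m ≤ 2 * n + 2) :
    MSmb (coeffMat (negCoeffs α ω) m) := by
  obtain ⟨j, rfl | rfl⟩ := Nat.even_or_odd' m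
  · rw [funext (coeffMat_even _ j)]
    exact mCls_bDiag.2 ⟨smb_negCoeffs_a h (by omega), mSmb_negCoeffs_d h (by omega)⟩
  · rw [funext (coeffMat_odd _ j)]
    exact mCls_bOff.2 (vSmb_negCoeffs h (by omega))

theorem mSch_negDer (h : ω ∈ negDomain α n) {m : ℕ} (hm : m ≤ 2 * n + 1) :
    MSch (negDer α ω m) := by
  obtain ⟨j, rfl | rfl⟩ := Nat.even_or_odd' m
  · rcases j with _ | j
    · exact MCls.zero
    · obtain ⟨hc, hb⟩ := vSmb_negCoeffs h (j := j) (by omega)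
      rw [funext (negDer_even j)]
      exact mCls_bDiag.2 ⟨sch_negA' hc hb, mSch_negD' hc hb⟩
  · rcases j with _ | j
    · rw [mul_zero, zero_add, funext negDer_one]
      exact mCls_bOff.2 ⟨fun j => ((sch_r ω j).const_mul α).neg, fun j => (sch_q ω j).const_mul α⟩
    · obtain ⟨hc, hb⟩ := vSch_negCoeffs h (j := j) (by omega)
      rw [funext (negDer_odd j)]
      exact mCls_bOff.2 ⟨vSch_negC' _ hc hb, vSch_negB' _ hc hb⟩

theorem bOff_invD (c b : ℝ → Vec N) (x : ℝ) (i j : Unit ⊕ Fin N) :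
    bOff (fun k => invD (fun y => c y k) x) (fun k => invD (fun y => b y k) x) i j =
      invD (fun y => bOff (c y) (b y) i j) x := by
  rcases i with i | i <;> rcases j with j | j
  · exact (invD_zero x).symm
  · rfl
  · rfl
  · exact (invD_zero x).symm

theorem bDiag_invD (a : ℝ → ℂ) (d : ℝ → Matrix (Fin N) (Fin N) ℂ) (x : ℝ)
    (i j : Unit ⊕ Fin N) :
    bDiag (invD a x) (invDMat d x) i j = invD (fun y => bDiag (a y) (d y) i j) x := by
  rcases i with i | i <;> rcases j with j | j
  · rfl
  · exact (invD_zero x).symm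
  · exact (invD_zero x).symm
  · rfl

/-- All coefficients but the constant one are mean primitives. -/
theorem negW_eq_invD {m : ℕ} (hm : 1 ≤ m) (x : ℝ) (i j : Unit ⊕ Fin N) :
    coeffMat (negCoeffs α ω) m x i j = invD (fun y => negDer α ω m y i j) x := by
  obtain ⟨k, rfl | rfl⟩ := Nat.even_or_odd' m
  · obtain ⟨k, rfl⟩ : ∃ l, k = l + 1 := ⟨k - 1, by omega⟩
    simp only [negDer_even]
    rw [coeffMat_even, ← bDiag_invD]
    rfl
  · rcases k with _ | k
    · simp only [mul_zero, zero_add, negDer_one]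
      rw [coeffMat_one, ← bOff_invD]
      have e : ∀ j, invD (fun y => -(α * rOf ω y j)) x = -(α * invD (fun y => rOf ω y j) x) :=
        fun j => by simpa only [neg_mul] using invD_const_mul (-α) (fun y => rOf ω y j) x
      simp only [invD_const_mul, e]
      rfl
    · simp only [negDer_odd]
      rw [coeffMat_odd, ← bOff_invD]
      rfl

theorem mSch_negW (hα : α ≠ 0) (h : ω ∈ negDomain α n) {m : ℕ} (h1 : 1 ≤ m) (hm : m ≤ 2 * n) :
    MSch (coeffMat (negCoeffs α ω) m) := (negW_square hα h m h1 (by omega)).2 hm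

/-- Along a curve in the phase space of the `n`-th flow the coefficients vary differentiably. They
are mean primitives, and as long as these are rapidly decreasing, which by `negW_square` is the
case up to the index `2 n`, differentiability in the topology of rapidly decreasing functions is
not lost. -/
theorem exists_varDer_negW (hα : α ≠ 0) (hP : ∀ ε, γ ε ∈ negDomain α n)
    (hγ : Tendsto (fun ε : ℝ => ε⁻¹ • (γ ε - γ 0)) (𝓝[≠] 0) (𝓝 φ)) (m : ℕ) : m ≤ 2 * n + 1 →
    ∃ V, MVarDer {0} (fun ε => coeffMat (negCoeffs α (γ ε)) m) V ∧
      (m ≤ 2 * n → MVarDer Set.univ (fun ε => coeffMat (negCoeffs α (γ ε)) m) V) := by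
  have hu : 0 ∈ (Set.univ : Set ℕ) := trivial
  induction m using Nat.strong_induction_on with
  | _ m ih =>
  intro hm
  rcases Nat.eq_zero_or_pos m with rfl | h1
  · have : ∀ K, MVarDer K (fun ε => coeffMat (negCoeffs α (γ ε)) 0) fun _ => 0 := fun K =>
      (MVarDer.const (MCls.const ((α / 2) • sigma3))).congr_fun fun ε x => (negW_zero x).symm
    exact ⟨_, this _, fun _ => this _⟩
  · obtain ⟨D, hD⟩ : ∃ D, MVarDer Set.univ (fun ε => negDer α (γ ε) m) D := by
      match m, h1 with
      | 1, _ =>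
        obtain ⟨V, -, hV⟩ := ih 0 one_pos (by omega)
        exact ⟨_, (mVarDer_matQ hγ).comm hu (hV (by omega))⟩
      | m + 2, _ =>
        obtain ⟨V, -, hV⟩ := ih m (by omega) (by omega)
        obtain ⟨V', -, hV'⟩ := ih (m + 1) (by omega) (by omega)
        exact ⟨_, ((hV (by omega)).const_comm hu (I • sigma3)).add
          ((mVarDer_matQ hγ).comm hu (hV' (by omega)))⟩
    have hs : ∀ ε, MSch (negDer α (γ ε) m) := fun ε => mSch_negDer (hP ε) hm
    refine ⟨fun x => of fun i j => invD (fun y => D y i j) x, fun i j => ?_, fun hm i j => ?_⟩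
    · exact ((hD i j).invD fun ε => hs ε i j).congr_fun fun ε x => (negW_eq_invD h1 x i j).symm
    · refine ((hD i j).invD_sch (fun ε => hs ε i j) fun ε => ?_).congr_fun
        fun ε x => (negW_eq_invD h1 x i j).symm
      have h := mSch_negW hα (hP ε) h1 hm i j
      rwa [funext fun x => negW_eq_invD (α := α) (ω := γ ε) h1 x i j] at h

theorem trace_negDensity (hn : n ≠ 0) (x : ℝ) :
    negDensity α n ω x = (1 / (2 * ((n : ℂ) + 1))) *
      (2 * ((I • sigma3) * coeffMat (negCoeffs α ω) (2 * n) x).trace +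
        (matQ ω x * coeffMat (negCoeffs α ω) (2 * n + 1) x).trace) := by
  rw [negDensity, if_neg hn, coeffMat_even, coeffMat_odd,
    trace_sigma_mul_bDiag, matQ_eq, trace_bOff_mul_bOff]
  ring

/-- The variation of `negDer`, `v` being the variation of the coefficients. -/
def negVarDer (α : ℂ) (ω φ : Phase N) (v : ℕ → ℝ → BMat N) : ℕ → ℝ → BMat N
  | 0, _ => 0
  | 1, x => comm (matQ ω x) (v 0 x) + comm (matQ φ x) (coeffMat (negCoeffs α ω) 0 x)
  | m + 2, x => comm (I • sigma3) (v m x) + comm (matQ ω x) (v (m + 1) x) +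
      comm (matQ φ x) (coeffMat (negCoeffs α ω) (m + 1) x)

theorem conv_congr_of_zero {f g g' : ℕ → BMat N} (h0 : f 0 = 0) {m : ℕ}
    (h : ∀ k ≤ m, g k = g' k) : conv f g (m + 1) = conv f g' (m + 1) := by
  refine Finset.sum_congr rfl fun p hp => ?_
  have hp' := Finset.HasAntidiagonal.mem_antidiagonal.1 hp
  rcases Nat.eq_zero_or_pos p.1 with h1 | h1
  · rw [h1, h0, zero_mul, zero_mul]
  · rw [h p.2 (by omega)]

/-- If the first series has no constant coefficient, the top coefficient of the second one does
not enter the product. -/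
theorem mDeriv_conv_of_zero {w w' v v' : ℕ → ℝ → BMat N} (m : ℕ) (h0 : ∀ x, w 0 x = 0)
    (h0' : ∀ x, w' 0 x = 0) (h : ∀ k ≤ m + 1, MDeriv (w k) (w' k))
    (h' : ∀ k ≤ m, MDeriv (v k) (v' k)) :
    MDeriv (fun x => conv (fun k => w k x) (fun k => v k x) (m + 1)) fun x =>
      conv (fun k => w' k x) (fun k => v k x) (m + 1) +
        conv (fun k => w k x) (fun k => v' k x) (m + 1) := by
  have key : ∀ (f : ℕ → ℝ → BMat N) (v : ℕ → ℝ → BMat N), (∀ x, f 0 x = 0) → ∀ x,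
      conv (fun k => f k x) (fun k => (if k ≤ m then v k else fun _ => 0) x) (m + 1) =
        conv (fun k => f k x) (fun k => v k x) (m + 1) := fun f v hf x =>
    conv_congr_of_zero (hf x) fun k hk => by rw [if_pos hk]
  have := mDeriv_conv (v := fun k => if k ≤ m then v k else fun _ => 0)
    (v' := fun k => if k ≤ m then v' k else fun _ => 0) (m + 1) h fun k _ => by
      by_cases hk : k ≤ m
      · simpa only [if_pos hk] using h' k hk
      · simpa only [if_neg hk] using MDeriv.const 0
  rw [funext (key w v h0)] at this
  exact this.congr fun x => by rw [key w' v h0' x, key w v' h0 x]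

/-- The densities of the negative hierarchy vary by the gradient up to a total derivative. -/
theorem hasVarDeriv_neg_of_ne_zero (hα : α ≠ 0) (hn : n ≠ 0) (hω : ω ∈ negDomain α n) :
    Integrable (negDensity α n ω) ∧ HasVarDeriv (negDomain α n) (negH α n) ω (negGrad α n ω) := by
  have hu : 0 ∈ (Set.univ : Set ℕ) := trivial
  have h0 : 0 ∈ ({0} : Set ℕ) := rfl
  have hdens : ∀ {ω : Phase N}, ω ∈ negDomain α n → Sch (negDensity α n ω) := fun {ω} hω => by
    rw [funext (trace_negDensity hn)]
    exact ((((MCls.mul' (MCls.const _) (mSch_negW hα hω (by omega) le_rfl)).trace).const_mul 2).add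
      (((mSch_matQ ω).mul (mSmb_negW hω (by omega))).trace)).const_mul _
  refine ⟨(hdens hω).integrable, ?_⟩
  rintro γ φ hP rfl hγ
  have hφ : IsSchwartz φ := ⟨φ, rfl⟩
  have hG := vSmb_negCoeffs hω le_rfl
  have hpair : Sch fun x => pair (negGrad α n (γ 0) x) (φ x) :=
    (VCls.dotProduct' hG.1 hφ.vSch.1).add (VCls.dotProduct' hG.2 hφ.vSch.2)
  refine ⟨hpair.integrable, ?_⟩
  choose! V hV hV' using exists_varDer_negW hα hP hγ
  have hQ := mVarDer_matQ hγ
  -- the linearisation of the stationary equation and of `W² = α² / 4`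
  have hVd : ∀ m ≤ 2 * n + 1, MDeriv (V m) (negVarDer α (γ 0) φ V m) := fun m hm => by
    refine (hV m hm).mDeriv (F' := fun ε => negDer α (γ ε) m)
      (fun ε => negW_mDeriv (hP ε) (by omega)) ?_
    match m with
    | 0 => exact MVarDer.const MCls.zero
    | 1 => exact hQ.bounded.comm h0 (hV 0 (by omega))
    | m + 2 =>
      exact (((hV m (by omega)).const_comm h0 (I • sigma3)).add
        (hQ.bounded.comm h0 (hV (m + 1) (by omega)))).congr_der fun x => (add_assoc _ _ _).symm
  have hanti : ∀ m < 2 * n + 2, ∀ x,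
      conv (fun k => V k x) (fun k => coeffMat (negCoeffs α (γ 0)) k x) m +
      conv (fun k => coeffMat (negCoeffs α (γ 0)) k x) (fun k => V k x) m = 0 := fun m hm => by
    refine (MVarDer.conv h0 m fun k hk => hV k (by omega)).unique ?_
    rcases Nat.eq_zero_or_pos m with rfl | hm0
    · refine (MVarDer.const (MCls.const (((α / 2) • sigma3) * ((α / 2) • sigma3)))).congr_fun
        fun ε x => ?_
      rw [conv_zero, negW_zero]
    · exact (MVarDer.const MCls.zero).congr_fun
        fun ε x => ((negW_square hα (hP ε) m hm0 (by omega)).1 x).symm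
  -- the coefficient of `tr (W Ẇ δW)` whose derivative is the error term; it decays although
  -- `V (2 n + 1)` does not, because the latter is multiplied by the first coefficient of `W`
  set u : ℕ → ℝ → BMat N := fun k x => conv (fun k => coeffMat (negCoeffs α (γ 0)) k x)
    (euler fun k => coeffMat (negCoeffs α (γ 0)) k x) k with hudef
  have hu0 : ∀ x, u 0 x = 0 := fun x => by simp [hudef, conv_zero, euler_apply]
  set Z : ℝ → ℂ := fun x => (conv (fun k => u k x) (fun k => V k x) (2 * n + 2)).trace with hZ
  have hZs : Sch Z := by
    refine MCls.trace (MCls.sum _ fun p hp => ?_)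
    have hp' := Finset.HasAntidiagonal.mem_antidiagonal.1 hp
    have hus : ∀ k ≤ 2 * n + 2, MSmb (u k) := fun k hk => MCls.sum _ fun p hp => by
      have hp' := Finset.HasAntidiagonal.mem_antidiagonal.1 hp
      exact (mSmb_negW hω (by omega)).mul ((mSmb_negW hω (by omega)).smul _)
    have h3 : p.1 = 0 ∨ p.2 ≤ 2 * n ∨ p.1 = 1 ∧ p.2 ≤ 2 * n + 1 := by omega
    rcases h3 with h | h | ⟨h, h2⟩
    · simp only [h, hu0, Matrix.zero_mul]
      exact MCls.zero
    · exact MCls.mul' (hus _ (by omega)) (hV' _ (by omega) h).cls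
    · have h1 := mSch_negW hα hω (m := 1) le_rfl (by omega)
      have hu1 : ∀ x, u 1 x =
          coeffMat (negCoeffs α (γ 0)) 0 x * coeffMat (negCoeffs α (γ 0)) 1 x := fun x => by
        simp [hudef, conv, Finset.Nat.antidiagonal_succ, euler_apply]
      simp only [h, hu1]
      exact (MCls.mul' (mSmb_negW hω (by omega)) h1).mul (hV _ h2).cls
  have hZd : ∀ x, HasDerivAt Z (2 * (α ^ 2 / 4) * ((((2 * n : ℕ) : ℂ) + 1) *
      (coeffMat (negCoeffs α (γ 0)) (2 * n + 1) x * matQ φ x).trace -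
        2 * ((I • sigma3) * V (2 * n) x).trace -
        (matQ (γ 0) x * V (2 * n + 1) x).trace)) x := fun x => by
    have hw : ∀ k ≤ 2 * n + 2, MDeriv (coeffMat (negCoeffs α (γ 0)) k) (negDer α (γ 0) k) :=
      fun k hk => negW_mDeriv hω hk
    have hud : ∀ k ≤ 2 * n + 2, MDeriv (u k) fun x =>
        conv (fun k => negDer α (γ 0) k x) (euler fun k => coeffMat (negCoeffs α (γ 0)) k x) k +
        conv (fun k => coeffMat (negCoeffs α (γ 0)) k x) (euler fun k => negDer α (γ 0) k x) k :=
      fun k hk => mDeriv_conv k (fun k hk' => hw k (hk'.trans hk))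
        fun k hk' => (hw k (hk'.trans hk)).smul (k : ℂ)
    have h1 := (mDeriv_conv_of_zero (2 * n + 1) hu0
      (fun x => by simp [conv_zero, euler_apply]) hud hVd).trace x
    have h2 := trace_identity_quadratic (A := I • sigma3) (Q := matQ (γ 0) x) (δQ := matQ φ x)
      (w := fun k => coeffMat (negCoeffs α (γ 0)) k x) (v := fun k => V k x) (c := α ^ 2 / 4)
      (w' := fun k => negDer α (γ 0) k x) (v' := fun k => negVarDer α (γ 0) φ V k x)
      rfl rfl (fun k => rfl) rfl rfl (fun k => rfl) (2 * n)
      (by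
        rw [conv_zero, negW_zero, Matrix.smul_mul, Matrix.mul_smul, sigma3_mul_self, smul_smul]
        congr 1
        ring)
      (fun k hk hk' => (negW_square hα hω k hk (by omega)).1 x) fun k hk => hanti k hk x
    exact h1.congr_deriv h2
  have hd : VarDer Set.univ (fun ε => negDensity α n (γ ε)) fun x => (1 / (2 * ((n : ℂ) + 1))) *
      (2 * ((I • sigma3) * V (2 * n) x).trace +
        (matQ φ x * coeffMat (negCoeffs α (γ 0)) (2 * n + 1) x +
          matQ (γ 0) x * V (2 * n + 1) x).trace) :=
    ((((((hV' (2 * n) (by omega) le_rfl).const_mul hu (I • sigma3)).trace).const_mul 2).add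
      ((hQ.mul_bounded (mSch_matQ _) (hV (2 * n + 1) le_rfl)).trace)).const_mul _).congr_fun
        fun ε x => (trace_negDensity hn x).symm
  refine (hd.integral fun ε => hdens (hP ε)).congr_deriv ?_
  have hn' : (n : ℂ) + 1 ≠ 0 := Nat.cast_add_one_ne_zero n
  have e : ∀ x, (1 / (2 * ((n : ℂ) + 1))) * (2 * ((I • sigma3) * V (2 * n) x).trace +
      (matQ φ x * coeffMat (negCoeffs α (γ 0)) (2 * n + 1) x +
        matQ (γ 0) x * V (2 * n + 1) x).trace) =
      pair (negGrad α n (γ 0) x) (φ x) + -(((n : ℂ) + 1) * α ^ 2)⁻¹ * deriv Z x := fun x => by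
    have hp : pair (negGrad α n (γ 0) x) (φ x) =
        (coeffMat (negCoeffs α (γ 0)) (2 * n + 1) x * matQ φ x).trace := by
      rw [coeffMat_odd, trace_bOff_mul_matQ]
      rfl
    rw [(hZd x).deriv, hp, Matrix.trace_add, Matrix.trace_mul_comm (matQ φ x)]
    push_cast
    field_simp
    ring
  rw [funext e, integral_add hpair.integrable (hZs.deriv.const_mul _).integrable,
    integral_const_mul, hZs.integral_deriv_eq_zero, mul_zero, add_zero]

/-- For `n = 0` the statement is the skew-symmetry of `∂⁻¹`. -/
theorem hasVarDeriv_neg_zero :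
    Integrable (negDensity α 0 ω) ∧ HasVarDeriv (negDomain α 0) (negH α 0) ω (negGrad α 0 ω) := by
  have hu : 0 ∈ (Set.univ : Set ℕ) := trivial
  have hdens : ∀ ω : Phase N, negDensity α 0 ω = fun x => ∑ j, α / 2 *
      (rOf ω x j * invD (fun y => qOf ω y j) x - qOf ω x j * invD (fun y => rOf ω y j) x) :=
    fun ω => by
      funext x
      rw [negDensity, if_pos rfl]
      simp only [negCoeffs, dotProduct, zero_add, Nat.cast_zero, mul_one]
      rw [← Finset.sum_add_distrib, Finset.mul_sum]
      exact Finset.sum_congr rfl fun j _ => by ring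
  have hs : ∀ ω : Phase N, Sch (negDensity α 0 ω) := fun ω => by
    rw [hdens]
    exact Cls.sum _ fun j _ => (((sch_r ω j).mul (sch_q ω j).invD).sub
      ((sch_q ω j).mul (sch_r ω j).invD)).const_mul _
  refine ⟨(hs ω).integrable, ?_⟩
  rintro γ φ - rfl hγ
  have hi : ∀ j, Integrable fun x => α *
      ((φ x).2 j * invD (fun y => qOf (γ 0) y j) x - (φ x).1 j * invD (fun y => rOf (γ 0) y j) x) :=
    fun j => ((((sch_snd φ j).mul (sch_q (γ 0) j).invD).sub
      ((sch_fst φ j).mul (sch_r (γ 0) j).invD)).const_mul _).integrable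
  have hp : ∀ x, pair (negGrad α 0 (γ 0) x) (φ x) = ∑ j, α *
      ((φ x).2 j * invD (fun y => qOf (γ 0) y j) x -
        (φ x).1 j * invD (fun y => rOf (γ 0) y j) x) := fun x => by
    simp only [pair, negGrad, negCoeffs, dotProduct]
    rw [← Finset.sum_add_distrib]
    exact Finset.sum_congr rfl fun j _ => by ring
  simp only [hp]
  refine ⟨integrable_finsetSum _ fun j _ => hi j, ?_⟩
  have hq : ∀ j, VarDer Set.univ (fun ε x => qOf (γ ε) x j) fun x => (φ x).1 j := fun j =>
    varDer_of_tendsto hγ (qCoord j)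
  have hr : ∀ j, VarDer Set.univ (fun ε x => rOf (γ ε) x j) fun x => (φ x).2 j := fun j =>
    varDer_of_tendsto hγ (rCoord j)
  have hd := VarDer.sum Finset.univ fun j _ =>
    (((hr j).mul_bounded (sch_r (γ 0) j) ((hq j).invD fun ε => sch_q (γ ε) j)).sub
      ((hq j).mul_bounded (sch_q (γ 0) j) ((hr j).invD fun ε => sch_r (γ ε) j))).const_mul (α / 2)
  refine ((hd.congr_fun (g := fun ε => negDensity α 0 (γ ε)) fun ε x => by
    rw [hdens]).integral fun ε => hs _).congr_deriv ?_
  have i1 : ∀ j, Integrable fun x => (φ x).2 j * invD (fun y => qOf (γ 0) y j) x := fun j =>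
    ((sch_snd φ j).mul (sch_q (γ 0) j).invD).integrable
  have i2 : ∀ j, Integrable fun x => rOf (γ 0) x j * invD (fun y => (φ y).1 j) x := fun j =>
    ((sch_r (γ 0) j).mul (sch_fst φ j).invD).integrable
  have i3 : ∀ j, Integrable fun x => (φ x).1 j * invD (fun y => rOf (γ 0) y j) x := fun j =>
    ((sch_fst φ j).mul (sch_r (γ 0) j).invD).integrable
  have i4 : ∀ j, Integrable fun x => qOf (γ 0) x j * invD (fun y => (φ y).2 j) x := fun j =>
    ((sch_q (γ 0) j).mul (sch_snd φ j).invD).integrable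
  have i5 : ∀ j, Integrable fun x => (φ x).2 j * invD (fun y => qOf (γ 0) y j) x +
      rOf (γ 0) x j * invD (fun y => (φ y).1 j) x := fun j => (i1 j).add (i2 j)
  have i6 : ∀ j, Integrable fun x => (φ x).1 j * invD (fun y => rOf (γ 0) y j) x +
      qOf (γ 0) x j * invD (fun y => (φ y).2 j) x := fun j => (i3 j).add (i4 j)
  have i7 : ∀ j, Integrable fun x => α / 2 *
      ((φ x).2 j * invD (fun y => qOf (γ 0) y j) x + rOf (γ 0) x j * invD (fun y => (φ y).1 j) x -
        ((φ x).1 j * invD (fun y => rOf (γ 0) y j) x +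
          qOf (γ 0) x j * invD (fun y => (φ y).2 j) x)) :=
    fun j => ((i5 j).sub (i6 j)).const_mul _
  rw [integral_finsetSum _ fun j _ => hi j, integral_finsetSum _ fun j _ => i7 j]
  refine Finset.sum_congr rfl fun j _ => ?_
  rw [integral_const_mul, integral_const_mul, integral_sub (i5 j) (i6 j),
    integral_add (i1 j) (i2 j), integral_add (i3 j) (i4 j), integral_sub (i1 j) (i3 j),
    integral_mul_invD (sch_r (γ 0) j) (sch_fst φ j),
    integral_mul_invD (sch_q (γ 0) j) (sch_snd φ j)]
  ring

theorem negCoeffs_alpha_zero (n : ℕ) : negCoeffs 0 ω n = ⟨fun _ => 0, fun _ => 0, fun _ => 0,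
    fun _ => 0⟩ := by
  induction n with
  | zero =>
    simp only [negCoeffs, Coeffs.mk.injEq]
    refine ⟨?_, ?_, ?_, ?_⟩ <;> funext x <;> simp <;> rfl
  | succ n ih =>
    rw [negCoeffs, ih, negStep]
    have hA : (invD fun _ => (0 : ℂ)) = fun _ => 0 := funext invD_zero
    simp only [Coeffs.mk.injEq, dotProduct_zero, zero_dotProduct, Pi.zero_apply, mul_zero, zero_mul,
      sub_zero, hA]
    refine ⟨by simp, ?_, ?_, ?_⟩
    · funext x; ext i j; simp
    · funext x j
      have e : (of fun _ _ => (0 : ℂ) : Matrix (Fin N) (Fin N) ℂ) = 0 := rfl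
      simp [e, invD_zero]
    · funext x j
      have e : (of fun _ _ => (0 : ℂ) : Matrix (Fin N) (Fin N) ℂ) = 0 := rfl
      simp [e, invD_zero]

theorem hasVarDeriv_neg (hω : ω ∈ negDomain α n) :
    Integrable (negDensity α n ω) ∧ HasVarDeriv (negDomain α n) (negH α n) ω (negGrad α n ω) := by
  rcases eq_or_ne n 0 with rfl | hn
  · exact hasVarDeriv_neg_zero
  rcases eq_or_ne α 0 with rfl | hα
  · have hd : ∀ ω : Phase N, negDensity 0 n ω = fun _ => 0 := fun ω => by
      funext x
      rw [negDensity, if_neg hn, negCoeffs_alpha_zero]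
      simp
    have hG : ∀ (φ : Phase N) (x : ℝ), pair (negGrad 0 n ω x) (φ x) = 0 := fun φ x => by
      simp [negGrad, negCoeffs_alpha_zero, pair]
    have hH : negH 0 n = fun _ : Phase N => 0 := by
      funext ω
      rw [negH, hd]
      simp
    refine ⟨by rw [hd]; exact integrable_zero _ _ _, fun γ φ _ _ _ => ?_⟩
    rw [funext (hG φ), hH]
    refine ⟨integrable_zero _ _ _, ?_⟩
    rw [integral_zero]
    exact hasDerivAt_const _ _
  · exact hasVarDeriv_neg_of_ne_zero hα hn hω

end NegVariation

/-! ### The first negative flow -/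

section FirstNegativeFlow

variable {N : ℕ} {α : ℂ} {ω : Phase N} {u v : ℝ → Vec N}

theorem Cls.conj {f : ℝ → ℂ} (hf : Sch f) : Sch fun x => (starRingEnd ℂ) (f x) := by
  obtain ⟨g, rfl⟩ := hf.exists_schwartzMap
  exact sch_schwartzMap (SchwartzMap.postcompCLM (𝕜 := ℝ) (conjCLE : ℂ →L[ℝ] ℂ) g)

theorem negGrad_zero_eq (hu : VSch u) (hv : VSch v) (hq : qOf ω = deriv u) (hr : rOf ω = deriv v) :
    (negCoeffs α ω 0).b = (fun x => α • u x) ∧ (negCoeffs α ω 0).c = fun x => -α • v x := by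
  have eq : ∀ j, invD (fun y => qOf ω y j) = fun x => u x j := fun j => by
    rw [hq, ← (hu j).invD_deriv]
    exact congrArg invD (funext fun y => hu.deriv_apply y j)
  have er : ∀ j, invD (fun y => rOf ω y j) = fun x => v x j := fun j => by
    rw [hr, ← (hv j).invD_deriv]
    exact congrArg invD (funext fun y => hv.deriv_apply y j)
  constructor
  · funext x j
    simp only [negCoeffs, eq]
    rfl
  · funext x j
    simp only [negCoeffs, er, Pi.smul_apply, smul_eq_mul, neg_mul]

theorem mem_negDomain_one (hu : VSch u) (hv : VSch v) (hq : qOf ω = deriv u)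
    (hr : rOf ω = deriv v) : ω ∈ negDomain α 1 := fun j hj => by
  obtain rfl : j = 0 := by omega
  obtain ⟨hb, hc⟩ := negGrad_zero_eq (α := α) hu hv hq hr
  refine isSchwartz_mk.2 ⟨?_, ?_⟩
  · rw [hc]
    exact hv.const_smul _
  · rw [hb]
    exact hu.const_smul _

/-- For `q = u_x`, `r = v_x` the first negative flow is local: the integrands of `a₁` and `d₁` are
the derivatives of `α vᵀ u` and of `-α u vᵀ`. -/
theorem opJ_negGrad_one (hu : VSch u) (hv : VSch v) (hq : qOf ω = deriv u) (hr : rOf ω = deriv v)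
    (x : ℝ) :
    opJ (negGrad α 1 ω) x =
      (-(2 * I * α) • u x + α • ((v x ⬝ᵥ u x) • qOf ω x + (v x ⬝ᵥ qOf ω x) • u x),
       -(2 * I * α) • v x - α • ((v x ⬝ᵥ u x) • rOf ω x + (u x ⬝ᵥ rOf ω x) • v x)) := by
  obtain ⟨hb, hc⟩ := negGrad_zero_eq (α := α) hu hv hq hr
  have hbS : VSch (negCoeffs α ω 0).b := hb ▸ hu.const_smul α
  have hcS : VSch (negCoeffs α ω 0).c := hc ▸ hv.const_smul (-α)
  have hu' : ∀ y j, HasDerivAt (fun y => u y j) (qOf ω y j) y := fun y j => hq ▸ hu.hasDerivAt y j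
  have hv' : ∀ y j, HasDerivAt (fun y => v y j) (rOf ω y j) y := fun y j => hr ▸ hv.hasDerivAt y j
  have ha : (negStep ω (negCoeffs α ω 0)).a = fun y => α * (v y ⬝ᵥ u y) := by
    have hS : Sch fun y => α * (v y ⬝ᵥ u y) := (hv.dotProduct hu.smb).const_mul α
    rw [← hS.invD_deriv]
    refine congrArg invD (funext fun y => Eq.symm (HasDerivAt.deriv ?_))
    have h : HasDerivAt (fun y => α * ∑ j, v y j * u y j)
        (α * ∑ j, (rOf ω y j * u y j + v y j * qOf ω y j)) y :=
      (HasDerivAt.fun_sum fun j _ => (hv' y j).mul (hu' y j)).const_mul α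
    refine h.congr_deriv ?_
    simp only [hb, hc, dotProduct_smul, smul_dotProduct, smul_eq_mul, Finset.sum_add_distrib]
    simp only [dotProduct]
    ring
  have hd : (negStep ω (negCoeffs α ω 0)).d = fun y => -α • vecMulVec (u y) (v y) := by
    funext y
    ext j k
    have hS : Sch fun y => -α * (u y j * v y k) := ((hu j).mul (hv k).smb).const_mul _
    refine Eq.trans ?_ (congrFun hS.invD_deriv y)
    refine congrArg (invD · y) (funext fun y => Eq.symm (HasDerivAt.deriv ?_))
    refine (((hu' y j).mul (hv' y k)).const_mul (-α)).congr_deriv ?_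
    simp only [hb, hc, Pi.smul_apply, smul_eq_mul]
    ring
  have hn := vSmb_negCoeffs (mem_negDomain_one (α := α) hu hv hq hr) (le_refl 1)
  rw [show opJ (negGrad α 1 ω) = _ from opJ_mk hn.1 hn.2]
  have h1 : deriv (negCoeffs α ω 1).b x = negB' ω (negCoeffs α ω 0) x := funext fun j =>
    (hn.2.hasDerivAt x j).unique (negStep_b_hasDerivAt _ hcS hbS x j)
  have h2 : deriv (negCoeffs α ω 1).c x = negC' ω (negCoeffs α ω 0) x := funext fun j =>
    (hn.1.hasDerivAt x j).unique (negStep_c_hasDerivAt _ hcS hbS x j)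
  refine Prod.ext (h1.trans ?_) (h2.trans ?_)
  · rw [negB', ha, hd, hb, smul_mulVec, vecMulVec_mulVec]
    funext j
    simp
    ring
  · rw [negC', ha, hd, hc, transpose_smul, transpose_vecMulVec, smul_mulVec, vecMulVec_mulVec]
    funext j
    simp
    ring

end FirstNegativeFlow

section FokasLenells

variable {σ : ℝ} {u : ℝ → 𝓢(ℝ, Vec 2)} {ω : ℝ → Phase 2}

/-- The second potential `v = (u₁*, σ u₂*)` of the Fokas–Lenells reduction. -/
def conjPotential (σ : ℝ) (u : Vec 2) : Vec 2 :=
  ![(starRingEnd ℂ) (u 0), σ * (starRingEnd ℂ) (u 1)]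

theorem vSch_potential (u : 𝓢(ℝ, Vec 2)) : VSch u := fun j =>
  sch_schwartzMap (SchwartzMap.postcompCLM (𝕜 := ℝ)
    (ContinuousLinearMap.proj (R := ℝ) (φ := fun _ : Fin 2 => ℂ) j) u)

theorem vSch_conjPotential {u : ℝ → Vec 2} (hu : VSch u) : VSch fun x => conjPotential σ (u x) :=
  Fin.forall_fin_two.2 ⟨(hu 0).conj, (hu 1).conj.const_mul σ⟩

theorem IsFLReduction.rOf_eq (h : IsFLReduction σ u ω) (t : ℝ) :
    rOf (ω t) = deriv fun x => conjPotential σ (u t x) := by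
  have hu := vSch_potential (u t)
  funext x
  rw [(h t x).2]
  refine funext <| Fin.forall_fin_two.2
    ⟨HasDerivAt.unique ?_ ((vSch_conjPotential (σ := σ) hu).hasDerivAt x 0),
      HasDerivAt.unique ?_ ((vSch_conjPotential (σ := σ) hu).hasDerivAt x 1)⟩
  · exact (hu.hasDerivAt x 0).star
  · exact (hu.hasDerivAt x 1).star.const_mul _

theorem IsFLReduction.mem_negDomain (h : IsFLReduction σ u ω) (α : ℂ) (t : ℝ) :
    ω t ∈ negDomain α 1 :=
  mem_negDomain_one (vSch_potential (u t)) (vSch_conjPotential (vSch_potential (u t)))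
    (funext fun x => (h t x).1) (h.rOf_eq t)

/-- The first negative flow at the point `(p, d) = (u, u_x)`. Its `r`-component is the complex
conjugate of the `q`-component, hence redundant. -/
theorem firstNegativeFlow_conj (p d : Vec 2) :
    -(-(2 * I * (I / 2)) • conjPotential σ p - (I / 2) •
        ((conjPotential σ p ⬝ᵥ p) • conjPotential σ d + (p ⬝ᵥ conjPotential σ d) •
          conjPotential σ p)) =
      conjPotential σ (-(-(2 * I * (I / 2)) • p + (I / 2) •
        ((conjPotential σ p ⬝ᵥ p) • d + (conjPotential σ p ⬝ᵥ d) • p))) := by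
  refine funext <| Fin.forall_fin_two.2 ⟨?_, ?_⟩ <;>
  · simp only [conjPotential, dotProduct, Fin.sum_univ_two, Pi.neg_apply, Pi.add_apply,
      Pi.sub_apply, Pi.smul_apply, smul_eq_mul, cons_val_zero, cons_val_one, map_neg, map_add,
      map_mul, map_div₀, conj_I, conj_ofReal, Complex.conj_conj, map_ofNat]
    ring

theorem isFlow_iff_coupledFL (h : IsFLReduction σ u ω) :
    IsFlow ω (fun η => -opJ (negGrad (I / 2) 1 η)) ↔ CoupledFL σ u := by
  have hω : ∀ t x, ω t x = (deriv (u t) x, conjPotential σ (deriv (u t) x)) := fun t x =>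
    Prod.ext (h t x).1 (h t x).2
  refine forall₂_congr fun t x => ?_
  set p := u t x
  set d := deriv (u t) x
  set G : Vec 2 := -(-(2 * I * (I / 2)) • p + (I / 2) •
    ((conjPotential σ p ⬝ᵥ p) • d + (conjPotential σ p ⬝ᵥ d) • p)) with hG
  have hJ : (-opJ (negGrad (I / 2) 1 (ω t))) x = (G, conjPotential σ G) := by
    rw [Pi.neg_apply, opJ_negGrad_one (vSch_potential (u t)) (vSch_conjPotential (σ := σ)
      (vSch_potential (u t))) (funext fun x => (h t x).1) (h.rOf_eq t) x,
      show qOf (ω t) x = d from (h t x).1, show rOf (ω t) x = conjPotential σ d from (h t x).2]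
    exact Prod.ext rfl (firstNegativeFlow_conj p d)
  have hn : ∀ z : ℂ, (‖z‖ : ℂ) ^ 2 = z * (starRingEnd ℂ) z := fun z => (Complex.mul_conj' z).symm
  have e0 : ∀ w : ℂ, w + p 0 + I * ((‖p 0‖ : ℂ) ^ 2 + 1 / 2 * σ * (‖p 1‖ : ℂ) ^ 2) * d 0 +
      I / 2 * σ * p 0 * (starRingEnd ℂ) (p 1) * d 1 = w - G 0 := fun w => by
    simp only [hG, conjPotential, dotProduct, Fin.sum_univ_two, Pi.neg_apply, Pi.add_apply,
      Pi.smul_apply, smul_eq_mul, cons_val_zero, cons_val_one, hn]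
    linear_combination p 0 * I_mul_I
  have e1 : ∀ w : ℂ, w + p 1 + I * (σ * (‖p 1‖ : ℂ) ^ 2 + 1 / 2 * (‖p 0‖ : ℂ) ^ 2) * d 1 +
      I / 2 * p 1 * (starRingEnd ℂ) (p 0) * d 0 = w - G 1 := fun w => by
    simp only [hG, conjPotential, dotProduct, Fin.sum_univ_two, Pi.neg_apply, Pi.add_apply,
      Pi.smul_apply, smul_eq_mul, cons_val_zero, cons_val_one, hn]
    linear_combination p 1 * I_mul_I
  simp only [e0, e1, sub_eq_zero]
  change HasDerivAt (fun s => ω s x) ((-opJ (negGrad (I / 2) 1 (ω t))) x) t ↔ _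
  rw [hJ, funext fun s => hω s x]
  constructor
  · intro H
    have H1 := hasDerivAt_pi.1 H.fst
    exact ⟨_, _, H1 0, H1 1, rfl, rfl⟩
  · rintro ⟨_, _, H0, H1, rfl, rfl⟩
    exact HasDerivAt.prodMk (hasDerivAt_pi.2 <| Fin.forall_fin_two.2 ⟨H0, H1⟩)
      (hasDerivAt_pi.2 <| Fin.forall_fin_two.2 ⟨H0.star, H1.star.const_mul _⟩)

end FokasLenells

end KaupNewell

end

theorem mainTheorem8 (N : ℕ) (α : ℂ) :
    -- Positive hierarchy.
    (∀ ω : Phase N,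
      (∀ k : ℤ, StationaryAt ω (posSeries α ω) k) ∧
      (∀ f : Phase N, IsSchwartz (opL ω f)) ∧
      (∀ (k : ℕ) (f g : Phase N), SkewOn (fun h => opJ ((opL ω)^[k] h)) f g) ∧
      ∀ n : ℕ,
        Integrable (posDensity α n ω) ∧
        HasVarDeriv Set.univ (posH α n) ω (posGrad α n ω) ∧
        ∀ k ≤ n, posGrad α n ω = (opL ω)^[k] (posGrad α (n - k) ω)) ∧
    (∀ (n : ℕ) (ω : ℝ → Phase N),
      ZeroCurvature ω (posV α n) ↔ IsFlow ω (fun η => opJ (posGrad α n η))) ∧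
    -- Negative hierarchy.
    (∀ ω : Phase N,
      (∀ (k : ℕ) (f g : Phase N),
        (∀ j < k, IsSchwartz ((opK ω)^[j] f) ∧ IsSchwartz ((opK ω)^[j] g)) →
        SkewOn (fun h => opJ ((opK ω)^[k] h)) f g) ∧
      ∀ n : ℕ, ω ∈ negDomain α n →
        (∀ k : ℤ, -(2 * (n : ℤ) + 2) ≤ k → StationaryAt ω (negSeries α ω) k) ∧
        Integrable (negDensity α n ω) ∧
        HasVarDeriv (negDomain α n) (negH α n) ω (negGrad α n ω) ∧
        ∀ k ≤ n, negGrad α n ω = (opK ω)^[k] (negGrad α (n - k) ω)) ∧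
    (∀ (n : ℕ) (ω : ℝ → Phase N), (∀ t, ω t ∈ negDomain α n) →
      (ZeroCurvature ω (negV α n) ↔ IsFlow ω (fun η => -opJ (negGrad α n η)))) ∧
    -- The first negative flow is the coupled Fokas-Lenells equation.
    (∀ σ : ℝ, σ = 1 ∨ σ = -1 →
      ∀ (u : ℝ → 𝓢(ℝ, Vec 2)) (ω : ℝ → Phase 2), IsFLReduction σ u ω →
        (∀ t, ω t ∈ negDomain (I / 2) 1) ∧
        (IsFlow ω (fun η => -opJ (negGrad (I / 2) 1 η)) ↔ CoupledFL σ u)) := by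
  refine ⟨fun ω => ⟨stationaryAt_pos, fun f => IsSchwartz.opL ⟨f, rfl⟩, skewOn_opL,
      fun n => ⟨(hasVarDeriv_pos n).1, (hasVarDeriv_pos n).2, fun k hk => ?_⟩⟩,
    zeroCurvature_pos_iff,
    fun ω => ⟨skewOn_opK, fun n h => ⟨stationaryAt_neg h, (hasVarDeriv_neg h).1,
      (hasVarDeriv_neg h).2, fun k hk => ?_⟩⟩,
    zeroCurvature_neg_iff,
    fun σ _ u ω h => ⟨h.mem_negDomain (I / 2), isFlow_iff_coupledFL h⟩⟩
  · have := posGrad_eq_iterate (α := α) (ω := ω) k (n - k)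
    rwa [Nat.sub_add_cancel hk] at this
  · have := negGrad_eq_iterate h k (n - k) (by omega)
    rwa [Nat.sub_add_cancel hk] at this
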